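/- **Setting.** Let $\mathfrak C_{\mathbb C}$ be the complexified Cayley algebra with basis $e_0,\dots,e_7$, where $e_0$ is the unit, $e_i^2=-e_0$ for $i\ge 1$, and $e_ie_j=-e_je_i=e_k$ whenever $(i,j,k)$ is a cyclic permutation of one of $(1,2,3),(1,4,5),(1,6,7),(2,5,7),(2,6,4),(3,5,6),(3,4,7)$. Let $SO(8,\mathbb C)=\{g\in SL(8,\mathbb C):{}^tgg=I_8\}$ act on $\mathfrak C_{\mathbb C}\cong\mathbb C^8$, and put $SO(7,\mathbb C)=\{g\in SO(8,\mathbb C): ge_0=e_0\}$, $Spin(7,\mathbb C)=\{g\in SO(8,\mathbb C):\exists g_0\in SO(7,\mathbb C)\ \forall x,y\ (g_0x)(gy)=g(xy)\}$, $G_2(\mathbb C)=\{g\in SO(8,\mathbb C):\forall x,y\ (gx)(gy)=g(xy)\}$, $SL(3,\mathbb C)=\{g\in G_2(\mathbb C):ge_1=e_1\}$. The reductive spherical pairs $(G_{\mathbb C},H_{\mathbb C})$ of rank-one type are $(SO(7,\mathbb C),G_2(\mathbb C))$, $(Spin(7,\mathbb C),G_2(\mathbb C))$ and $(G_2(\mathbb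 C),SL(3,\mathbb C))$. Let $G_u=\{g\in G_{\mathbb C}:\overline g=g\}$, a compact Lie group acting on $D=G_{\mathbb C}/H_{\mathbb C}$ by left translation. Put $d_\theta=\begin{pmatrix}\cosh\theta&-\sqrt{-1}\sinh\theta\\ \sqrt{-1}\sinh\theta&\cosh\theta\end{pmatrix}$ and let $A$ be, respectively for the three pairs, $\{\operatorname{diag}(I_2,d_\theta,d_\theta,d_\theta):\theta\in\mathbb R\}$, $\{\operatorname{diag}(d_\theta,d_{-\theta/3},d_{-\theta/3},d_{-\theta/3}):\theta\in\mathbb R\}$, and the set of matrices $t_\theta$ ($\theta\in\mathbb R$) that fix $e_0,e_3$ and act by $d_\theta$ on $(e_1,e_2)$ and by $d_{-\theta/2}$ on $(e_4,e_7)$ and on $(e_5,e_6)$. Let $\sigma_0(g)=I_{+-}\overline gI_{+-}$ with $I_{+-}=\operatorname{diag}(1,-1,1,-1,1,-1,1,-1)$. A holomorphic action of a Lie group $G$ on a connected complex manifold $D$ is *strongly visible* if there are a real submanifold $S\subset D$ (a *slice*) and an anti-holomorphic diffeomorphism $\sigma$ of $D$ with $D=G\cdot S$, $\sigma|_S=\mathrm{id}_S$,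 and $\sigma(x)\in G\cdot x$ for all $x\in D$. **Theorem.** Let $(G_{\mathbb C},H_{\mathbb C})$ be a reductive spherical pair of rank-one type. Then $A\subset G_{\mathbb C}$, $G_{\mathbb C}=G_uAH_{\mathbb C}$, and the action of the compact Lie group $G_u$ on the connected complex manifold $D=G_{\mathbb C}/H_{\mathbb C}$ (with its quotient complex structure) is strongly visible. More precisely, $S=AH_{\mathbb C}/H_{\mathbb C}$ is a one-dimensional real submanifold of $D$, $\sigma_0$ maps $G_{\mathbb C}$ to itself and induces an anti-holomorphic diffeomorphism $\sigma(gH_{\mathbb C})=\sigma_0(g)H_{\mathbb C}$ of $D$, and the three conditions above hold for this $S$ and this $\sigma$. -/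

import Mathlib

open scoped Manifold ContDiff Topology

noncomputable section

/-! ### The complexified Cayley algebra and the matrix groups -/

/-- The group `SL(8, ℂ)`, with its topology induced from the space of matrices. -/
abbrev SL8 : Type := Matrix.SpecialLinearGroup (Fin 8) ℂ

/-- The product of the complexified Cayley algebra `ℂ e₀ ⊕ ⋯ ⊕ ℂ e₇` in coordinates: `e₀` is the
unit, `eᵢ² = -e₀` and `eᵢ eⱼ = -eⱼ eᵢ = eₖ` for `(i, j, k)` a cyclic permutation of one of
`(1,2,3), (1,4,5), (1,6,7), (2,5,7), (2,6,4), (3,5,6), (3,4,7)`. -/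
def octMul (x y : Fin 8 → ℂ) : Fin 8 → ℂ :=
  ![x 0 * y 0 - x 1 * y 1 - x 2 * y 2 - x 3 * y 3 - x 4 * y 4 - x 5 * y 5 - x 6 * y 6 - x 7 * y 7,
    x 0 * y 1 + x 1 * y 0 + x 2 * y 3 - x 3 * y 2 + x 4 * y 5 - x 5 * y 4 + x 6 * y 7 - x 7 * y 6,
    x 0 * y 2 - x 1 * y 3 + x 2 * y 0 + x 3 * y 1 - x 4 * y 6 + x 5 * y 7 + x 6 * y 4 - x 7 * y 5,
    x 0 * y 3 + x 1 * y 2 - x 2 * y 1 + x 3 * y 0 + x 4 * y 7 + x 5 * y 6 - x 6 * y 5 - x 7 * y 4,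
    x 0 * y 4 - x 1 * y 5 + x 2 * y 6 - x 3 * y 7 + x 4 * y 0 + x 5 * y 1 - x 6 * y 2 + x 7 * y 3,
    x 0 * y 5 + x 1 * y 4 - x 2 * y 7 - x 3 * y 6 - x 4 * y 1 + x 5 * y 0 + x 6 * y 3 + x 7 * y 2,
    x 0 * y 6 - x 1 * y 7 - x 2 * y 4 + x 3 * y 5 + x 4 * y 2 - x 5 * y 3 + x 6 * y 0 + x 7 * y 1,
    x 0 * y 7 + x 1 * y 6 + x 2 * y 5 + x 3 * y 4 - x 4 * y 3 - x 5 * y 2 - x 6 * y 1 + x 7 * y 0]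

/-- The standard basis vector `eᵢ`. -/
def octE (i : Fin 8) : Fin 8 → ℂ := Pi.single i 1

/-- The action of a matrix on a coordinate vector. -/
def act (g : SL8) (x : Fin 8 → ℂ) : Fin 8 → ℂ := Matrix.mulVec (g : Matrix (Fin 8) (Fin 8) ℂ) x

theorem act_one (x : Fin 8 → ℂ) : act 1 x = x := by simp [act]

theorem act_mul (g h : SL8) (x : Fin 8 → ℂ) : act (g * h) x = act g (act h x) := by
  simp [act, Matrix.mulVec_mulVec]

theorem act_inv_act (g : SL8) (x : Fin 8 → ℂ) : act g⁻¹ (act g x) = x := by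
  rw [← act_mul, inv_mul_cancel, act_one]

theorem act_act_inv (g : SL8) (x : Fin 8 → ℂ) : act g (act g⁻¹ x) = x := by
  rw [← act_mul, mul_inv_cancel, act_one]

/-- `SO(8, ℂ) = {g ∈ SL(8, ℂ) : ᵗg g = 1}`. -/
def SO8 : Subgroup SL8 where
  carrier := {g | (g : Matrix (Fin 8) (Fin 8) ℂ).transpose * (g : Matrix (Fin 8) (Fin 8) ℂ) = 1}
  one_mem' := by simp
  mul_mem' := by
    intro a b ha hb
    simp only [Set.mem_ofPred_eq, Matrix.SpecialLinearGroup.coe_mul, Matrix.transpose_mul] at *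
    calc _ = (b : Matrix (Fin 8) (Fin 8) ℂ).transpose *
          ((a : Matrix (Fin 8) (Fin 8) ℂ).transpose * (a : Matrix (Fin 8) (Fin 8) ℂ)) *
          (b : Matrix (Fin 8) (Fin 8) ℂ) := by simp only [Matrix.mul_assoc]
      _ = 1 := by rw [ha, Matrix.mul_one, hb]
  inv_mem' := by
    intro a ha
    simp only [Set.mem_ofPred_eq] at *
    have h1 : (a : Matrix (Fin 8) (Fin 8) ℂ) * ((a⁻¹ : SL8) : Matrix (Fin 8) (Fin 8) ℂ) = 1 := by
      rw [← Matrix.SpecialLinearGroup.coe_mul, mul_inv_cancel, Matrix.SpecialLinearGroup.coe_one]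
    have h2 : ((a⁻¹ : SL8) : Matrix (Fin 8) (Fin 8) ℂ)
        = (a : Matrix (Fin 8) (Fin 8) ℂ).transpose := by
      calc _ = ((a : Matrix (Fin 8) (Fin 8) ℂ).transpose * (a : Matrix (Fin 8) (Fin 8) ℂ)) *
            ((a⁻¹ : SL8) : Matrix (Fin 8) (Fin 8) ℂ) := by rw [ha, Matrix.one_mul]
        _ = _ := by rw [Matrix.mul_assoc, h1, Matrix.mul_one]
    rw [h2, Matrix.transpose_transpose, ← h2, h1]

/-- `SO(7, ℂ)`, the stabilizer of `e₀` in `SO(8, ℂ)`. -/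
def SO7 : Subgroup SL8 where
  carrier := {g | g ∈ SO8 ∧ act g (octE 0) = octE 0}
  one_mem' := ⟨one_mem _, act_one _⟩
  mul_mem' := fun ha hb => ⟨mul_mem ha.1 hb.1, by rw [act_mul, hb.2, ha.2]⟩
  inv_mem' := fun {a} ha => ⟨inv_mem ha.1, by
    conv_lhs => rw [← ha.2]
    exact act_inv_act _ _⟩

/-- `Spin(7, ℂ)`, realized as the group of all `g ∈ SO(8, ℂ)` for which there is `g₀ ∈ SO(7, ℂ)`
with `(g₀ x)(g y) = g (x y)` for all `x, y`. -/
def Spin7 : Subgroup SL8 where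
  carrier := {g | g ∈ SO8 ∧ ∃ g₀ ∈ SO7, ∀ x y, octMul (act g₀ x) (act g y) = act g (octMul x y)}
  one_mem' := ⟨one_mem _, 1, one_mem _, fun x y => by simp [act_one]⟩
  mul_mem' := by
    rintro a b ⟨ha, a₀, ha₀, hA⟩ ⟨hb, b₀, hb₀, hB⟩
    exact ⟨mul_mem ha hb, a₀ * b₀, mul_mem ha₀ hb₀, fun x y => by simp only [act_mul, hA, hB]⟩
  inv_mem' := by
    rintro a ⟨ha, a₀, ha₀, hA⟩
    refine ⟨inv_mem ha, a₀⁻¹, inv_mem ha₀, fun x y => ?_⟩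
    have h := hA (act a₀⁻¹ x) (act a⁻¹ y)
    rw [act_act_inv, act_act_inv] at h
    rw [h, act_inv_act]

/-- `G₂(ℂ)`, the group of all `g ∈ SO(8, ℂ)` that are automorphisms of the complexified Cayley
algebra. -/
def G2 : Subgroup SL8 where
  carrier := {g | g ∈ SO8 ∧ ∀ x y, octMul (act g x) (act g y) = act g (octMul x y)}
  one_mem' := ⟨one_mem _, fun x y => by simp [act_one]⟩
  mul_mem' := by
    rintro a b ⟨ha, hA⟩ ⟨hb, hB⟩
    exact ⟨mul_mem ha hb, fun x y => by simp only [act_mul, hA, hB]⟩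
  inv_mem' := by
    rintro a ⟨ha, hA⟩
    refine ⟨inv_mem ha, fun x y => ?_⟩
    have h := hA (act a⁻¹ x) (act a⁻¹ y)
    rw [act_act_inv, act_act_inv] at h
    rw [h, act_inv_act]

/-- `SL(3, ℂ)`, realized as the stabilizer of `e₁` in `G₂(ℂ)`. -/
def SL3 : Subgroup SL8 where
  carrier := {g | g ∈ G2 ∧ act g (octE 1) = octE 1}
  one_mem' := ⟨one_mem _, act_one _⟩
  mul_mem' := fun ha hb => ⟨mul_mem ha.1 hb.1, by rw [act_mul, hb.2, ha.2]⟩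
  inv_mem' := fun {a} ha => ⟨inv_mem ha.1, by
    conv_lhs => rw [← ha.2]
    exact act_inv_act _ _⟩

/-- The Cartan involution `θ(g) = ḡ` (entrywise complex conjugation). -/
def cartanInv : SL8 →* SL8 := Matrix.SpecialLinearGroup.map (starRingEnd ℂ)

/-- The matrix `I₊₋ = diag(1, -1, 1, -1, 1, -1, 1, -1)`. -/
def Ipm : SL8 :=
  ⟨Matrix.diagonal ![1, -1, 1, -1, 1, -1, 1, -1], by simp [Matrix.det_diagonal, Fin.prod_univ_eight]⟩

/-- The map `σ₀(g) = I₊₋ ḡ I₊₋`. -/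
def sigmaZero (g : SL8) : SL8 := Ipm * cartanInv g * Ipm

/-! ### The reductive spherical pairs of rank-one type -/

/-- The three pairs `(SO(7,ℂ), G₂(ℂ))`, `(Spin(7,ℂ), G₂(ℂ))` and `(G₂(ℂ), SL(3,ℂ))`. -/
inductive RankOnePair
  | so7g2
  | spin7g2
  | g2sl3

namespace RankOnePair

/-- The complex group `G_ℂ`. -/
def GC : RankOnePair → Subgroup SL8
  | so7g2 => SO7
  | spin7g2 => Spin7
  | g2sl3 => G2

/-- The complex subgroup `H_ℂ`, as a subgroup of `SL(8, ℂ)`. -/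
def HC : RankOnePair → Subgroup SL8
  | so7g2 => G2
  | spin7g2 => G2
  | g2sl3 => SL3

/-- The compact group `G_u = {g ∈ G_ℂ : θ(g) = g}`, as a subgroup of `G_ℂ`. -/
def Gu (P : RankOnePair) : Subgroup P.GC where
  carrier := {g | cartanInv (g : SL8) = g}
  one_mem' := by simp
  mul_mem' := by
    intro a b ha hb
    simp only [Set.mem_ofPred_eq, Subgroup.coe_mul, map_mul] at *
    rw [ha, hb]
  inv_mem' := by
    intro a ha
    simp only [Set.mem_ofPred_eq, Subgroup.coe_inv, map_inv] at *
    rw [ha]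

/-- The homogeneous space `D = G_ℂ / H_ℂ` with the quotient topology; `G_ℂ`, and hence its subgroup
`G_u`, acts on it by left translations. -/
abbrev D (P : RankOnePair) : Type := P.GC ⧸ P.HC.subgroupOf P.GC

/-- The quotient map `g ↦ g H_ℂ`. -/
def proj (P : RankOnePair) (g : P.GC) : P.D := QuotientGroup.mk g

end RankOnePair

/-- The matrix `diag(d_r, d_s, d_s, d_s)` with `d_t` the block with rows
`(cosh t, -√-1 sinh t)` and `(√-1 sinh t, cosh t)`. -/
def dBlocks (r s : ℝ) : Matrix (Fin 8) (Fin 8) ℂ :=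
  let C : ℝ → ℂ := fun t => (Real.cosh t : ℂ)
  let I : ℝ → ℂ := fun t => Complex.I * (Real.sinh t : ℂ)
  !![C r, -I r, 0, 0, 0, 0, 0, 0;
     I r, C r, 0, 0, 0, 0, 0, 0;
     0, 0, C s, -I s, 0, 0, 0, 0;
     0, 0, I s, C s, 0, 0, 0, 0;
     0, 0, 0, 0, C s, -I s, 0, 0;
     0, 0, 0, 0, I s, C s, 0, 0;
     0, 0, 0, 0, 0, 0, C s, -I s;
     0, 0, 0, 0, 0, 0, I s, C s]

/-- The matrix `t_θ` that acts by a hyperbolic rotation with parameter `t = θ` on the pair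
`(e₁, e₂)` and with parameter `u = -θ/2` on the pairs `(e₄, e₇)` and `(e₅, e₆)`. -/
def tBlocks (t : ℝ) : Matrix (Fin 8) (Fin 8) ℂ :=
  let u : ℝ := -t / 2
  let C : ℝ → ℂ := fun t => (Real.cosh t : ℂ)
  let I : ℝ → ℂ := fun t => Complex.I * (Real.sinh t : ℂ)
  !![1, 0, 0, 0, 0, 0, 0, 0;
     0, C t, -I t, 0, 0, 0, 0, 0;
     0, I t, C t, 0, 0, 0, 0, 0;
     0, 0, 0, 1, 0, 0, 0, 0;
     0, 0, 0, 0, C u, 0, 0, -I u;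
     0, 0, 0, 0, 0, C u, -I u, 0;
     0, 0, 0, 0, 0, I u, C u, 0;
     0, 0, 0, 0, I u, 0, 0, C u]

namespace RankOnePair

/-- The one-parameter group of matrices whose image is the abelian group `A`. -/
def aMat : RankOnePair → ℝ → Matrix (Fin 8) (Fin 8) ℂ
  | so7g2, t => dBlocks 0 t
  | spin7g2, t => dBlocks t (-t / 3)
  | g2sl3, t => tBlocks t

/-- The one-dimensional abelian group `A`, as a subset of `SL(8, ℂ)`. -/
def A (P : RankOnePair) : Set SL8 := {g | ∃ t : ℝ, (g : Matrix (Fin 8) (Fin 8) ℂ) = P.aMat t}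

/-- The slice `S = A H_ℂ / H_ℂ` in `D`. -/
def slice (P : RankOnePair) : Set P.D := {x | ∃ a : P.GC, (a : SL8) ∈ P.A ∧ x = P.proj a}

end RankOnePair

/-! ### The complex structure of `G_ℂ / H_ℂ` and the Lie group structure of `G_u` -/

/-- The entries of a matrix in `SL(8, ℂ)`, as a point of the normed space `ℂ^(8 × 8)`. -/
def entries (g : SL8) : Fin 8 → Fin 8 → ℂ := fun i j => g i j

/-- Holomorphy of a function on an open subset `V` of a closed complex Lie subgroup `G` of
`SL(8, ℂ)`: locally it is the restriction of a holomorphic function of the matrix entries. -/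
def IsHolomorphicOnGroup (G : Subgroup SL8) (f : G → ℂ) (V : Set G) : Prop :=
  ∀ g ∈ V, ∃ F : (Fin 8 → Fin 8 → ℂ) → ℂ,
    AnalyticAt ℂ F (entries g) ∧ ∀ᶠ h : G in 𝓝 g, f h = F (entries h)

/-- The charts on `D = G_ℂ / H_ℂ` form the quotient complex structure: a function `f` on an open set
`U ⊆ D` is holomorphic iff `g ↦ f (g H_ℂ)` is holomorphic on the preimage of `U` in `G_ℂ`. As the
holomorphic functions determine a complex manifold structure, there is at most one such structure. -/
def IsQuotientComplexStructure (P : RankOnePair) (d : ℕ) [ChartedSpace (Fin d → ℂ) P.D] : Prop :=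
  IsManifold 𝓘(ℂ, Fin d → ℂ) ω P.D ∧
  ∀ U : Set P.D, IsOpen U → ∀ f : P.D → ℂ,
    MDifferentiableOn 𝓘(ℂ, Fin d → ℂ) 𝓘(ℂ, ℂ) f U ↔
      IsHolomorphicOnGroup P.GC (fun g => f (P.proj g)) (P.proj ⁻¹' U)

/-- The charts on `G_u` form its structure of a (real) Lie subgroup of `SL(8, ℂ)`: it is a Lie group
whose topology is induced from `SL(8, ℂ)` and whose inclusion into the space of matrices is smooth.
(A topological group carries at most one Lie group structure.) -/
def IsLieSubgroupStructure (P : RankOnePair) (m : ℕ) [ChartedSpace (Fin m → ℝ) P.Gu] : Prop :=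
  LieGroup 𝓘(ℝ, Fin m → ℝ) ∞ P.Gu ∧
  ContMDiff 𝓘(ℝ, Fin m → ℝ) 𝓘(ℝ, Fin 8 → Fin 8 → ℂ) ∞
    (fun k : P.Gu => entries ((k : P.GC) : SL8))

/-! ### Strongly visible actions -/

section StronglyVisible

variable (d m : ℕ)
  (D : Type*) [TopologicalSpace D] [ChartedSpace (Fin d → ℂ) D]
  (G : Type*) [Group G] [TopologicalSpace G] [ChartedSpace (Fin m → ℝ) G] [MulAction G D]

/-- `D` is a connected complex manifold of complex dimension `d`. -/
structure IsConnectedComplexManifold : Prop where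
  isManifold : IsManifold 𝓘(ℂ, Fin d → ℂ) ω D
  connected : ConnectedSpace D
  hausdorff : T2Space D
  secondCountable : SecondCountableTopology D

/-- The action of `G` on the complex manifold `D` is a holomorphic action of a Lie group: `G` is a
Lie group, the action map `G × D → D` is smooth, and every `g ∈ G` acts holomorphically. -/
structure IsHolomorphicLieAction : Prop where
  lieGroup : LieGroup 𝓘(ℝ, Fin m → ℝ) ∞ G
  smooth : ContMDiff (𝓘(ℝ, Fin m → ℝ).prod 𝓘(ℝ, Fin d → ℂ)) 𝓘(ℝ, Fin d → ℂ) ∞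
    (fun q : G × D => q.1 • q.2)
  holomorphic : ∀ g : G, MDifferentiable 𝓘(ℂ, Fin d → ℂ) 𝓘(ℂ, Fin d → ℂ) (fun x : D => g • x)

variable {D}

/-- `S` is a `k`-dimensional (embedded) real submanifold of the complex manifold `D`: near each of
its points there is a smooth real coordinate system `(u, v)` of `D`, with `u` having `k` components,
in which `S` is given by `v = 0`. -/
def IsRealSubmanifold (k : ℕ) (S : Set D) : Prop :=
  ∀ x ∈ S, ∃ (n : ℕ) (φ : OpenPartialHomeomorph D ((Fin k → ℝ) × (Fin n → ℝ))),
    x ∈ φ.source ∧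
    ContMDiffOn 𝓘(ℝ, Fin d → ℂ) 𝓘(ℝ, (Fin k → ℝ) × (Fin n → ℝ)) ∞ φ φ.source ∧
    ContMDiffOn 𝓘(ℝ, (Fin k → ℝ) × (Fin n → ℝ)) 𝓘(ℝ, Fin d → ℂ) ∞ φ.symm φ.target ∧
    ∀ y ∈ φ.source, y ∈ S ↔ (φ y).2 = 0

/-- A diffeomorphism `σ` of the complex manifold `D` is anti-holomorphic: its real differential at
every point is conjugate-linear. -/
def IsAntiholomorphic (σ : Diffeomorph 𝓘(ℝ, Fin d → ℂ) 𝓘(ℝ, Fin d → ℂ) D D ∞) : Prop :=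
  ∀ x : D,
    let L : (Fin d → ℂ) →L[ℝ] (Fin d → ℂ) :=
      mfderiv 𝓘(ℝ, Fin d → ℂ) 𝓘(ℝ, Fin d → ℂ) σ x
    ∀ v : Fin d → ℂ, L (Complex.I • v) = -(Complex.I • L v)

/-- The holomorphic action of the Lie group `G` on the connected complex manifold `D` is strongly
visible with the `k`-dimensional slice `S` and the anti-holomorphic diffeomorphism `σ`. -/
structure IsStronglyVisibleVia (k : ℕ) (S : Set D)
    (σ : Diffeomorph 𝓘(ℝ, Fin d → ℂ) 𝓘(ℝ, Fin d → ℂ) D D ∞) : Prop where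
  complexManifold : IsConnectedComplexManifold d D
  holomorphicAction : IsHolomorphicLieAction d m D G
  submanifold : IsRealSubmanifold d k S
  antiholomorphic : IsAntiholomorphic d σ
  /-- `D = G · S`. -/
  meets_orbits : ∀ x : D, ∃ g : G, ∃ s ∈ S, x = g • s
  /-- `σ` is the identity on `S`. -/
  fixes_slice : ∀ s ∈ S, σ s = s
  /-- `σ` preserves every `G`-orbit. -/
  preserves_orbits : ∀ x : D, σ x ∈ MulAction.orbit G x

variable (D)

/-- The action of the Lie group `G` on the connected complex manifold `D` is strongly visible. -/
def IsStronglyVisible : Prop :=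
  ∃ (k : ℕ) (S : Set D) (σ : Diffeomorph 𝓘(ℝ, Fin d → ℂ) 𝓘(ℝ, Fin d → ℂ) D D ∞),
    IsStronglyVisibleVia d m G k S σ

end StronglyVisible

end

noncomputable section

set_option linter.unusedSectionVars false

/-! ### Osgood's lemma: holomorphic functions of several complex variables are analytic -/

section Osgood

open MeasureTheory Set Metric

/-! Geometry. A coset of `G2` in `Spin7` is determined by the vector g e₀, and a coset of `SL3` in
`G2` by g e₁; both are points of a complex quadric z · z = 1, in ℂ⁸ and in the imaginary octonions
respectively. Splitting such a z into real and imaginary parts gives z = cosh t x + i sinh t y with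
x, y real and orthonormal (`exists_cosh_sinh`). The compact groups are transitive on real
orthonormal pairs (`exists_Spin7_act_eq`, `exists_G2_act_eq`), and a_t sends e₀, resp. e₁, to the
model vector of parameter t. Hence some k ∈ G_u has k a_t e = z, so (k a_t)⁻¹ g fixes e and lies in
H_ℂ: this is G_ℂ = G_u A H_ℂ (`RankOnePair.exists_cartan`). The pair (SO(7), G₂) follows by lifting
to Spin(7) (`exists_isLift`), decomposing there, and projecting back. Lifts and transitivity come
from one identity: left multiplication by a unit imaginary octonion u lies over the half-turn around
u (`isLift_leftMulSL`).

Visibility. σ₀ is an antiholomorphic automorphism of G_ℂ that preserves H_ℂ and G_u and fixes A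
pointwise, so σ(k a H_ℂ) = σ₀(k) a H_ℂ = σ₀(k) k⁻¹ · (k a H_ℂ). Thus σ fixes the slice and preserves
every G_u-orbit, and the decomposition says that the slice meets every orbit.

Manifolds. The groups are closed sets of matrices, and G_ℂ, H_ℂ are zero loci of holomorphic
functions, so their Lie algebras are complex subspaces (`exp_complex_smul_mem`). Exponentiating a
complement M of the Lie algebra of H_ℂ gives a chart of D around the base point
(`exists_local_slice`, `exists_isSliceChart`), and the translates of this chart form an atlas. All
smoothness and holomorphy on D is checked on local lifts to the group; Osgood's lemma turns complex
differentiability in a chart into analyticity and so yields the quotient complex structure. G_u gets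
its atlas from the same construction with trivial stabilizer.

Slice. M is chosen to contain the generator of A, so that S is locally a coordinate line. A
continuous τ on D with τ(a_t H_ℂ) = t (`RankOnePair.exists_separating`) keeps S from returning to
the chart elsewhere. -/

theorem torusIntegrable_cauchyKernel {n : ℕ} {f : (Fin n → ℂ) → ℂ} {c w : Fin n → ℂ} {R : ℝ}
    (hR : 0 < R)
    (hf : ∀ z, (∀ i, z i ∈ closedBall (c i) R) → DifferentiableAt ℂ f z)
    (hw : ∀ i, w i ∈ ball (c i) R) :
    TorusIntegrable (fun x => (∏ i, (x i - w i)⁻¹) * f x) c (fun _ => R) := by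
  refine ContinuousOn.integrableOn_compact isCompact_Icc (Continuous.continuousOn ?_)
  refine continuous_iff_continuousAt.2 fun θ => ?_
  have hmem : ∀ i, torusMap c (fun _ => R) θ i ∈ sphere (c i) R := fun i => by
    simp [torusMap, abs_of_pos hR]
  have hT : Continuous (torusMap c (fun _ => R)) := by unfold torusMap; fun_prop
  refine ContinuousAt.mul ?_ ?_
  · refine tendsto_finsetProd _ fun i _ => ContinuousAt.inv₀ (by fun_prop) ?_
    rw [sub_ne_zero]
    intro h
    have h1 := hmem i
    have h2 := hw i
    rw [h] at h1
    rw [mem_sphere] at h1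
    rw [mem_ball] at h2
    linarith
  · exact ContinuousAt.comp (f := torusMap c (fun _ => R)) (g := f)
      (hf _ fun i => sphere_subset_closedBall (hmem i)).continuousAt hT.continuousAt

/-- Iterated Cauchy formula: after splitting off the first variable, the inner torus integral is the
formula in one variable fewer and the outer circle integral is the classical one. -/
theorem torusIntegral_cauchyKernel {n : ℕ} {f : (Fin n → ℂ) → ℂ} {c w : Fin n → ℂ} {R : ℝ}
    (hR : 0 < R)
    (hf : ∀ z, (∀ i, z i ∈ closedBall (c i) R) → DifferentiableAt ℂ f z)
    (hw : ∀ i, w i ∈ ball (c i) R) :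
    torusIntegral (fun x => (∏ i, (x i - w i)⁻¹) * f x) c (fun _ => R)
      = (2 * Real.pi * Complex.I) ^ n * f w := by
  induction n with
  | zero =>
    rw [torusIntegral_dim0]
    simp [Subsingleton.elim c w]
  | succ n ih =>
    rw [torusIntegral_succ (torusIntegrable_cauchyKernel hR hf hw)]
    have hmem : ∀ x : ℂ, x ∈ closedBall (c 0) R → ∀ z : Fin n → ℂ,
        (∀ i, z i ∈ closedBall (c i.succ) R) →
        DifferentiableAt ℂ f (Fin.cons x z : Fin (n + 1) → ℂ) := by
      intro x hx z hz
      refine hf _ fun i => ?_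
      refine Fin.cases ?_ (fun j => ?_) i
      · simpa using hx
      · simpa using hz j
    have hinner : ∀ x ∈ sphere (c 0) R,
        torusIntegral (fun y : Fin n → ℂ => (∏ i : Fin (n + 1),
          ((Fin.cons x y : Fin (n + 1) → ℂ) i - w i)⁻¹) * f (Fin.cons x y)) (c ∘ Fin.succ)
          ((fun _ => R) ∘ Fin.succ)
        = (x - w 0)⁻¹ • ((2 * Real.pi * Complex.I) ^ n *
            f (Fin.cons x (fun i => w i.succ))) := by
      intro x hx
      have h1 := ih (f := fun z => f (Fin.cons x z)) (c := c ∘ Fin.succ)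
        (w := fun i => w i.succ)
        (fun z hz => DifferentiableAt.comp z (hmem x (sphere_subset_closedBall hx) z hz)
          (by
            refine differentiableAt_pi.2 fun i => ?_
            refine Fin.cases ?_ (fun j => ?_) i
            · simp
            · simp only [Fin.cons_succ]; fun_prop))
        (fun i => hw i.succ)
      rw [← h1, smul_eq_mul, ← torusIntegral_const_mul]
      congr 1
      funext y
      rw [Fin.prod_univ_succ]
      simp [mul_assoc]
    rw [circleIntegral.integral_congr hR.le hinner]
    have hd : DiffContOnCl ℂ (fun x => (2 * Real.pi * Complex.I) ^ n *
        f (Fin.cons x (fun i => w i.succ))) (ball (c 0) R) := by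
      refine DifferentiableOn.diffContOnCl ?_
      rw [closure_ball _ hR.ne']
      intro x hx
      refine DifferentiableAt.differentiableWithinAt (DifferentiableAt.const_mul ?_ _)
      refine DifferentiableAt.comp (g := f)
        (f := fun x : ℂ => (Fin.cons x (fun i => w i.succ) : Fin (n + 1) → ℂ)) x
        (hmem x hx _ fun i => ball_subset_closedBall (hw i.succ)) ?_
      refine differentiableAt_pi.2 fun i => ?_
      refine Fin.cases ?_ (fun j => ?_) i
      · simp
      · simp
    rw [hd.circleIntegral_sub_inv_smul (hw 0), smul_eq_mul]
    have : (Fin.cons (w 0) (fun i => w i.succ) : Fin (n + 1) → ℂ) = w :=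
      Fin.cons_self_tail w
    rw [this]
    ring

/-- Integration against a fixed continuous weight over a compact set, as a continuous functional. -/
theorem exists_clm_setIntegral_mul {X : Type*} [TopologicalSpace X] [MeasurableSpace X]
    [BorelSpace X] [T2Space X] (μ : Measure X) [IsFiniteMeasureOnCompacts μ] {K : Set X}
    (hK : IsCompact K) {g : X → ℂ} (hg : ContinuousOn g K) :
    ∃ L : C(K, ℂ) →L[ℂ] ℂ, ∀ (h : X → ℂ) (h' : C(K, ℂ)), (∀ x : K, h' x = h x) →
      L h' = ∫ x in K, h x * g x ∂μ := by
  have : CompactSpace K := isCompact_iff_compactSpace.1 hK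
  have key : ∀ h' : C(K, ℂ), IntegrableOn (fun x => (Function.extend Subtype.val h' 0) x * g x) K μ := by
    intro h'
    refine ContinuousOn.integrableOn_compact hK (ContinuousOn.mul ?_ hg)
    rw [continuousOn_iff_continuous_domRestrict]
    have : K.domRestrict (Function.extend Subtype.val h' 0) = h' := by
      funext x
      simp [Set.domRestrict]
    rw [this]
    exact h'.continuous
  obtain ⟨C, hC⟩ := hK.exists_bound_of_continuousOn hg
  refine ⟨LinearMap.mkContinuous
    { toFun := fun h' => ∫ x in K, (Function.extend Subtype.val h' 0) x * g x ∂μ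
      map_add' := ?_
      map_smul' := ?_ } (max C 0 * μ.real K) ?_, ?_⟩
  · intro a b
    rw [← integral_add (key a) (key b)]
    refine setIntegral_congr_fun hK.measurableSet fun x hx => ?_
    lift x to K using hx
    simp [add_mul]
  · intro a b
    rw [RingHom.id_apply, ← integral_smul]
    refine setIntegral_congr_fun hK.measurableSet fun x hx => ?_
    lift x to K using hx
    simp [mul_assoc]
  · intro h'
    have := norm_setIntegral_le_of_norm_le_const (μ := μ) (s := K) (C := ‖h'‖ * max C 0)
      (f := fun x => (Function.extend Subtype.val h' 0) x * g x) hK.measure_lt_top ?_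
    · refine this.trans (le_of_eq ?_)
      ring
    · intro x hx
      have h1 := hC x hx
      lift x to K using hx
      rw [norm_mul, Subtype.val_injective.extend_apply]
      exact mul_le_mul (h'.norm_coe_le_norm x) (h1.trans (le_max_left _ _)) (norm_nonneg _)
        (norm_nonneg _)
  · intro h h' hh
    refine setIntegral_congr_fun hK.measurableSet fun x hx => ?_
    lift x to K using hx
    simp [hh]

/-- Osgood's lemma for a complex differentiable function on a neighbourhood of a point. -/
theorem analyticAt_of_eventually_differentiableAt_pi {n : ℕ} {f : (Fin n → ℂ) → ℂ}
    {c : Fin n → ℂ} (hf : ∀ᶠ z in 𝓝 c, DifferentiableAt ℂ f z) : AnalyticAt ℂ f c := by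
  obtain ⟨R, hR, hball⟩ := Metric.nhds_basis_closedBall.eventually_iff.1 hf
  have hf' : ∀ z : Fin n → ℂ, (∀ i, z i ∈ closedBall (c i) R) → DifferentiableAt ℂ f z := by
    intro z hz
    refine hball ?_
    rw [mem_closedBall, dist_pi_le_iff hR.le]
    exact hz
  set T : (Fin n → ℝ) → (Fin n → ℂ) := torusMap c (fun _ => R) with hTdef
  have hT : Continuous T := by rw [hTdef]; unfold torusMap; fun_prop
  have hmem : ∀ θ i, T θ i ∈ sphere (c i) R := fun θ i => by
    simp [hTdef, torusMap, abs_of_pos hR]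
  set K : Set (Fin n → ℝ) := Icc 0 (fun _ => 2 * Real.pi) with hK
  have hKc : IsCompact K := isCompact_Icc
  have : CompactSpace K := isCompact_iff_compactSpace.1 hKc
  have hfT : Continuous fun θ => f (T θ) := continuous_iff_continuousAt.2 fun θ =>
    ContinuousAt.comp (f := T) (g := f)
      (hf' _ fun i => sphere_subset_closedBall (hmem θ i)).continuousAt hT.continuousAt
  -- The weight collects everything independent of z: the Jacobian factors of `torusMap` and the
  -- boundary values of f.
  obtain ⟨L, hL⟩ := exists_clm_setIntegral_mul (volume : Measure (Fin n → ℝ)) hKc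
    (g := fun θ => (∏ i : Fin n, (R : ℂ) * Complex.exp (θ i * Complex.I) * Complex.I) * f (T θ))
    (Continuous.mul (continuous_finsetProd _ fun i _ => by fun_prop) hfT).continuousOn
  let Z : Fin n → C(K, ℂ) := fun i => ⟨fun θ => T θ i, by fun_prop⟩
  -- The Cauchy kernel as a map into the Banach algebra C(K, ℂ). It is analytic because inversion is
  -- analytic at units, and f is a constant times a continuous functional of it; no power series has
  -- to be summed.
  let κ : (Fin n → ℂ) → C(K, ℂ) := fun z => ∏ i, Ring.inverse (Z i - algebraMap ℂ C(K, ℂ) (z i))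
  have hne : ∀ z : Fin n → ℂ, (∀ i, z i ∈ ball (c i) R) → ∀ i (θ : K),
      (Z i - algebraMap ℂ C(K, ℂ) (z i)) θ ≠ 0 := by
    intro z hz i θ h
    have h0 : T θ i = z i := sub_eq_zero.1 h
    have h1 := hmem θ i
    have h2 := hz i
    rw [h0, mem_sphere] at h1
    rw [mem_ball] at h2
    linarith
  have hunit : ∀ z : Fin n → ℂ, (∀ i, z i ∈ ball (c i) R) → ∀ i,
      IsUnit (Z i - algebraMap ℂ C(K, ℂ) (z i)) := fun z hz i =>
    (ContinuousMap.isUnit_iff_forall_ne_zero _).2 (hne z hz i)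
  have hformula : ∀ z : Fin n → ℂ, (∀ i, z i ∈ ball (c i) R) →
      f z = ((2 * Real.pi * Complex.I) ^ n)⁻¹ * L (κ z) := by
    intro z hz
    have h1 := torusIntegral_cauchyKernel hR hf' hz
    rw [hL (fun θ => ∏ i, (T θ i - z i)⁻¹) (κ z) ?_]
    · rw [eq_inv_mul_iff_mul_eq₀
        (pow_ne_zero _ Complex.two_pi_I_ne_zero), ← h1, torusIntegral]
      refine setIntegral_congr_fun hKc.measurableSet fun θ _ => ?_
      simp only [smul_eq_mul, ← hTdef]
      ring
    · intro θ
      simp only [κ, ContinuousMap.prod_apply]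
      refine Finset.prod_congr rfl fun i _ => ?_
      have h2 := congrArg (fun q : C(K, ℂ) => q θ) (Ring.inverse_mul_cancel _ (hunit z hz i))
      exact eq_inv_of_mul_eq_one_left h2
  have hκ : AnalyticAt ℂ κ c := by
    refine Finset.analyticAt_fun_prod _ fun i _ => ?_
    obtain ⟨u, hu⟩ := hunit c (fun i => mem_ball_self hR) i
    have h1 : AnalyticAt ℂ (fun z : Fin n → ℂ => Z i - algebraMap ℂ C(K, ℂ) (z i)) c := by
      refine analyticAt_const.sub ?_
      exact ((Algebra.linearMap ℂ C(K, ℂ)).toContinuousLinearMap.comp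
        (ContinuousLinearMap.proj (R := ℂ) (φ := fun _ : Fin n => ℂ) i)).analyticAt c
    refine AnalyticAt.fun_comp (g := Ring.inverse)
      (f := fun z : Fin n → ℂ => Z i - algebraMap ℂ C(K, ℂ) (z i)) ?_ h1
    rw [← hu]
    exact analyticAt_inverse u
  have hfin : AnalyticAt ℂ (fun z => ((2 * Real.pi * Complex.I) ^ n)⁻¹ * L (κ z)) c :=
    analyticAt_const.mul ((L.analyticAt _).fun_comp hκ)
  refine hfin.congr ?_
  filter_upwards [Metric.ball_mem_nhds c hR] with z hz
  refine (hformula z fun i => ?_).symm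
  exact (dist_le_pi_dist z c i).trans_lt hz

end Osgood

/-! ### The Lie algebra of a closed linear group -/

section ClosedLinearGroup

open NormedSpace Filter

variable {A : Type*} [NormedRing A] [NormedAlgebra ℝ A] [FiniteDimensional ℝ A]

/-- A closed set of a finite dimensional algebra that is a group under multiplication. -/
structure IsClosedLinearGroup (S : Set A) : Prop where
  one_mem : (1 : A) ∈ S
  mul_mem : ∀ a ∈ S, ∀ b ∈ S, a * b ∈ S
  inv_mem : ∀ a ∈ S, ∀ b, a * b = 1 → b ∈ S
  isClosed : IsClosed S

/-- The generators of the one-parameter groups inside `S`. -/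
def lieSet (S : Set A) : Set A := {X | ∀ t : ℝ, exp (t • X) ∈ S}

theorem exp_mul_exp_neg_self (X : A) : exp X * exp (-X) = 1 := by
  have := FiniteDimensional.complete ℝ A
  let := NormedAlgebra.restrictScalars ℚ ℝ A
  rw [← exp_add_of_commute (Commute.neg_right (Commute.refl X)), add_neg_cancel, exp_zero]

theorem exp_neg_mul_exp_self (X : A) : exp (-X) * exp X = 1 := by
  simpa using exp_mul_exp_neg_self (-X)

theorem exp_mem_of_mem_lieSet {S : Set A} {X : A} (hX : X ∈ lieSet S) : exp X ∈ S := by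
  simpa using hX 1

theorem smul_mem_lieSet {S : Set A} {X : A} (hX : X ∈ lieSet S) (c : ℝ) : c • X ∈ lieSet S :=
  fun t => by rw [smul_smul]; exact hX _

theorem IsClosedLinearGroup.exp_neg_mem {S : Set A} (hS : IsClosedLinearGroup S) {X : A}
    (hX : exp X ∈ S) : exp (-X) ∈ S :=
  hS.inv_mem _ hX _ (exp_mul_exp_neg_self X)

theorem IsClosedLinearGroup.pow_mem {S : Set A} (hS : IsClosedLinearGroup S) {a : A}
    (ha : a ∈ S) (n : ℕ) : a ^ n ∈ S := by
  induction n with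
  | zero => simpa using hS.one_mem
  | succ n ih => rw [pow_succ]; exact hS.mul_mem _ ih _ ha

theorem IsClosedLinearGroup.exp_int_smul_mem {S : Set A} (hS : IsClosedLinearGroup S) {X : A}
    (hX : exp X ∈ S) (k : ℤ) : exp ((k : ℝ) • X) ∈ S := by
  have := FiniteDimensional.complete ℝ A
  let := NormedAlgebra.restrictScalars ℚ ℝ A
  obtain ⟨n, rfl | rfl⟩ := k.eq_nat_or_neg
  · rw [Int.cast_natCast, Nat.cast_smul_eq_nsmul, exp_nsmul]
    exact hS.pow_mem hX n
  · rw [Int.cast_neg, Int.cast_natCast, neg_smul, Nat.cast_smul_eq_nsmul]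
    refine hS.exp_neg_mem ?_
    rw [exp_nsmul]
    exact hS.pow_mem hX n

theorem hasStrictFDerivAt_exp_zero_real :
    HasStrictFDerivAt (exp : A → A) (1 : A →L[ℝ] A) 0 := by
  have := FiniteDimensional.complete ℝ A
  exact hasStrictFDerivAt_exp_zero

/-- Inverse function theorem: exp has derivative 1 at 0. -/
theorem exists_local_log : ∃ log : A → A, HasFDerivAt log (1 : A →L[ℝ] A) 1 ∧ log 1 = 0 ∧
    ∀ᶠ a in 𝓝 (1 : A), exp (log a) = a := by
  have := FiniteDimensional.complete ℝ A
  have h : HasStrictFDerivAt (exp : A → A) ((ContinuousLinearEquiv.refl ℝ A : A ≃L[ℝ] A) :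
      A →L[ℝ] A) 0 := hasStrictFDerivAt_exp_zero_real
  refine ⟨h.localInverse, ?_, ?_, ?_⟩
  · have := h.to_localInverse.hasFDerivAt
    rw [exp_zero] at this
    exact this
  · have := h.localInverse_apply_image
    rwa [exp_zero] at this
  · have := h.eventually_right_inverse
    rwa [exp_zero] at this

theorem hasDerivAt_exp_smul_zero (X : A) : HasDerivAt (fun t : ℝ => exp (t • X)) X 0 := by
  have := FiniteDimensional.complete ℝ A
  have h : HasFDerivAt (exp : A → A) (1 : A →L[ℝ] A) ((0 : ℝ) • X) := by
    rw [zero_smul]; exact hasStrictFDerivAt_exp_zero_real.hasFDerivAt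
  have h2 : HasDerivAt (fun t : ℝ => t • X) X 0 := by
    simpa using (hasDerivAt_id (0 : ℝ)).smul_const X
  exact h.comp_hasDerivAt 0 h2

/-- Lie product formula. With γ(t) = exp(tX) exp(tY), the curve log γ has derivative X + Y at 0, so
exp(X + Y) is the limit of γ(1/(n+1))^(n+1), which lies in the closed set S. -/
theorem IsClosedLinearGroup.add_mem_lieSet {S : Set A} (hS : IsClosedLinearGroup S) {X Y : A}
    (hX : X ∈ lieSet S) (hY : Y ∈ lieSet S) : X + Y ∈ lieSet S := by
  have := FiniteDimensional.complete ℝ A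
  let := NormedAlgebra.restrictScalars ℚ ℝ A
  suffices H : ∀ X ∈ lieSet S, ∀ Y ∈ lieSet S, exp (X + Y) ∈ S by
    intro t
    rw [smul_add]
    exact H _ (smul_mem_lieSet hX t) _ (smul_mem_lieSet hY t)
  clear hX hY X Y
  intro X hX Y hY
  obtain ⟨log, hlog, hlog1, hexp⟩ := exists_local_log (A := A)
  set γ : ℝ → A := fun t => exp (t • X) * exp (t • Y) with hγ
  have hγ0 : γ 0 = 1 := by simp [hγ]
  have hγd : HasDerivAt γ (X + Y) 0 := by
    have := (hasDerivAt_exp_smul_zero X).mul (hasDerivAt_exp_smul_zero Y)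
    rw [zero_smul, zero_smul, exp_zero, mul_one, one_mul] at this
    exact this
  have hc : HasDerivAt (fun t => log (γ t)) (X + Y) 0 := by
    have h1 : HasFDerivAt log (1 : A →L[ℝ] A) (γ 0) := by rw [hγ0]; exact hlog
    exact h1.comp_hasDerivAt 0 hγd
  have hu : Tendsto (fun n : ℕ => ((n : ℝ) + 1)⁻¹) atTop (𝓝[≠] 0) := by
    refine tendsto_nhdsWithin_iff.2 ⟨?_, Eventually.of_forall fun n => ?_⟩
    · simpa using tendsto_one_div_add_atTop_nhds_zero_nat (𝕜 := ℝ)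
    · have : (0 : ℝ) < (n : ℝ) + 1 := by positivity
      simp [this.ne']
  have hlim := hc.tendsto_slope_zero.comp hu
  simp only [zero_add, hγ0, hlog1, sub_zero, Function.comp_def, inv_inv] at hlim
  have hlim2 := hlim.exp
  refine hS.isClosed.mem_of_tendsto hlim2 ?_
  have hcont : Tendsto γ (𝓝[≠] 0) (𝓝 1) := by
    rw [← hγ0]; exact hγd.continuousAt.tendsto.mono_left nhdsWithin_le_nhds
  filter_upwards [(hcont.comp hu).eventually hexp] with n hn
  have h1 : (((n : ℝ) + 1) : ℝ) • log (γ ((n : ℝ) + 1)⁻¹)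
      = (n + 1) • log (γ ((n : ℝ) + 1)⁻¹) := by
    rw [← Nat.cast_smul_eq_nsmul ℝ]; simp
  rw [h1, exp_nsmul]
  simp only [Function.comp_def] at hn
  rw [hn]
  exact hS.pow_mem (hS.mul_mem _ (hX _) _ (hY _)) _

/-- Near `0`, a subspace that meets the Lie algebra trivially meets the logarithm of the group
trivially. -/
theorem IsClosedLinearGroup.eventually_eq_zero {S : Set A} (hS : IsClosedLinearGroup S)
    (V : Submodule ℝ A) (hV : ∀ X ∈ V, X ∈ lieSet S → X = 0) :
    ∀ᶠ Z in 𝓝 (0 : A), Z ∈ V → exp Z ∈ S → Z = 0 := by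
  have := FiniteDimensional.complete ℝ A
  have := FiniteDimensional.proper ℝ A
  let := NormedAlgebra.restrictScalars ℚ ℝ A
  by_contra hcon
  rw [not_eventually] at hcon
  -- A sequence of counterexamples tending to 0; its directions accumulate at a unit vector w of V,
  -- and w is shown to generate a one-parameter group in S.
  obtain ⟨Z, hZ0, hZ⟩ := exists_seq_forall_of_frequently hcon
  simp only [Classical.not_imp] at hZ
  have hpos : ∀ n, 0 < ‖Z n‖ := fun n => norm_pos_iff.2 (hZ n).2.2
  have hsph : ∀ n, ‖Z n‖⁻¹ • Z n ∈ Metric.sphere (0 : A) 1 := fun n => by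
    rw [mem_sphere_zero_iff_norm, norm_smul, norm_inv, norm_norm, inv_mul_cancel₀ (hpos n).ne']
  obtain ⟨w, hw, φ, hφ, hlim⟩ := (isCompact_sphere (0 : A) 1).tendsto_subseq hsph
  have hwV : w ∈ V := V.closed_of_finiteDimensional.mem_of_tendsto hlim
    (Eventually.of_forall fun n => V.smul_mem _ (hZ _).1)
  have hwS : w ∈ lieSet S := by
    intro t
    have hnorm : Tendsto (fun n => ‖Z (φ n)‖) atTop (𝓝 0) := by
      simpa using (hZ0.comp hφ.tendsto_atTop).norm
    -- Rounding t/‖Zₙ‖ down to an integer changes the multiple of ‖Zₙ‖ by at most ‖Zₙ‖. Hence exp(t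
    -- w) is a limit of integer powers of exp Zₙ.
    have hk : Tendsto (fun n => (⌊t / ‖Z (φ n)‖⌋ : ℝ) * ‖Z (φ n)‖) atTop (𝓝 t) := by
      rw [tendsto_iff_dist_tendsto_zero]
      refine squeeze_zero (fun _ => dist_nonneg) (fun n => ?_) hnorm
      have h1 := Int.floor_le (t / ‖Z (φ n)‖)
      have h2 := Int.lt_floor_add_one (t / ‖Z (φ n)‖)
      have h3 := hpos (φ n)
      rw [le_div_iff₀ h3] at h1
      rw [div_lt_iff₀ h3] at h2
      rw [Real.dist_eq, abs_le]
      constructor <;> linarith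
    have h1 := (hk.smul hlim).exp
    refine hS.isClosed.mem_of_tendsto h1 (Eventually.of_forall fun n => ?_)
    have h3 := hpos (φ n)
    simp only [Function.comp_def]
    rw [smul_smul, mul_assoc, mul_inv_cancel₀ h3.ne', mul_one]
    exact hS.exp_int_smul_mem (hZ _).2.1 _
  have := hV w hwV hwS
  rw [this] at hw
  simp at hw

/-- The scalar field is left open: ℝ serves the compact group, ℂ the zero loci, where `hc` is a
genuine condition. -/
theorem IsClosedLinearGroup.exists_submodule {𝕜 : Type*} [NormedField 𝕜] [NormedAlgebra 𝕜 A]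
    {S : Set A} (hS : IsClosedLinearGroup S) (hc : ∀ (c : 𝕜), ∀ X ∈ lieSet S, c • X ∈ lieSet S) :
    ∃ 𝔤 : Submodule 𝕜 A, ∀ X, X ∈ 𝔤 ↔ X ∈ lieSet S :=
  ⟨{ carrier := lieSet S
     add_mem' := hS.add_mem_lieSet
     zero_mem' := fun t => by simpa using hS.one_mem
     smul_mem' := fun c X hX => hc c X hX }, fun _ => Iff.rfl⟩

end ClosedLinearGroup

/-- A group cut out by holomorphic equations contains the complexification of each of its
one-parameter groups. -/
theorem exp_complex_smul_mem {A : Type*} [NormedRing A] [NormedAlgebra ℂ A] [CompleteSpace A]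
    {ι : Type*} {F : ι → A → ℂ} (hF : ∀ i, Differentiable ℂ (F i)) {S : Set A}
    (hS : ∀ a, a ∈ S ↔ ∀ i, F i a = 0) (X : A)
    (hX : ∀ t : ℝ, NormedSpace.exp ((t : ℂ) • X) ∈ S) (z : ℂ) : NormedSpace.exp (z • X) ∈ S := by
  rw [hS]
  intro i
  have hd : Differentiable ℂ (fun z : ℂ => F i (NormedSpace.exp (z • X))) := by
    have he : Differentiable ℂ (NormedSpace.exp : A → A) := fun a =>
      (NormedSpace.exp_analytic (𝕂 := ℂ) a).differentiableAt
    exact (hF i).comp (he.comp (differentiable_id.smul_const X))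
  have han : AnalyticOnNhd ℂ (fun z : ℂ => F i (NormedSpace.exp (z • X))) Set.univ := fun z _ =>
    hd.analyticAt z
  -- Every equation vanishes along the real axis, in particular at 1/(n+1) → 0; the identity theorem
  -- extends this to all of ℂ.
  have h0 : ∃ᶠ z : ℂ in 𝓝[≠] (0 : ℂ), F i (NormedSpace.exp (z • X)) = (fun _ => 0) z := by
    have hu : Filter.Tendsto (fun n : ℕ => (((((n : ℝ) + 1)⁻¹ : ℝ)) : ℂ)) Filter.atTop
        (𝓝[≠] 0) := by
      refine tendsto_nhdsWithin_iff.2 ⟨?_, Filter.Eventually.of_forall fun n => ?_⟩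
      · rw [← Complex.ofReal_zero]
        refine (Complex.continuous_ofReal.tendsto 0).comp ?_
        simpa using tendsto_one_div_add_atTop_nhds_zero_nat (𝕜 := ℝ)
      · simp only [Set.mem_compl_iff, Set.mem_singleton_iff, Complex.ofReal_eq_zero]
        positivity
    refine hu.frequently (Filter.Eventually.frequently (Filter.Eventually.of_forall fun n => ?_))
    exact (hS _).1 (hX _) i
  exact han.eqOn_of_preconnected_of_frequently_eq (fun z _ => analyticAt_const)
    isPreconnected_univ (Set.mem_univ 0) h0 (Set.mem_univ z)

/-! ### Local slices for the quotient of two closed linear groups -/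

section LocalSlice

open NormedSpace Filter

variable {𝕜 : Type*} [RCLike 𝕜] {A : Type*} [NormedRing A] [NormedAlgebra ℝ A]
  [FiniteDimensional ℝ A] [NormedAlgebra 𝕜 A] [IsScalarTower ℝ 𝕜 A]

/-- The projections of the decomposition A = M ⊕ C ⊕ H. In the application M is the slice direction,
C is transverse to the group and H is the Lie algebra of the stabilizer. -/
theorem exists_projections {M C H : Submodule 𝕜 A} [FiniteDimensional 𝕜 A] (hHM : Disjoint H M)
    (hC : IsCompl (H ⊔ M) C) :
    ∃ pm pc ph : A →L[𝕜] A, (∀ W, pm W ∈ M) ∧ (∀ W, pc W ∈ C) ∧ (∀ W, ph W ∈ H) ∧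
      (∀ W, pm W + pc W + ph W = W) ∧
      (∀ X ∈ M, ∀ Y ∈ H, pm (X + Y) = X ∧ pc (X + Y) = 0 ∧ ph (X + Y) = Y) := by
  have key : ∀ W : A, ∃ X ∈ M, ∃ Z ∈ C, ∃ Y ∈ H, X + Z + Y = W := by
    intro W
    have hW : W ∈ (H ⊔ M) ⊔ C := by rw [hC.sup_eq_top]; trivial
    obtain ⟨G, hG, Z, hZ, rfl⟩ := Submodule.mem_sup.1 hW
    obtain ⟨Y, hY, X, hX, rfl⟩ := Submodule.mem_sup.1 hG
    exact ⟨X, hX, Z, hZ, Y, hY, by abel⟩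
  have uniq : ∀ X ∈ M, ∀ Z ∈ C, ∀ Y ∈ H, X + Z + Y = 0 → X = 0 ∧ Z = 0 ∧ Y = 0 := by
    intro X hX Z hZ Y hY h0
    have hZ0 : Z = 0 := by
      refine Submodule.disjoint_def.1 hC.disjoint Z ?_ hZ
      have : Z = -(Y + X) := by rw [eq_neg_iff_add_eq_zero, ← h0]; abel
      rw [this]
      exact neg_mem (Submodule.mem_sup.2 ⟨Y, hY, X, hX, rfl⟩)
    subst hZ0
    have hX0 : X = 0 := by
      refine Submodule.disjoint_def.1 hHM X ?_ hX
      have : X = -Y := by rw [eq_neg_iff_add_eq_zero, ← h0]; abel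
      rw [this]
      exact neg_mem hY
    subst hX0
    simpa using h0
  have uniq2 : ∀ X ∈ M, ∀ Z ∈ C, ∀ Y ∈ H, ∀ X' ∈ M, ∀ Z' ∈ C, ∀ Y' ∈ H,
      X + Z + Y = X' + Z' + Y' → X = X' ∧ Z = Z' ∧ Y = Y' := by
    intro X hX Z hZ Y hY X' hX' Z' hZ' Y' hY' h
    have := uniq (X - X') (sub_mem hX hX') (Z - Z') (sub_mem hZ hZ') (Y - Y') (sub_mem hY hY') (by
      rw [← sub_eq_zero] at h; rw [← h]; abel)
    simpa only [sub_eq_zero] using this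
  choose fm hfm fc hfc fh hfh hsum using key
  have hadd := fun W V : A => uniq2 _ (hfm (W + V)) _ (hfc (W + V)) _ (hfh (W + V))
    _ (add_mem (hfm W) (hfm V)) _ (add_mem (hfc W) (hfc V)) _ (add_mem (hfh W) (hfh V))
    (by rw [hsum]; conv_lhs => rw [← hsum W, ← hsum V]
        abel)
  have hsmul := fun (c : 𝕜) (W : A) => uniq2 _ (hfm (c • W)) _ (hfc (c • W)) _ (hfh (c • W))
    _ (M.smul_mem c (hfm W)) _ (C.smul_mem c (hfc W)) _ (H.smul_mem c (hfh W))
    (by rw [hsum]; conv_lhs => rw [← hsum W]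
        rw [smul_add, smul_add])
  refine ⟨LinearMap.toContinuousLinearMap ⟨⟨fm, fun W V => (hadd W V).1⟩, fun c W => (hsmul c W).1⟩,
    LinearMap.toContinuousLinearMap ⟨⟨fc, fun W V => (hadd W V).2.1⟩, fun c W => (hsmul c W).2.1⟩,
    LinearMap.toContinuousLinearMap ⟨⟨fh, fun W V => (hadd W V).2.2⟩, fun c W => (hsmul c W).2.2⟩,
    hfm, hfc, hfh, hsum, fun X hX Y hY => ?_⟩
  exact uniq2 _ (hfm _) _ (hfc _) _ (hfh _) _ hX _ (zero_mem C) _ hY (by rw [hsum]; abel)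

/-- The map `g ↦ g T` from `S` to `S / T` has, near `1`, a holomorphic coordinate `r` with values in
a complement `M` of the Lie algebra of `T` in the Lie algebra of `S`, inverse to `X ↦ exp X`. -/
theorem exists_local_slice {S T : Set A} (hS : IsClosedLinearGroup S) (hT : IsClosedLinearGroup T)
    (hTS : T ⊆ S) {M H G : Submodule 𝕜 A} (hG : ∀ X, X ∈ G ↔ X ∈ lieSet S)
    (hH : ∀ X, X ∈ H ↔ X ∈ lieSet T) (hHM : Disjoint H M) (hsup : H ⊔ M = G) :
    ∃ (U : Set A) (r : A → A), IsOpen U ∧ 1 ∈ U ∧ AnalyticOnNhd 𝕜 r U ∧ r 1 = 0 ∧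
      (∀ a, r a ∈ M) ∧ (∀ g ∈ S, g ∈ U → exp (-r g) * g ∈ T) ∧
      (∀ᶠ X in 𝓝 (0 : A), X ∈ M → exp X ∈ U ∧ r (exp X) = X) ∧
      (∀ g ∈ S, g ∈ U → ∀ h ∈ T, g * h ∈ U → r (g * h) = r g) := by
  have := FiniteDimensional.complete ℝ A
  have : FiniteDimensional 𝕜 A := FiniteDimensional.right ℝ 𝕜 A
  obtain ⟨C, hC⟩ := Submodule.exists_isCompl G
  rw [← hsup] at hC
  obtain ⟨pm, pc, ph, hpm, hpc, hph, hsum, hfix⟩ := exists_projections hHM hC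
  have hMG : ∀ X ∈ M, exp X ∈ S := fun X hX => exp_mem_of_mem_lieSet
    ((hG X).1 (hsup ▸ Submodule.mem_sup_right hX))
  have hHT : ∀ X ∈ H, exp X ∈ T := fun X hX => exp_mem_of_mem_lieSet ((hH X).1 hX)
  have hmid : ∀ X Z Y a : A, exp X * exp Z * exp Y = a → exp Z = exp (-X) * a * exp (-Y) := by
    rintro X Z Y a rfl
    simp only [mul_assoc, exp_mul_exp_neg_self, mul_one]
    rw [← mul_assoc, exp_neg_mul_exp_self, one_mul]
  have hleft : ∀ X Y a : A, a = exp X * exp Y → exp (-X) * a = exp Y := by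
    rintro X Y a rfl
    rw [← mul_assoc, exp_neg_mul_exp_self, one_mul]
  -- Coordinates of the second kind. The derivative at 0 is pm + pc + ph = id, so Ψ is locally
  -- invertible, and r will be the M-component of the inverse.
  set Ψ : A → A := fun W => exp (pm W) * exp (pc W) * exp (ph W) with hΨ
  have hΨ0 : Ψ 0 = 1 := by simp [hΨ]
  have hd : HasStrictFDerivAt Ψ ((ContinuousLinearEquiv.refl 𝕜 A : A ≃L[𝕜] A) : A →L[𝕜] A) 0 := by
    have h1 : ∀ p : A →L[𝕜] A, HasStrictFDerivAt (fun W => exp (p W)) p 0 := by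
      intro p
      have h2 : HasStrictFDerivAt (exp : A → A) (1 : A →L[𝕜] A) (p 0) := by
        rw [map_zero]; exact hasStrictFDerivAt_exp_zero
      exact h2.comp 0 p.hasStrictFDerivAt
    have h3 := ((h1 pm).mul' (h1 pc)).mul' (h1 ph)
    refine h3.congr_fderiv ?_
    ext W
    have := hsum W
    simp only [map_zero, exp_zero, one_smul, MulOpposite.op_one,
      add_apply, Pi.mul_apply, one_mul, ContinuousLinearEquiv.coe_coe,
      ContinuousLinearEquiv.coe_refl', id]
    conv_rhs => rw [← this]
    simp [add_comm, add_left_comm]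
  have hΨan : ∀ W, AnalyticAt 𝕜 Ψ W := by
    intro W
    have h1 : ∀ p : A →L[𝕜] A, AnalyticAt 𝕜 (fun W => exp (p W)) W := fun p =>
      (exp_analytic (p W)).fun_comp (p.analyticAt W)
    exact ((h1 pm).mul (h1 pc)).mul (h1 ph)
  set e := hd.toOpenPartialHomeomorph Ψ with he
  have hecoe : ∀ W, e W = Ψ W := fun W => rfl
  have h0src : (0 : A) ∈ e.source := hd.mem_toOpenPartialHomeomorph_source
  have h1tgt : (1 : A) ∈ e.target := hΨ0 ▸ e.map_source h0src
  have hsymm1 : e.symm 1 = 0 := by rw [← hΨ0, ← hecoe, e.left_inv h0src]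
  have hsyman : AnalyticAt 𝕜 e.symm 1 := by
    have := e.analyticAt_symm' h0src (hΨan 0) hd.hasFDerivAt.fderiv
    rwa [hecoe, hΨ0] at this
  have hsymc : Tendsto e.symm (𝓝 1) (𝓝 0) := by
    have := hsyman.continuousAt.tendsto
    rwa [hsymm1] at this
  -- For a point of S near 1 the C-factor lies in S as well, hence is trivial; `hMT` does the same
  -- for the M-factor of a point of T.
  have hCS : ∀ᶠ Z in 𝓝 (0 : A), Z ∈ C → exp Z ∈ S → Z = 0 := by
    refine hS.eventually_eq_zero (C.restrictScalars ℝ) fun X hX hXS => ?_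
    refine Submodule.disjoint_def.1 hC.disjoint X ?_ hX
    rw [hsup]
    exact (hG X).2 hXS
  have hMT : ∀ᶠ Z in 𝓝 (0 : A), Z ∈ M → exp Z ∈ T → Z = 0 := by
    refine hT.eventually_eq_zero (M.restrictScalars ℝ) fun X hX hXT => ?_
    exact Submodule.disjoint_def.1 hHM X ((hH X).2 hXT) hX
  have hp0 : ∀ p : A →L[𝕜] A, Tendsto p (𝓝 0) (𝓝 0) := fun p => by
    simpa using p.continuous.tendsto 0
  have hpair : ∀ᶠ q in 𝓝 (0 : A) ×ˢ 𝓝 (0 : A),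
      (exp (-pm q.1) * exp (pm q.2) ∈ e.target) ∧
      (pc (e.symm (exp (-pm q.1) * exp (pm q.2))) ∈ C →
        exp (pc (e.symm (exp (-pm q.1) * exp (pm q.2)))) ∈ S →
        pc (e.symm (exp (-pm q.1) * exp (pm q.2))) = 0) ∧
      (pm (e.symm (exp (-pm q.1) * exp (pm q.2))) ∈ M →
        exp (pm (e.symm (exp (-pm q.1) * exp (pm q.2)))) ∈ T →
        pm (e.symm (exp (-pm q.1) * exp (pm q.2))) = 0) ∧
      pm q.2 ∈ e.source ∧
      pm q.1 + ph (e.symm (exp (-pm q.1) * exp (pm q.2))) ∈ e.source ∧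
      (pc q.1 ∈ C → exp (pc q.1) ∈ S → pc q.1 = 0) := by
    have hq1 : Tendsto (fun q : A × A => pm q.1) (𝓝 0 ×ˢ 𝓝 0) (𝓝 0) :=
      (hp0 pm).comp tendsto_fst
    have hq2 : Tendsto (fun q : A × A => pm q.2) (𝓝 0 ×ˢ 𝓝 0) (𝓝 0) :=
      (hp0 pm).comp tendsto_snd
    have hdq : Tendsto (fun q : A × A => exp (-pm q.1) * exp (pm q.2)) (𝓝 0 ×ˢ 𝓝 0) (𝓝 1) := by
      let := NormedAlgebra.restrictScalars ℚ ℝ A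
      have := (hq1.neg.exp).mul hq2.exp
      simpa using this
    have hes := hsymc.comp hdq
    have hsrc := e.open_source.mem_nhds h0src
    have hlast : Tendsto (fun q : A × A => pm q.1 + ph (e.symm (exp (-pm q.1) * exp (pm q.2))))
        (𝓝 0 ×ˢ 𝓝 0) (𝓝 0) := by
      simpa using hq1.add ((hp0 ph).comp hes)
    filter_upwards [hdq (e.open_target.mem_nhds h1tgt), ((hp0 pc).comp hes).eventually hCS,
      ((hp0 pm).comp hes).eventually hMT, hq2 hsrc, hlast hsrc,
      ((hp0 pc).comp tendsto_fst).eventually hCS] with q a1 a2 a3 a4 a5 a6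
    exact ⟨a1, a2, a3, a4, a5, a6⟩
  -- One neighbourhood N that works for all pairs of its points, since g and g h must be compared
  -- without any smallness of h.
  obtain ⟨N, hN, hNpair⟩ := eventually_prod_self_iff'.1 hpair
  obtain ⟨U, hUsub, hUo, h1U⟩ := mem_nhds_iff.1
    (inter_mem (inter_mem (hsymc hN) (e.open_target.mem_nhds h1tgt))
      hsyman.eventually_analyticAt)
  have hdecomp : ∀ g ∈ S, g ∈ U → e.symm g ∈ N ∧
      g = exp (pm (e.symm g)) * exp (ph (e.symm g)) := by
    intro g hg hgU
    obtain ⟨⟨hgN, hgt⟩, -⟩ := hUsub hgU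
    refine ⟨hgN, ?_⟩
    have h1 : Ψ (e.symm g) = g := e.right_inv hgt
    have hZ : pc (e.symm g) = 0 := by
      refine (hNpair _ hgN _ hgN).2.2.2.2.2 (hpc _) ?_
      rw [hmid _ _ _ _ h1]
      exact hS.mul_mem _ (hS.mul_mem _ (hMG _ (neg_mem (hpm _))) _ hg) _
        (hTS (hHT _ (neg_mem (hph _))))
    conv_lhs => rw [← h1]
    simp [hΨ, hZ]
  refine ⟨U, fun a => pm (e.symm a), hUo, h1U, fun a ha => ?_, by simp [hsymm1], fun a => hpm _,
    fun g hg hgU => ?_, ?_, fun g hg hgU h hh hghU => ?_⟩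
  · exact (pm.analyticAt _).fun_comp (hUsub ha).2
  · obtain ⟨hgN, hgd⟩ := hdecomp g hg hgU
    rw [hleft _ _ _ hgd]
    exact hHT _ (hph _)
  · have hexp : Tendsto (exp : A → A) (𝓝 0) (𝓝 1) := by
      let := NormedAlgebra.restrictScalars ℚ ℝ A
      simpa using (exp_continuous (𝔸 := A)).tendsto 0
    filter_upwards [hexp (hUo.mem_nhds h1U), e.open_source.mem_nhds h0src] with X hXU hXs hXM
    refine ⟨hXU, ?_⟩
    have hf := hfix X hXM 0 (zero_mem H)
    simp only [add_zero] at hf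
    have : e X = exp X := by simp [hecoe, hΨ, hf]
    rw [← this, e.left_inv hXs]
    exact hf.1
  · obtain ⟨hgN, hgd⟩ := hdecomp g hg hgU
    obtain ⟨hgN', hgd'⟩ := hdecomp (g * h) (hS.mul_mem _ hg _ (hTS hh)) hghU
    obtain ⟨b1, b2, b3, b4, b5, -⟩ := hNpair _ hgN _ hgN'
    set W := e.symm g
    set W' := e.symm (g * h)
    simp only at b1 b2 b3 b4 b5
    -- With X, X' the M-coordinates of g and g h, d = exp(-X) exp(X') lies in T and is close to 1,
    -- so only its H-factor exp Y survives. Then exp X' = exp X exp Y, and injectivity of Ψ forces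
    -- X' = X.
    set d := exp (-pm W) * exp (pm W') with hdd
    set W1 := e.symm d
    have hdT : d ∈ T := by
      have h1 : exp (pm W') = g * h * exp (-ph W') := by
        rw [hgd', mul_assoc, exp_mul_exp_neg_self, mul_one]
      have h2 : d = exp (ph W) * h * exp (-ph W') := by
        rw [hdd, h1]
        conv_lhs => rw [hgd]
        simp only [← mul_assoc]
        rw [exp_neg_mul_exp_self, one_mul]
      rw [h2]
      exact hT.mul_mem _ (hT.mul_mem _ (hHT _ (hph _)) _ hh) _ (hHT _ (neg_mem (hph _)))
    have h1 : exp (pm W1) * exp (pc W1) * exp (ph W1) = d := e.right_inv b1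
    have hZ : pc W1 = 0 := by
      refine b2 (hpc _) ?_
      rw [hmid _ _ _ _ h1]
      exact hS.mul_mem _ (hS.mul_mem _ (hMG _ (neg_mem (hpm _))) _ (hTS hdT)) _
        (hTS (hHT _ (neg_mem (hph _))))
    rw [hZ, exp_zero, mul_one] at h1
    have hX : pm W1 = 0 := by
      refine b3 (hpm _) ?_
      have h2 : exp (pm W1) = d * exp (-ph W1) := by
        rw [← h1, mul_assoc, exp_mul_exp_neg_self, mul_one]
      rw [h2]
      exact hT.mul_mem _ hdT _ (hHT _ (neg_mem (hph _)))
    rw [hX, exp_zero, one_mul] at h1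
    have h3 : exp (pm W') = exp (pm W) * exp (ph W1) := by
      rw [h1, hdd, ← mul_assoc, exp_mul_exp_neg_self, one_mul]
    have hf := hfix (pm W') (hpm _) 0 (zero_mem H)
    simp only [add_zero] at hf
    have hf' := hfix (pm W) (hpm _) (ph W1) (hph _)
    have h4 : e (pm W') = e (pm W + ph W1) := by
      simp only [hecoe, hΨ]
      rw [hf.1, hf.2.1, hf.2.2, hf'.1, hf'.2.1, hf'.2.2]
      simpa using h3
    have h5 := e.injOn b4 b5 h4
    have h6 := congrArg pm h5
    rw [hf.1, hf'.1] at h6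
    exact h6

end LocalSlice

/-! ### Charts on homogeneous spaces of linear groups -/

section SliceCharts

open Filter Topology

variable (𝕜 : Type*) [NontriviallyNormedField 𝕜] {A : Type*} [NormedRing A] [NormedAlgebra 𝕜 A]
  {E : Type*} [NormedAddCommGroup E] [NormedSpace 𝕜 E]
  {G : Type*} [Group G] [TopologicalSpace G] [IsTopologicalGroup G]
  {X : Type*} [TopologicalSpace X] [MulAction G X] [ContinuousConstSMul G X]

/-- A chart of the homogeneous space `X` of the linear group `ι : G →* A` is a slice chart if its
inverse lifts locally and analytically to `G`, and its coordinates on `G` are locally analytic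
functions of the linear representation. -/
structure IsSliceChart (ι : G →* A) (x₀ : X) (e : OpenPartialHomeomorph X E) : Prop where
  exists_lift : ∀ v ∈ e.target, ∃ σ : E → G, AnalyticAt 𝕜 (fun w => ι (σ w)) v ∧
    ∀ᶠ w in 𝓝 v, e.symm w = σ w • x₀
  exists_coord : ∀ g : G, g • x₀ ∈ e.source → ∃ F : A → E, AnalyticAt 𝕜 F (ι g) ∧
    ∀ᶠ g' in 𝓝 g, e (g' • x₀) = F (ι g')

/-- The translate of a chart by a group element. -/
def translateChart (g : G) (e : OpenPartialHomeomorph X E) : OpenPartialHomeomorph X E :=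
  (Homeomorph.smul g⁻¹).transOpenPartialHomeomorph e

theorem translateChart_apply (g : G) (e : OpenPartialHomeomorph X E) (x : X) :
    translateChart g e x = e (g⁻¹ • x) := rfl

theorem translateChart_symm_apply (g : G) (e : OpenPartialHomeomorph X E) (v : E) :
    (translateChart g e).symm v = g • e.symm v := by
  simp [translateChart, Homeomorph.smul]

theorem mem_translateChart_source (g : G) (e : OpenPartialHomeomorph X E) (x : X) :
    x ∈ (translateChart g e).source ↔ g⁻¹ • x ∈ e.source := Iff.rfl

variable {𝕜}

theorem IsSliceChart.translate {ι : G →* A} {x₀ : X} {e : OpenPartialHomeomorph X E}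
    (he : IsSliceChart 𝕜 ι x₀ e) (g : G) : IsSliceChart 𝕜 ι x₀ (translateChart g e) where
  exists_lift v hv := by
    obtain ⟨σ, hσ, hev⟩ := he.exists_lift v hv
    refine ⟨fun w => g * σ w, ?_, ?_⟩
    · simp only [map_mul]
      exact analyticAt_const.mul hσ
    · filter_upwards [hev] with w hw
      rw [translateChart_symm_apply, hw, mul_smul]
  exists_coord k hk := by
    rw [mem_translateChart_source, ← mul_smul] at hk
    obtain ⟨F, hF, hev⟩ := he.exists_coord _ hk
    refine ⟨fun a => F (ι g⁻¹ * a), ?_, ?_⟩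
    · rw [map_mul] at hF
      exact hF.fun_comp (f := fun a => ι g⁻¹ * a) (analyticAt_const.mul analyticAt_id)
    · have hc : Tendsto (fun k' : G => g⁻¹ * k') (𝓝 k) (𝓝 (g⁻¹ * k)) :=
        (continuous_const_mul _).tendsto _
      filter_upwards [hc.eventually hev] with k' hk'
      rw [translateChart_apply, ← mul_smul, hk', map_mul]

theorem IsSliceChart.restrictScalars (𝕂 : Type*) [NontriviallyNormedField 𝕂] [NormedAlgebra 𝕂 𝕜]
    [NormedAlgebra 𝕂 A] [IsScalarTower 𝕂 𝕜 A] [NormedSpace 𝕂 E] [IsScalarTower 𝕂 𝕜 E]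
    {ι : G →* A} {x₀ : X} {e : OpenPartialHomeomorph X E}
    (he : IsSliceChart 𝕜 ι x₀ e) : IsSliceChart 𝕂 ι x₀ e where
  exists_lift v hv := by
    obtain ⟨σ, hσ, hev⟩ := he.exists_lift v hv
    exact ⟨σ, hσ.restrictScalars, hev⟩
  exists_coord g hg := by
    obtain ⟨F, hF, hev⟩ := he.exists_coord g hg
    exact ⟨F, hF.restrictScalars, hev⟩

theorem continuousAt_of_analyticAt_comp {ι : G →* A} (hι : IsInducing ι) {σ : E → G} {v : E}
    (hσ : AnalyticAt 𝕜 (fun w => ι (σ w)) v) : ContinuousAt σ v :=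
  hι.continuousAt_iff.2 hσ.continuousAt

/-- A transition map is a local lift of one chart followed by the coordinate function of the other,
both analytic through A. -/
theorem IsSliceChart.analyticAt_transition {ι : G →* A} (hι : IsInducing ι) {x₀ : X}
    {e e' : OpenPartialHomeomorph X E} (he : IsSliceChart 𝕜 ι x₀ e) (he' : IsSliceChart 𝕜 ι x₀ e')
    {v : E} (hv : v ∈ (e.symm.trans e').source) : AnalyticAt 𝕜 (e.symm.trans e') v := by
  rw [OpenPartialHomeomorph.trans_source] at hv
  obtain ⟨σ, hσ, hev⟩ := he.exists_lift v hv.1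
  have h1 : σ v • x₀ ∈ e'.source := by rw [← hev.self_of_nhds]; exact hv.2
  obtain ⟨F, hF, hev'⟩ := he'.exists_coord _ h1
  refine (hF.fun_comp (f := fun w => ι (σ w)) hσ).congr ?_
  filter_upwards [hev, (continuousAt_of_analyticAt_comp hι hσ).tendsto.eventually hev']
    with w hw hw'
  rw [OpenPartialHomeomorph.trans_apply, hw, hw']

theorem isManifold_of_isSliceChart [CompleteSpace E] [ChartedSpace E X] {ι : G →* A}
    (hι : IsInducing ι) {x₀ : X} (hatlas : ∀ e ∈ atlas E X, IsSliceChart 𝕜 ι x₀ e) :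
    IsManifold 𝓘(𝕜, E) ω X := by
  refine isManifold_of_contDiffOn _ _ _ fun e e' he he' => ?_
  simp only [modelWithCornersSelf_coe, modelWithCornersSelf_coe_symm, Function.id_comp,
    Function.comp_id, Set.preimage_id, Set.range_id, Set.inter_univ]
  intro v hv
  exact ((hatlas e he).analyticAt_transition hι (hatlas e' he') hv).contDiffAt.contDiffWithinAt

variable {EM : Type*} [NormedAddCommGroup EM] [NormedSpace 𝕜 EM] {HM : Type*} [TopologicalSpace HM]
  {I : ModelWithCorners 𝕜 EM HM} {M : Type*} [TopologicalSpace M] [ChartedSpace HM M]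

/-- Smoothness of a map into X can be tested on any lift to G, read in the linear algebra A.
Together with `exists_contMDiffAt_lift`, which supplies smooth local sections, it reduces the
calculus on X to calculus in A. -/
theorem contMDiffAt_of_lift [CompleteSpace E] [ChartedSpace E X] {ι : G →* A} (hι : IsInducing ι)
    {x₀ : X} (hx₀ : Continuous fun g : G => g • x₀)
    (hatlas : ∀ e ∈ atlas E X, IsSliceChart 𝕜 ι x₀ e)
    {n : WithTop ℕ∞} {f : M → X} {γ : M → G} {m : M}
    (hγ : ContMDiffAt I 𝓘(𝕜, A) n (fun m => ι (γ m)) m)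
    (hf : ∀ᶠ m' in 𝓝 m, f m' = γ m' • x₀) : ContMDiffAt I 𝓘(𝕜, E) n f m := by
  have hγc : ContinuousAt γ m := hι.continuousAt_iff.2 hγ.continuousAt
  have hfm : f m = γ m • x₀ := hf.self_of_nhds
  rw [contMDiffAt_iff_target]
  constructor
  · have : ContinuousAt (fun m' => γ m' • x₀) m := hx₀.continuousAt.comp hγc
    exact this.congr (hf.mono fun _ h => h.symm)
  · have hsrc : γ m • x₀ ∈ (chartAt E (f m)).source := by rw [← hfm]; exact mem_chart_source E _
    obtain ⟨F, hF, hev⟩ := (hatlas _ (chart_mem_atlas E (f m))).exists_coord _ hsrc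
    have h1 : ContMDiffAt I 𝓘(𝕜, E) n (fun m' => F (ι (γ m'))) m :=
      hF.contDiffAt.contMDiffAt.comp m hγ
    refine h1.congr_of_eventuallyEq ?_
    filter_upwards [hf, hγc.tendsto.eventually hev] with m' h1 h2
    simp only [Function.comp_apply, mfld_simps]
    rw [h1, h2]

theorem exists_contMDiffAt_lift [CompleteSpace E] [CompleteSpace A] [ChartedSpace E X] {ι : G →* A}
    (hι : IsInducing ι) {x₀ : X} (hatlas : ∀ e ∈ atlas E X, IsSliceChart 𝕜 ι x₀ e)
    (n : WithTop ℕ∞) (x : X) :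
    ∃ γ : X → G, ContMDiffAt 𝓘(𝕜, E) 𝓘(𝕜, A) n (fun y => ι (γ y)) x ∧
      ∀ᶠ y in 𝓝 x, γ y • x₀ = y := by
  have : IsManifold 𝓘(𝕜, E) ω X := isManifold_of_isSliceChart hι hatlas
  have : IsManifold 𝓘(𝕜, E) n X := IsManifold.of_le le_top
  have hsrc := mem_chart_source E x
  obtain ⟨σ, hσ, hev⟩ := (hatlas _ (chart_mem_atlas E x)).exists_lift _
    ((chartAt E x).map_source hsrc)
  refine ⟨fun y => σ (chartAt E x y), ?_, ?_⟩
  · have h1 : ContMDiffAt 𝓘(𝕜, E) 𝓘(𝕜, E) n (chartAt E x) x :=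
      contMDiffAt_of_mem_maximalAtlas (IsManifold.chart_mem_maximalAtlas x) hsrc
    exact hσ.contDiffAt.contMDiffAt.comp x h1
  · filter_upwards [((chartAt E x).continuousAt hsrc).tendsto.eventually hev,
      (chartAt E x).open_source.mem_nhds hsrc] with y hy hys
    rw [← hy, (chartAt E x).left_inv hys]

/-- A homogeneous space with a slice chart around the base point carries an atlas of translates. -/
@[reducible] def homogeneousChartedSpace {x₀ : X} (e : OpenPartialHomeomorph X E)
    (he : x₀ ∈ e.source) (htrans : ∀ x : X, ∃ g : G, g • x₀ = x) : ChartedSpace E X where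
  atlas := Set.range fun g : G => translateChart g e
  chartAt x := translateChart (htrans x).choose e
  mem_chart_source x := by
    rw [mem_translateChart_source, inv_smul_eq_iff.2 (htrans x).choose_spec.symm]
    exact he
  chart_mem_atlas x := ⟨_, rfl⟩

end SliceCharts

/-! ### Exponential charts at the base point -/

section SliceChartExistence

open Filter NormedSpace Topology

variable {𝕜 : Type*} [RCLike 𝕜] {A : Type*} [NormedRing A] [NormedAlgebra ℝ A]
  [FiniteDimensional ℝ A] [NormedAlgebra 𝕜 A] [IsScalarTower ℝ 𝕜 A]
  {E : Type*} [NormedAddCommGroup E] [NormedSpace 𝕜 E]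
  {G : Type*} [Group G] [TopologicalSpace G] [IsTopologicalGroup G]
  {X : Type*} [TopologicalSpace X] [MulAction G X] [ContinuousConstSMul G X]

/-- Exponential slice chart around the base point of the quotient of two closed linear groups. -/
theorem exists_isSliceChart {ι : G →* A} (hι : IsInducing ι) {T : Set A}
    (hS : IsClosedLinearGroup (Set.range ι)) (hT : IsClosedLinearGroup T) (hTS : T ⊆ Set.range ι)
    {M H K : Submodule 𝕜 A} (hK : ∀ X, X ∈ K ↔ X ∈ lieSet (Set.range ι))
    (hH : ∀ X, X ∈ H ↔ X ∈ lieSet T) (hHM : Disjoint H M) (hsup : H ⊔ M = K)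
    {L : E →L[𝕜] A} {l : A →L[𝕜] E} (hLM : ∀ v, L v ∈ M) (hlL : ∀ v, l (L v) = v)
    (hLl : ∀ Y ∈ M, L (l Y) = Y) {x₀ : X} (hstab : ∀ g : G, g • x₀ = x₀ ↔ ι g ∈ T)
    (hcont : Continuous fun g : G => g • x₀) (hopen : IsOpenMap fun g : G => g • x₀) :
    ∃ ψ : OpenPartialHomeomorph X E, IsSliceChart 𝕜 ι x₀ ψ ∧ x₀ ∈ ψ.source ∧ ψ x₀ = 0 ∧
      ∀ v ∈ ψ.target, ∀ g : G, ι g = exp (L v) → ψ.symm v = g • x₀ := by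
  have := FiniteDimensional.complete ℝ A
  obtain ⟨U, r, hUo, h1U, hran, hr1, hrM, hrT, hexp, hconst⟩ :=
    exists_local_slice hS hT hTS hK hH hHM hsup
  have hmemS : ∀ v, ∃ g : G, ι g = exp (L v) := fun v =>
    exp_mem_of_mem_lieSet ((hK _).1 (hsup ▸ Submodule.mem_sup_right (hLM v)))
  choose s hs using hmemS
  have hLc : Tendsto L (𝓝 0) (𝓝 0) := by simpa using L.continuous.tendsto 0
  have hsc : Continuous s := by
    rw [hι.continuous_iff]
    have : (fun v => ι (s v)) = fun v => exp (L v) := funext hs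
    rw [Function.comp_def, this]
    let := NormedAlgebra.restrictScalars ℚ ℝ A
    exact exp_continuous.comp L.continuous
  obtain ⟨N, hNsub, hNo, h0N⟩ := mem_nhds_iff.1 (hLc.eventually hexp)
  have hN : ∀ v ∈ N, exp (L v) ∈ U ∧ r (exp (L v)) = L v := fun v hv => hNsub hv (hLM v)
  set V : Set G := ι ⁻¹' (U ∩ (fun a => l (r a)) ⁻¹' N) with hV
  have hρc : ContinuousOn (fun a => l (r a)) U :=
    l.continuous.comp_continuousOn hran.continuousOn
  have hVo : IsOpen V := (hρc.isOpen_inter_preimage hUo hNo).preimage hι.continuous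
  have h1V : (1 : G) ∈ V := by simp [hV, h1U, hr1, h0N]
  have hιinv : ∀ (g : G) (Y : A), ι g = exp Y → ι g⁻¹ = exp (-Y) := fun g Y h => by
    calc ι g⁻¹ = ι g⁻¹ * (exp Y * exp (-Y)) := by rw [exp_mul_exp_neg_self, mul_one]
      _ = exp (-Y) := by rw [← h, ← mul_assoc, ← map_mul, inv_mul_cancel, map_one, one_mul]
  have hsmul : ∀ g k : G, g • x₀ = k • x₀ ↔ ι (g⁻¹ * k) ∈ T := fun g k => by
    rw [← hstab, mul_smul, inv_smul_eq_iff]; exact eq_comm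
  have hwd : ∀ g ∈ V, ∀ k ∈ V, g • x₀ = k • x₀ → l (r (ι k)) = l (r (ι g)) := by
    intro g hg k hk h
    have h1 := hconst (ι g) ⟨g, rfl⟩ hg.1 _ ((hsmul g k).1 h) (by
      rw [← map_mul, mul_inv_cancel_left]; exact hk.1)
    rw [← map_mul, mul_inv_cancel_left] at h1
    rw [h1]
  classical
  -- The coordinate of a point is read off from any representative in V; `hwd`, the constancy of r
  -- on cosets, makes the choice irrelevant. The value 0 outside the chart domain plays no role.
  let ψf : X → E := fun x => if h : ∃ g ∈ V, g • x₀ = x then l (r (ι h.choose)) else 0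
  have hψ : ∀ g ∈ V, ψf (g • x₀) = l (r (ι g)) := by
    intro g hg
    have h : ∃ k ∈ V, k • x₀ = g • x₀ := ⟨g, hg, rfl⟩
    simp only [ψf, dif_pos h]
    exact hwd g hg _ h.choose_spec.1 h.choose_spec.2.symm
  have hsV : ∀ v ∈ N, s v ∈ V := fun v hv => by
    simp only [hV, Set.mem_preimage, Set.mem_inter_iff, hs]
    exact ⟨(hN v hv).1, by rw [(hN v hv).2, hlL]; exact hv⟩
  have hnhds : ∀ g : G, 𝓝 (g • x₀) = map (fun g : G => g • x₀) (𝓝 g) := fun g =>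
    le_antisymm (hopen.nhds_le g) hcont.continuousAt
  let ψ : OpenPartialHomeomorph X E :=
    { toFun := ψf
      invFun := fun v => s v • x₀
      source := (fun g : G => g • x₀) '' V
      target := N
      map_source' := by
        rintro _ ⟨g, hg, rfl⟩
        simp only [hψ g hg]
        exact hg.2
      map_target' := fun v hv => ⟨s v, hsV v hv, rfl⟩
      left_inv' := by
        rintro _ ⟨g, hg, rfl⟩
        simp only [hψ g hg]
        rw [hsmul, map_mul, hιinv _ _ (hs _), hLl _ (hrM _)]
        exact hrT _ ⟨g, rfl⟩ hg.1
      right_inv' := by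
        intro v hv
        simp only [hψ _ (hsV v hv), hs, (hN v hv).2, hlL]
      open_source := hopen _ hVo
      open_target := hNo
      continuousOn_toFun := by
        rintro _ ⟨g, hg, rfl⟩
        refine ContinuousAt.continuousWithinAt ?_
        simp only [ContinuousAt, hnhds g, tendsto_map'_iff, hψ g hg]
        have h1 : ContinuousAt (fun g' => l (r (ι g'))) g :=
          ContinuousAt.comp (f := ι) (g := fun a => l (r a))
            (hρc.continuousAt (hUo.mem_nhds hg.1)) hι.continuous.continuousAt
        refine h1.tendsto.congr' ?_
        filter_upwards [hVo.mem_nhds hg] with g' hg'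
        exact (hψ g' hg').symm
      continuousOn_invFun := (hcont.comp hsc).continuousOn }
  have hψcoe : ∀ x, ψ x = ψf x := fun _ => rfl
  refine ⟨ψ, ⟨fun v hv => ⟨s, ?_, Eventually.of_forall fun w => rfl⟩, ?_⟩,
    ⟨1, h1V, one_smul _ _⟩, ?_, ?_⟩
  · simp only [hs]
    exact (exp_analytic (L v)).fun_comp (L.analyticAt v)
  · rintro g ⟨k, hk, hkg⟩
    have h1 : (k⁻¹ * g)⁻¹ • x₀ = x₀ := by
      rw [inv_smul_eq_iff]
      have : k • x₀ = g • x₀ := hkg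
      rw [mul_smul, ← this, inv_smul_smul]
    -- The element g itself need not lie in V. Right multiplication by (k⁻¹ g)⁻¹, which fixes the
    -- base point, carries it to the representative k ∈ V.
    refine ⟨fun a => l (r (a * ι (k⁻¹ * g)⁻¹)), ?_, ?_⟩
    · have h2 : ι g * ι (k⁻¹ * g)⁻¹ = ι k := by rw [← map_mul]; congr 1; group
      refine (l.analyticAt _).fun_comp (f := fun a => r (a * ι (k⁻¹ * g)⁻¹)) ?_
      refine AnalyticAt.fun_comp (g := r) (f := fun a => a * ι (k⁻¹ * g)⁻¹) ?_
        (analyticAt_id.mul analyticAt_const)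
      rw [h2]
      exact hran _ hk.1
    · have hc : Tendsto (fun g' : G => g' * (k⁻¹ * g)⁻¹) (𝓝 g) (𝓝 k) := by
        have := (continuous_mul_const (k⁻¹ * g)⁻¹).tendsto g
        have h2 : g * (k⁻¹ * g)⁻¹ = k := by group
        rwa [h2] at this
      filter_upwards [hc (hVo.mem_nhds hk)] with g' hg'
      rw [hψcoe, ← map_mul, ← hψ _ hg', mul_smul, h1]
  · have := hψ 1 h1V
    rw [one_smul] at this
    rw [hψcoe, this, map_one, hr1, map_zero]
  · intro v hv g hg
    change s v • x₀ = g • x₀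
    rw [hsmul, map_mul, hιinv _ _ (hs _), hg, exp_neg_mul_exp_self]
    exact hT.one_mem

end SliceChartExistence

/-! ### Holomorphic functions on the quotient -/

section HolomorphicFunctions

open Filter Topology

variable {A : Type*} [NormedRing A] [NormedAlgebra ℂ A]
  {G : Type*} [Group G] [TopologicalSpace G] [IsTopologicalGroup G]
  {X : Type*} [TopologicalSpace X] [MulAction G X] [ContinuousConstSMul G X]

/-- On a homogeneous space with slice charts the holomorphic functions are those whose pullback to
the group is locally an analytic function of the linear representation. -/
theorem mdifferentiableOn_iff_analytic_pullback {d : ℕ} [ChartedSpace (Fin d → ℂ) X] {ι : G →* A}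
    (hι : IsInducing ι) {x₀ : X} (hcont : Continuous fun g : G => g • x₀)
    (hatlas : ∀ e ∈ atlas (Fin d → ℂ) X, IsSliceChart ℂ ι x₀ e) {U : Set X} (hU : IsOpen U)
    (f : X → ℂ) :
    MDifferentiableOn 𝓘(ℂ, Fin d → ℂ) 𝓘(ℂ, ℂ) f U ↔
      ∀ g : G, g • x₀ ∈ U → ∃ F : A → ℂ, AnalyticAt ℂ F (ι g) ∧
        ∀ᶠ h in 𝓝 g, f (h • x₀) = F (ι h) := by
  have : IsManifold 𝓘(ℂ, Fin d → ℂ) ω X := isManifold_of_isSliceChart hι hatlas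
  have : IsManifold 𝓘(ℂ, Fin d → ℂ) 1 X := IsManifold.of_le le_top
  constructor
  · intro hf g hg
    set e := chartAt (Fin d → ℂ) (g • x₀) with he
    have hsrc : g • x₀ ∈ e.source := mem_chart_source _ _
    obtain ⟨F, hF, hev⟩ := (hatlas e (chart_mem_atlas _ _)).exists_coord g hsrc
    have han : AnalyticAt ℂ (fun w => f (e.symm w)) (e (g • x₀)) := by
      -- Osgood's lemma enters here: f is only known to be complex differentiable in the chart.
      refine analyticAt_of_eventually_differentiableAt_pi ?_
      have hopen : IsOpen (e.target ∩ e.symm ⁻¹' U) := e.symm.isOpen_inter_preimage hU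
      have hmem : e (g • x₀) ∈ e.target ∩ e.symm ⁻¹' U :=
        ⟨e.map_source hsrc, by rw [Set.mem_preimage, e.left_inv hsrc]; exact hg⟩
      filter_upwards [hopen.mem_nhds hmem] with w hw
      rw [← mdifferentiableAt_iff_differentiableAt]
      have h1 : MDifferentiableAt 𝓘(ℂ, Fin d → ℂ) 𝓘(ℂ, ℂ) f (e.symm w) :=
        (hf _ hw.2).mdifferentiableAt (hU.mem_nhds hw.2)
      exact h1.comp w (mdifferentiableAt_atlas_symm (chart_mem_atlas _ _) hw.1)
    have hFg : e (g • x₀) = F (ι g) := hev.self_of_nhds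
    refine ⟨fun a => f (e.symm (F a)), ?_, ?_⟩
    · rw [hFg] at han
      exact han.fun_comp (g := fun w => f (e.symm w)) hF
    · filter_upwards [hev, hcont.continuousAt (e.open_source.mem_nhds hsrc)] with h h1 h2
      rw [← h1, e.left_inv h2]
  · intro hf x hx
    set e := chartAt (Fin d → ℂ) x with he
    have hsrc : x ∈ e.source := mem_chart_source _ _
    obtain ⟨σ, hσ, hev⟩ := (hatlas e (chart_mem_atlas _ _)).exists_lift _ (e.map_source hsrc)
    have hx' : σ (e x) • x₀ = x := by rw [← hev.self_of_nhds, e.left_inv hsrc]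
    obtain ⟨F, hF, hevF⟩ := hf (σ (e x)) (by rw [hx']; exact hx)
    have hd : DifferentiableAt ℂ (fun w => f (e.symm w)) (e x) := by
      refine ((hF.fun_comp (f := fun w => ι (σ w)) hσ).congr ?_).differentiableAt
      filter_upwards [hev, (continuousAt_of_analyticAt_comp hι hσ).tendsto.eventually hevF]
        with w h1 h2
      rw [h1, h2]
    have h1 : MDifferentiableAt 𝓘(ℂ, Fin d → ℂ) 𝓘(ℂ, ℂ) (fun y => f (e.symm (e y))) x :=
      hd.mdifferentiableAt.comp x (mdifferentiableAt_atlas (chart_mem_atlas _ _) hsrc)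
    refine (h1.congr_of_eventuallyEq ?_).mdifferentiableWithinAt
    filter_upwards [e.open_source.mem_nhds hsrc] with y hy
    rw [e.left_inv hy]

end HolomorphicFunctions

/-! ### Closed linear groups as Lie groups -/

section LieGroupCharts

open Filter Topology

variable {A : Type*} [NormedRing A] [NormedAlgebra ℝ A] [CompleteSpace A]
  {E : Type*} [NormedAddCommGroup E] [NormedSpace ℝ E] [CompleteSpace E]
  {K : Type*} [Group K] [TopologicalSpace K] [IsTopologicalGroup K] [ChartedSpace E K]

theorem contMDiff_of_isSliceChart {ι : K →* A} (hι : IsInducing ι)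
    (hatlas : ∀ e ∈ atlas E K, IsSliceChart ℝ ι (1 : K) e) (n : WithTop ℕ∞) :
    ContMDiff 𝓘(ℝ, E) 𝓘(ℝ, A) n ι := by
  intro k
  obtain ⟨γ, hγ, hev⟩ := exists_contMDiffAt_lift hι hatlas n k
  refine hγ.congr_of_eventuallyEq ?_
  filter_upwards [hev] with y hy
  rw [smul_eq_mul, mul_one] at hy
  rw [hy]

/-- K is its own homogeneous space with base point 1, so the group operations are their own lifts.
In A they become multiplication and `Ring.inverse`, which is smooth at units. -/
theorem lieGroup_of_isSliceChart {ι : K →* A} (hι : IsInducing ι)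
    (hatlas : ∀ e ∈ atlas E K, IsSliceChart ℝ ι (1 : K) e) (n : WithTop ℕ∞) :
    LieGroup 𝓘(ℝ, E) n K := by
  have : IsManifold 𝓘(ℝ, E) ω K := isManifold_of_isSliceChart hι hatlas
  have : IsManifold 𝓘(ℝ, E) n K := IsManifold.of_le le_top
  have hcont : Continuous fun g : K => g • (1 : K) := by simpa using continuous_id'
  have hsm := contMDiff_of_isSliceChart hι hatlas n
  refine { contMDiff_mul := fun q => ?_, contMDiff_inv := fun k => ?_ }
  · refine contMDiffAt_of_lift hι hcont hatlas (γ := fun q : K × K => q.1 * q.2) ?_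
      (Eventually.of_forall fun q => by simp)
    simp only [map_mul]
    have h1 : ContMDiffAt (𝓘(ℝ, E).prod 𝓘(ℝ, E)) 𝓘(ℝ, A × A) n
        (fun q : K × K => (ι q.1, ι q.2)) q :=
      ((hsm.comp contMDiff_fst) q).prodMk_space ((hsm.comp contMDiff_snd) q)
    have h2 : ContDiff ℝ n (fun p : A × A => p.1 * p.2) := contDiff_mul
    exact h2.contMDiff.contMDiffAt.comp q h1
  · refine contMDiffAt_of_lift hι hcont hatlas (γ := fun k : K => k⁻¹) ?_
      (Eventually.of_forall fun q => by simp)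
    have h1 : ∀ k : K, ι k⁻¹ = Ring.inverse (ι k) := fun k => by
      have h := Ring.inverse_unit ((Units.map ι) (toUnits k))
      rw [← map_inv] at h
      simpa using h.symm
    simp only [h1]
    have h2 : ContDiffAt ℝ n (Ring.inverse : A → A) (ι k) :=
      contDiffAt_ringInverse ℝ ((Units.map ι) (toUnits k))
    exact h2.contMDiffAt.comp k (hsm k)

end LieGroupCharts

/-! ### Smoothness of the action and of semi-equivariant maps -/

section Actions

open Filter Topology

variable {𝕜 : Type*} [RCLike 𝕜] {A : Type*} [NormedRing A] [NormedAlgebra 𝕜 A]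
  [NormedAlgebra ℝ A] [IsScalarTower ℝ 𝕜 A]
  [CompleteSpace A] {E : Type*} [NormedAddCommGroup E] [NormedSpace 𝕜 E] [NormedSpace ℝ E]
  [IsScalarTower ℝ 𝕜 E] [CompleteSpace E] {G : Type*} [Group G] [TopologicalSpace G] [IsTopologicalGroup G]
  {X : Type*} [TopologicalSpace X] [MulAction G X] [ContinuousConstSMul G X]
  [ChartedSpace E X]

/-- A lift of (m, x) ↦ φ(m) x is φ(m) γ(x) with γ a local section. The parameter φ will be the
inclusion of G_u into G_ℂ. -/
theorem contMDiff_hom_smul {ι : G →* A} (hι : IsInducing ι) {x₀ : X}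
    (hcont : Continuous fun g : G => g • x₀)
    (hatlas : ∀ e ∈ atlas E X, IsSliceChart 𝕜 ι x₀ e) {EM HM M : Type*}
    [NormedAddCommGroup EM] [NormedSpace ℝ EM] [TopologicalSpace HM]
    {I : ModelWithCorners ℝ EM HM} [TopologicalSpace M] [ChartedSpace HM M] {n : WithTop ℕ∞}
    {φ : M → G} (hφ : ContMDiff I 𝓘(ℝ, A) n fun m => ι (φ m)) :
    ContMDiff (I.prod 𝓘(ℝ, E)) 𝓘(ℝ, E) n (fun q : M × X => φ q.1 • q.2) := by
  have hatlas' : ∀ e ∈ atlas E X, IsSliceChart ℝ ι x₀ e := fun e he =>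
    (hatlas e he).restrictScalars ℝ
  intro q
  obtain ⟨γ, hγ, hev⟩ := exists_contMDiffAt_lift hι hatlas' n q.2
  refine contMDiffAt_of_lift hι hcont hatlas' (γ := fun q => φ q.1 * γ q.2) ?_ ?_
  · simp only [map_mul]
    have h1 : ContMDiffAt (I.prod 𝓘(ℝ, E)) 𝓘(ℝ, A × A) n
        (fun q : M × X => (ι (φ q.1), ι (γ q.2))) q :=
      ((hφ.comp contMDiff_fst) q).prodMk_space (hγ.comp q contMDiffAt_snd)
    have h2 : ContDiff ℝ n (fun p : A × A => p.1 * p.2) := contDiff_mul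
    exact h2.contMDiff.contMDiffAt.comp q h1
  · filter_upwards [continuous_snd.continuousAt.tendsto.eventually hev] with p hp
    rw [mul_smul, hp]

theorem mdifferentiable_const_smul {ι : G →* A} (hι : IsInducing ι) {x₀ : X}
    (hcont : Continuous fun g : G => g • x₀)
    (hatlas : ∀ e ∈ atlas E X, IsSliceChart 𝕜 ι x₀ e) (g : G) :
    MDifferentiable 𝓘(𝕜, E) 𝓘(𝕜, E) (fun x : X => g • x) := by
  intro x
  obtain ⟨γ, hγ, hev⟩ := exists_contMDiffAt_lift hι hatlas 1 x
  refine (contMDiffAt_of_lift hι hcont hatlas (n := 1) (γ := fun x => g * γ x) ?_ ?_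
    ).mdifferentiableAt one_ne_zero
  · simp only [map_mul]
    have h2 : ContDiff 𝕜 1 (fun p : A => ι g * p) := contDiff_const.mul contDiff_id
    exact h2.contMDiff.contMDiffAt.comp x hγ
  · filter_upwards [hev] with p hp
    rw [mul_smul, hp]

theorem contMDiff_of_semiequivariant {ι : G →* A} (hι : IsInducing ι) {x₀ : X}
    (hcont : Continuous fun g : G => g • x₀)
    (hatlas : ∀ e ∈ atlas E X, IsSliceChart 𝕜 ι x₀ e) {Θ : A →L[ℝ] A} {τ : G → G}
    (hτ : ∀ g, ι (τ g) = Θ (ι g)) {σ : X → X} (hσ : ∀ g : G, σ (g • x₀) = τ g • x₀)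
    (n : WithTop ℕ∞) : ContMDiff 𝓘(ℝ, E) 𝓘(ℝ, E) n σ := by
  have hatlas' : ∀ e ∈ atlas E X, IsSliceChart ℝ ι x₀ e := fun e he =>
    (hatlas e he).restrictScalars ℝ
  intro x
  obtain ⟨γ, hγ, hev⟩ := exists_contMDiffAt_lift hι hatlas' n x
  refine contMDiffAt_of_lift hι hcont hatlas' (γ := fun x => τ (γ x)) ?_ ?_
  · simp only [hτ]
    exact Θ.contDiff.contMDiff.contMDiffAt.comp x hγ
  · filter_upwards [hev] with p hp
    rw [← hσ, hp]

/-- In charts σ is F ∘ Θ ∘ ι ∘ s with F and ι ∘ s analytic over 𝕜. Its derivative is thus 𝕜-linear,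
then Θ, then 𝕜-linear, and inherits the sign rule of Θ for j. -/
theorem mfderiv_of_semiequivariant {ι : G →* A} (hι : IsInducing ι) {x₀ : X}
    (hcont : Continuous fun g : G => g • x₀)
    (hatlas : ∀ e ∈ atlas E X, IsSliceChart 𝕜 ι x₀ e) {Θ : A →L[ℝ] A}
    {j : 𝕜} (hΘ : ∀ a, Θ (j • a) = -(j • Θ a)) {τ : G → G}
    (hτ : ∀ g, ι (τ g) = Θ (ι g)) {σ : X → X} (hσ : ∀ g : G, σ (g • x₀) = τ g • x₀) (x : X)
    (v : E) :
    let D : E →L[ℝ] E := mfderiv 𝓘(ℝ, E) 𝓘(ℝ, E) σ x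
    D (j • v) = -(j • D v) := by
  intro D
  have hMD : MDifferentiableAt 𝓘(ℝ, E) 𝓘(ℝ, E) σ x :=
    (contMDiff_of_semiequivariant hι hcont hatlas hτ hσ 1 x).mdifferentiableAt one_ne_zero
  set e := chartAt E x with he
  have hsrc : x ∈ e.source := mem_chart_source _ _
  obtain ⟨s, hs, hev⟩ := (hatlas e (chart_mem_atlas _ _)).exists_lift _ (e.map_source hsrc)
  have hx : s (e x) • x₀ = x := by rw [← hev.self_of_nhds, e.left_inv hsrc]
  have hcoord := (hatlas _ (chart_mem_atlas E (σ x))).exists_coord (τ (s (e x)))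
    (by rw [← hσ, hx]; exact mem_chart_source _ _)
  obtain ⟨F, hF, hevF⟩ := hcoord
  rw [hτ] at hF
  have hτs : ContinuousAt (fun w => τ (s w)) (e x) := by
    rw [hι.continuousAt_iff]
    simp only [Function.comp_def, hτ]
    exact Θ.continuous.continuousAt.comp hs.continuousAt
  have heq : (fun w => chartAt E (σ x) (σ (e.symm w))) =ᶠ[𝓝 (e x)]
      fun w => F (Θ (ι (s w))) := by
    filter_upwards [hev, hτs.tendsto.eventually hevF] with w h1 h2
    rw [h1, hσ, h2, hτ]
  have hsd : HasFDerivAt (fun w => ι (s w))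
      ((fderiv 𝕜 (fun w => ι (s w)) (e x)).restrictScalars ℝ) (e x) :=
    hs.differentiableAt.hasFDerivAt.restrictScalars ℝ
  have hFd : HasFDerivAt F ((fderiv 𝕜 F (Θ (ι (s (e x))))).restrictScalars ℝ)
      (Θ (ι (s (e x)))) := hF.differentiableAt.hasFDerivAt.restrictScalars ℝ
  have hd := hFd.comp (e x) (Θ.hasFDerivAt.comp (e x) hsd)
  have hmf : D = fderiv ℝ (fun w => chartAt E (σ x) (σ (e.symm w))) (e x) := by
    refine Eq.trans (b := fderivWithin ℝ (writtenInExtChartAt 𝓘(ℝ, E) 𝓘(ℝ, E) x σ)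
      (Set.range 𝓘(ℝ, E)) (extChartAt 𝓘(ℝ, E) x x)) hMD.mfderiv ?_
    simp only [mfld_simps, fderivWithin_univ, writtenInExtChartAt]
    rfl
  rw [hmf, heq.fderiv_eq]
  have h3 : fderiv ℝ (fun w => F (Θ (ι (s w)))) (e x) = _ := hd.fderiv
  rw [h3]
  simp [hΘ]

end Actions

/-! ### One-parameter orbits as real submanifolds -/

section Submanifold

open Filter Topology

theorem exists_realCoordinates {E : Type*} [NormedAddCommGroup E] [NormedSpace ℝ E]
    [FiniteDimensional ℝ E] {u : E} (hu : u ≠ 0) :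
    ∃ (n : ℕ) (Λ : E ≃L[ℝ] (Fin 1 → ℝ) × (Fin n → ℝ)),
      ∀ v, (Λ v).2 = 0 ↔ ∃ t : ℝ, v = t • u := by
  obtain ⟨q, hq⟩ := Submodule.exists_isCompl (Submodule.span ℝ {u})
  have h1 : Module.finrank ℝ (Submodule.span ℝ {u}) = Module.finrank ℝ (Fin 1 → ℝ) := by
    rw [finrank_span_singleton hu]; simp
  have h2 : Module.finrank ℝ q = Module.finrank ℝ (Fin (Module.finrank ℝ q) → ℝ) := by simp
  let Λ := (Submodule.prodEquivOfIsCompl _ _ hq).symm.trans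
    ((LinearEquiv.ofFinrankEq _ _ h1).prodCongr (LinearEquiv.ofFinrankEq _ _ h2))
  refine ⟨Module.finrank ℝ q, Λ.toContinuousLinearEquiv, fun v => ?_⟩
  have h3 : (Λ v).2 = LinearEquiv.ofFinrankEq _ _ h2
      ((Submodule.prodEquivOfIsCompl _ _ hq).symm v).2 := rfl
  change (Λ v).2 = 0 ↔ _
  rw [h3, map_eq_zero_iff _ (LinearEquiv.injective _),
    Submodule.prodEquivOfIsCompl_symm_apply_snd_eq_zero, Submodule.mem_span_singleton]
  simp only [eq_comm]

variable {d : ℕ} {G : Type*} [Group G] [TopologicalSpace G] [IsTopologicalGroup G]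
  {X : Type*} [TopologicalSpace X] [MulAction G X] [ContinuousConstSMul G X]
  [ChartedSpace (Fin d → ℂ) X]

/-- The orbit of a one-parameter group that is a coordinate line of the slice chart and is separated
by a continuous function is a one-dimensional submanifold. -/
theorem isRealSubmanifold_range_smul [IsManifold 𝓘(ℝ, Fin d → ℂ) ∞ X] {x₀ : X}
    {ψ : OpenPartialHomeomorph X (Fin d → ℂ)} (hx₀ : x₀ ∈ ψ.source) (hψ0 : ψ x₀ = 0)
    (hatlas : ∀ g : G, translateChart g ψ ∈ atlas (Fin d → ℂ) X)
    {a : ℝ → G} (hadd : ∀ s t, a (s + t) = a s * a t) {u : Fin d → ℂ} (hu : u ≠ 0)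
    (hψa : ∀ t : ℝ, t • u ∈ ψ.target → ψ.symm (t • u) = a t • x₀)
    {τ : X → ℝ} (hτ : Continuous τ) (hτa : ∀ t, τ (a t • x₀) = t) :
    IsRealSubmanifold d 1 (Set.range fun t => a t • x₀) := by
  rintro _ ⟨t₀, rfl⟩
  have ha0 : a 0 = 1 := by
    have := hadd 0 0
    rw [add_zero] at this
    exact left_eq_mul.1 this
  have hneg : ∀ t, (a t)⁻¹ = a (-t) := fun t => by
    rw [inv_eq_iff_mul_eq_one, ← hadd, add_neg_cancel, ha0]
  obtain ⟨n, Λ, hΛ⟩ := exists_realCoordinates hu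
  have h0t : (0 : ℝ) • u ∈ ψ.target := by rw [zero_smul, ← hψ0]; exact ψ.map_source hx₀
  have hO : IsOpen {t : ℝ | (t - t₀) • u ∈ ψ.target} :=
    ψ.open_target.preimage (by fun_prop)
  -- Restricting the chart to W discards returns of the orbit: a point a_t x₀ in W has (t - t₀) u in
  -- the chart's range, so it sits on the coordinate line at its own parameter.
  set W : Set X := τ ⁻¹' {t : ℝ | (t - t₀) • u ∈ ψ.target} with hWdef
  have hW : IsOpen W := hO.preimage hτ
  set e := translateChart (a t₀) ψ with he
  have hemax : e ∈ IsManifold.maximalAtlas 𝓘(ℝ, Fin d → ℂ) ∞ X :=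
    IsManifold.subset_maximalAtlas (hatlas _)
  have hsrc : ((e.restrOpen W hW).trans Λ.toHomeomorph.toOpenPartialHomeomorph).source
      = e.source ∩ W := by simp
  have htgt : ((e.restrOpen W hW).trans Λ.toHomeomorph.toOpenPartialHomeomorph).target
      ⊆ Λ.symm ⁻¹' e.target := by
    intro p hp
    have h1 := OpenPartialHomeomorph.map_target _ hp
    rw [hsrc] at h1
    have h2 := e.map_source h1.1
    have h3 := OpenPartialHomeomorph.right_inv _ hp
    rw [← h3]
    simpa using h2
  refine ⟨n, (e.restrOpen W hW).trans Λ.toHomeomorph.toOpenPartialHomeomorph, ?_, ?_, ?_, ?_⟩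
  · rw [hsrc]
    refine ⟨?_, ?_⟩
    · rw [he, mem_translateChart_source, inv_smul_smul]
      exact hx₀
    · simp only [hWdef, Set.mem_preimage, Set.mem_ofPred_eq, hτa, sub_self]
      exact h0t
  · rw [hsrc]
    have h1 : ContMDiffOn 𝓘(ℝ, Fin d → ℂ) 𝓘(ℝ, Fin d → ℂ) ∞ e (e.source ∩ W) :=
      (contMDiffOn_of_mem_maximalAtlas hemax).mono Set.inter_subset_left
    exact Λ.contDiff.contMDiff.comp_contMDiffOn h1
  · have h1 : ContMDiffOn 𝓘(ℝ, Fin d → ℂ) 𝓘(ℝ, Fin d → ℂ) ∞ e.symm e.target :=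
      contMDiffOn_symm_of_mem_maximalAtlas hemax
    exact h1.comp (Λ.symm.contDiff (n := ∞)).contMDiff.contMDiffOn htgt
  · intro y hy
    rw [hsrc] at hy
    have hcoe : ((e.restrOpen W hW).trans Λ.toHomeomorph.toOpenPartialHomeomorph) y = Λ (e y) := rfl
    rw [hcoe, hΛ]
    constructor
    · rintro ⟨t, rfl⟩
      refine ⟨t - t₀, ?_⟩
      have h1 : (t - t₀) • u ∈ ψ.target := by
        have := hy.2
        simpa only [hWdef, Set.mem_preimage, Set.mem_ofPred_eq, hτa] using this
      rw [he, translateChart_apply, ← mul_smul, hneg, ← hadd, neg_add_eq_sub, ← hψa _ h1,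
        ψ.right_inv h1]
    · rintro ⟨t, ht⟩
      have h1 : t • u ∈ ψ.target := by rw [← ht]; exact e.map_source hy.1
      refine ⟨t₀ + t, ?_⟩
      have h2 := e.left_inv hy.1
      rw [ht, he, translateChart_symm_apply, hψa _ h1] at h2
      simp only [← h2, hadd, mul_smul]

end Submanifold

/-! ### The complexified Cayley algebra -/

section Octonions

open Matrix

theorem fin8_funext {x y : Fin 8 → ℂ} (h0 : x 0 = y 0) (h1 : x 1 = y 1) (h2 : x 2 = y 2)
    (h3 : x 3 = y 3) (h4 : x 4 = y 4) (h5 : x 5 = y 5) (h6 : x 6 = y 6) (h7 : x 7 = y 7) :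
    x = y := by
  funext i
  fin_cases i <;> assumption

theorem octMul_coords (x y : Fin 8 → ℂ) :
    octMul x y 0 = x 0 * y 0 - x 1 * y 1 - x 2 * y 2 - x 3 * y 3 - x 4 * y 4 - x 5 * y 5 - x 6 *
      y 6 - x 7 * y 7 ∧
    octMul x y 1 = x 0 * y 1 + x 1 * y 0 + x 2 * y 3 - x 3 * y 2 + x 4 * y 5 - x 5 * y 4 + x 6 *
      y 7 - x 7 * y 6 ∧
    octMul x y 2 = x 0 * y 2 - x 1 * y 3 + x 2 * y 0 + x 3 * y 1 - x 4 * y 6 + x 5 * y 7 + x 6 *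
      y 4 - x 7 * y 5 ∧
    octMul x y 3 = x 0 * y 3 + x 1 * y 2 - x 2 * y 1 + x 3 * y 0 + x 4 * y 7 + x 5 * y 6 - x 6 *
      y 5 - x 7 * y 4 ∧
    octMul x y 4 = x 0 * y 4 - x 1 * y 5 + x 2 * y 6 - x 3 * y 7 + x 4 * y 0 + x 5 * y 1 - x 6 *
      y 2 + x 7 * y 3 ∧
    octMul x y 5 = x 0 * y 5 + x 1 * y 4 - x 2 * y 7 - x 3 * y 6 - x 4 * y 1 + x 5 * y 0 + x 6 *
      y 3 + x 7 * y 2 ∧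
    octMul x y 6 = x 0 * y 6 - x 1 * y 7 - x 2 * y 4 + x 3 * y 5 + x 4 * y 2 - x 5 * y 3 + x 6 *
      y 0 + x 7 * y 1 ∧
    octMul x y 7 = x 0 * y 7 + x 1 * y 6 + x 2 * y 5 + x 3 * y 4 - x 4 * y 3 - x 5 * y 2 - x 6 *
      y 1 + x 7 * y 0 :=
  ⟨rfl, rfl, rfl, rfl, rfl, rfl, rfl, rfl⟩

theorem octMul_add_left (x x' y : Fin 8 → ℂ) : octMul (x + x') y = octMul x y + octMul x' y := by
  apply fin8_funext <;> simp only [octMul_coords, Pi.add_apply] <;> ring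

theorem octMul_add_right (x y y' : Fin 8 → ℂ) : octMul x (y + y') = octMul x y + octMul x y' := by
  apply fin8_funext <;> simp only [octMul_coords, Pi.add_apply] <;> ring

theorem octMul_smul_left (c : ℂ) (x y : Fin 8 → ℂ) : octMul (c • x) y = c • octMul x y := by
  apply fin8_funext <;> simp only [octMul_coords, Pi.smul_apply, smul_eq_mul] <;> ring

theorem octMul_smul_right (c : ℂ) (x y : Fin 8 → ℂ) : octMul x (c • y) = c • octMul x y := by
  apply fin8_funext <;> simp only [octMul_coords, Pi.smul_apply, smul_eq_mul] <;> ring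

theorem octMul_one (x : Fin 8 → ℂ) : octMul x (octE 0) = x := by
  apply fin8_funext <;> simp [octMul_coords, octE]

theorem one_octMul (x : Fin 8 → ℂ) : octMul (octE 0) x = x := by
  apply fin8_funext <;> simp [octMul_coords, octE]

theorem octMul_star (x y : Fin 8 → ℂ) : octMul (star x) (star y) = star (octMul x y) := by
  apply fin8_funext <;> simp [octMul_coords]

theorem dotProduct_octMul_self (x y : Fin 8 → ℂ) :
    octMul x y ⬝ᵥ octMul x y = (x ⬝ᵥ x) * (y ⬝ᵥ y) := by
  simp only [dotProduct, Fin.sum_univ_eight, octMul_coords]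
  ring

/-- The conjugate `x̄ = 2 x₀ e₀ - x` of an octonion. -/
def octConj (x : Fin 8 → ℂ) : Fin 8 → ℂ := (2 * x 0) • octE 0 - x

/-- The adjoint of right multiplication by y is right multiplication by ȳ. -/
theorem octMul_dotProduct (x y z : Fin 8 → ℂ) : octMul x y ⬝ᵥ z = x ⬝ᵥ octMul z (octConj y) := by
  simp [octMul_coords, octConj, octE, dotProduct, Fin.sum_univ_eight]
  ring

theorem octMul_octMul_self {u : Fin 8 → ℂ} (hu : u 0 = 0) (y : Fin 8 → ℂ) :
    octMul u (octMul u y) = -(u ⬝ᵥ u) • y := by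
  apply fin8_funext <;>
    simp only [octMul_coords, dotProduct, Fin.sum_univ_eight, hu, Pi.smul_apply, smul_eq_mul] <;>
    ring

/-- Linearized alternative law u(xy) + x(uy) = (ux + xu)y, where ux + xu = 2x₀u - 2(u · x)e₀ for
imaginary u. -/
theorem octMul_octMul_add {u : Fin 8 → ℂ} (hu : u 0 = 0) (x y : Fin 8 → ℂ) :
    octMul u (octMul x y) = (2 * x 0) • octMul u y - (2 * (u ⬝ᵥ x)) • y
      - octMul x (octMul u y) := by
  apply fin8_funext <;>
    simp only [octMul_coords, dotProduct, Fin.sum_univ_eight, hu, Pi.smul_apply, Pi.sub_apply,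
      smul_eq_mul] <;>
    ring

theorem octMul_skew {u : Fin 8 → ℂ} (hu : u 0 = 0) (x y : Fin 8 → ℂ) :
    octMul u x ⬝ᵥ y = -(x ⬝ᵥ octMul u y) := by
  simp only [octMul_coords, dotProduct, Fin.sum_univ_eight, hu]
  ring

theorem octMul_zero_coord (x y : Fin 8 → ℂ) : octMul x y 0 = 2 * x 0 * y 0 - x ⬝ᵥ y := by
  simp only [octMul_coords, dotProduct, Fin.sum_univ_eight]
  ring

/-- Left multiplication by an octonion, as a matrix. -/
def leftMulMat (u : Fin 8 → ℂ) : Matrix (Fin 8) (Fin 8) ℂ :=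
  LinearMap.toMatrix' ⟨⟨octMul u, octMul_add_right u⟩, fun c y => octMul_smul_right c u y⟩

/-- Right multiplication by an octonion, as a matrix. -/
def rightMulMat (u : Fin 8 → ℂ) : Matrix (Fin 8) (Fin 8) ℂ :=
  LinearMap.toMatrix' ⟨⟨fun x => octMul x u, fun x y => octMul_add_left x y u⟩,
    fun c y => octMul_smul_left c y u⟩

theorem leftMulMat_mulVec (u y : Fin 8 → ℂ) : leftMulMat u *ᵥ y = octMul u y := by
  rw [leftMulMat, ← Matrix.toLin'_apply, Matrix.toLin'_toMatrix']
  rfl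

theorem rightMulMat_mulVec (u y : Fin 8 → ℂ) : rightMulMat u *ᵥ y = octMul y u := by
  rw [rightMulMat, ← Matrix.toLin'_apply, Matrix.toLin'_toMatrix']
  rfl

theorem Matrix.eq_of_mulVec_eq {M N : Matrix (Fin 8) (Fin 8) ℂ} (h : ∀ x, M *ᵥ x = N *ᵥ x) :
    M = N := by
  refine Matrix.toLin'.injective (LinearMap.ext fun x => ?_)
  simpa using h x

theorem transpose_mul_self_of_dotProduct {M : Matrix (Fin 8) (Fin 8) ℂ}
    (h : ∀ x, M *ᵥ x ⬝ᵥ M *ᵥ x = x ⬝ᵥ x) : Mᵀ * M = 1 := by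
  have hpol : ∀ x y, M *ᵥ x ⬝ᵥ M *ᵥ y = x ⬝ᵥ y := by
    intro x y
    have h1 := h (x + y)
    rw [mulVec_add] at h1
    simp only [dotProduct_add, add_dotProduct, h, dotProduct_comm y x,
      dotProduct_comm (M *ᵥ y) (M *ᵥ x)] at h1
    linear_combination h1 / 2
  refine Matrix.eq_of_mulVec_eq fun y => ?_
  rw [one_mulVec, ← mulVec_mulVec]
  refine dotProduct_eq _ _ fun x => ?_
  rw [dotProduct_comm, dotProduct_mulVec, vecMul_transpose, hpol, dotProduct_comm]

theorem det_sq_of_transpose_mul_self {M : Matrix (Fin 8) (Fin 8) ℂ} (h : Mᵀ * M = 1) :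
    M.det ^ 2 = 1 := by
  have := congrArg Matrix.det h
  rwa [det_mul, det_transpose, det_one, ← sq] at this

theorem leftMulMat_transpose_mul {u : Fin 8 → ℂ} (hu : u ⬝ᵥ u = 1) :
    (leftMulMat u)ᵀ * leftMulMat u = 1 := by
  refine transpose_mul_self_of_dotProduct fun x => ?_
  rw [leftMulMat_mulVec, dotProduct_octMul_self, hu, one_mul]

/-- Orthogonality alone gives ±1. Since L_u² = -1, L_u is the square of the orthogonal matrix (1 +
L_u)/√2, which settles the sign. -/
theorem det_leftMulMat {u : Fin 8 → ℂ} (hu0 : u 0 = 0) (hu : u ⬝ᵥ u = 1) :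
    (leftMulMat u).det = 1 := by
  obtain ⟨c, hc⟩ : ∃ c : ℂ, c ^ 2 = 1 / 2 := IsAlgClosed.exists_pow_nat_eq _ two_pos
  set N : Matrix (Fin 8) (Fin 8) ℂ := c • (1 + leftMulMat u) with hN
  have hNv : ∀ x, N *ᵥ x = c • (x + octMul u x) := fun x => by
    rw [hN, smul_mulVec, add_mulVec, one_mulVec, leftMulMat_mulVec]
  have h1 : Nᵀ * N = 1 := by
    refine transpose_mul_self_of_dotProduct fun x => ?_
    rw [hNv]
    have h2 := octMul_skew hu0 x x
    simp only [smul_dotProduct, dotProduct_smul, dotProduct_add, add_dotProduct, smul_eq_mul,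
      dotProduct_octMul_self, hu, h2]
    linear_combination (2 * x ⬝ᵥ x) * hc
  have h2 : leftMulMat u = N * N := by
    refine Matrix.eq_of_mulVec_eq fun x => ?_
    rw [← mulVec_mulVec, hNv, hNv, leftMulMat_mulVec]
    simp only [octMul_smul_right, octMul_add_right, octMul_octMul_self hu0, hu]
    funext i
    simp only [Pi.smul_apply, Pi.add_apply, smul_eq_mul]
    linear_combination (-2 * octMul u x i) * hc
  rw [h2, det_mul, ← sq, det_sq_of_transpose_mul_self h1]

/-- The half-turn of the imaginary octonions around an imaginary vector `u` with `u · u = 1`. -/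
def halfTurnMat (u : Fin 8 → ℂ) : Matrix (Fin 8) (Fin 8) ℂ :=
  (2 : ℂ) • vecMulVec u u + (2 : ℂ) • vecMulVec (octE 0) (octE 0) - 1

theorem halfTurnMat_mulVec (u x : Fin 8 → ℂ) :
    halfTurnMat u *ᵥ x = (2 * (u ⬝ᵥ x)) • u + (2 * x 0) • octE 0 - x := by
  simp [halfTurnMat, sub_mulVec, add_mulVec, smul_mulVec, vecMulVec_mulVec, smul_smul, octE]

theorem halfTurnMat_transpose_mul {u : Fin 8 → ℂ} (hu0 : u 0 = 0) (hu : u ⬝ᵥ u = 1) :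
    (halfTurnMat u)ᵀ * halfTurnMat u = 1 := by
  refine transpose_mul_self_of_dotProduct fun x => ?_
  rw [halfTurnMat_mulVec]
  simp only [smul_dotProduct, dotProduct_smul, dotProduct_add, add_dotProduct, dotProduct_sub,
    sub_dotProduct, smul_eq_mul, hu, dotProduct_comm x u]
  simp [octE, hu0]
  ring

theorem det_one_sub_two_vecMulVec {u : Fin 8 → ℂ} (hu : u ⬝ᵥ u = 1) :
    (1 - (2 : ℂ) • vecMulVec u u : Matrix (Fin 8) (Fin 8) ℂ).det = -1 := by
  have h : (2 : ℂ) • vecMulVec u u = vecMulVec ((2 : ℂ) • u) u := by rw [smul_vecMulVec]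
  rw [h, sub_eq_add_neg, ← neg_vecMulVec, vecMulVec_eq Unit, det_one_add_mul_comm]
  simp [hu]
  norm_num

/-- A half-turn is minus the product of the reflections along u and e₀, and det(-1) = 1 in dimension
8. -/
theorem det_halfTurnMat {u : Fin 8 → ℂ} (hu0 : u 0 = 0) (hu : u ⬝ᵥ u = 1) :
    (halfTurnMat u).det = 1 := by
  have h : halfTurnMat u = -((1 - (2 : ℂ) • vecMulVec u u) *
      (1 - (2 : ℂ) • vecMulVec (octE 0) (octE 0))) := by
    refine Matrix.eq_of_mulVec_eq fun x => ?_
    rw [halfTurnMat_mulVec, neg_mulVec, ← mulVec_mulVec]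
    simp only [sub_mulVec, smul_mulVec, vecMulVec_mulVec, one_mulVec, mulVec_sub]
    simp [octE, hu0, smul_smul]
    funext i
    simp
    ring
  have h0 : octE 0 ⬝ᵥ octE 0 = 1 := by simp [octE]
  rw [h, det_neg, det_mul, det_one_sub_two_vecMulVec hu, det_one_sub_two_vecMulVec h0]
  norm_num

end Octonions

/-! ### The covering `Spin(7, ℂ) → SO(7, ℂ)` and transitivity properties of the compact groups -/

section SpinCover

open Matrix

theorem act_octE (g : SL8) (i j : Fin 8) : act g (octE j) i = (g : Matrix (Fin 8) (Fin 8) ℂ) i j := by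
  simp [act, octE]

theorem act_injective {g h : SL8} (H : ∀ x, act g x = act h x) : g = h :=
  Subtype.ext (Matrix.eq_of_mulVec_eq H)

theorem act_add (g : SL8) (x y : Fin 8 → ℂ) : act g (x + y) = act g x + act g y :=
  mulVec_add _ _ _

theorem act_neg (g : SL8) (x : Fin 8 → ℂ) : act g (-x) = -act g x :=
  mulVec_neg _ _

theorem act_smul (g : SL8) (c : ℂ) (x : Fin 8 → ℂ) : act g (c • x) = c • act g x :=
  mulVec_smul _ _ _

theorem act_dotProduct_act {g : SL8} (hg : g ∈ SO8) (x y : Fin 8 → ℂ) :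
    act g x ⬝ᵥ act g y = x ⬝ᵥ y := by
  have h : (g : Matrix (Fin 8) (Fin 8) ℂ)ᵀ * (g : Matrix (Fin 8) (Fin 8) ℂ) = 1 := hg
  rw [act, act, dotProduct_mulVec, ← mulVec_transpose, mulVec_mulVec, h, one_mulVec]

theorem cartanInv_apply (g : SL8) (i j : Fin 8) :
    (cartanInv g : Matrix (Fin 8) (Fin 8) ℂ) i j = star ((g : Matrix (Fin 8) (Fin 8) ℂ) i j) := rfl

theorem star_act (g : SL8) (x : Fin 8 → ℂ) : star (act g x) = act (cartanInv g) (star x) := by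
  funext i
  simp [act, mulVec, dotProduct, cartanInv_apply]

theorem cartanInv_eq_self_of_star_act {g : SL8} (h : ∀ x, star (act g x) = act g (star x)) :
    cartanInv g = g := by
  refine act_injective fun x => ?_
  have := h (star x)
  rwa [star_act, star_star] at this

theorem star_act_of_real {g : SL8} (hg : cartanInv g = g) {x : Fin 8 → ℂ} (hx : star x = x) :
    star (act g x) = act g x := by
  rw [star_act, hg, hx]

theorem cartanInv_inv_of_real {g : SL8} (hg : cartanInv g = g) : cartanInv g⁻¹ = g⁻¹ := by
  rw [map_inv, hg]

theorem cartanInv_mul_of_real {g h : SL8} (hg : cartanInv g = g) (hh : cartanInv h = h) :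
    cartanInv (g * h) = g * h := by
  rw [map_mul, hg, hh]

theorem star_octE (i : Fin 8) : star (octE i) = octE i := by
  simp [octE]

theorem octE_dotProduct (i : Fin 8) (x : Fin 8 → ℂ) : octE i ⬝ᵥ x = x i := by
  simp [octE]

theorem octE_dotProduct_octE (i j : Fin 8) : octE i ⬝ᵥ octE j = if i = j then 1 else 0 := by
  simp [octE, Pi.single_apply, eq_comm]

/-- `g` is a lift to `Spin(7, ℂ)` of `g₀ ∈ SO(7, ℂ)`. -/
structure IsLift (g₀ g : SL8) : Prop where
  mem_SO7 : g₀ ∈ SO7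
  mem_SO8 : g ∈ SO8
  octMul_act : ∀ x y, octMul (act g₀ x) (act g y) = act g (octMul x y)

theorem mem_Spin7_iff {g : SL8} : g ∈ Spin7 ↔ ∃ g₀, IsLift g₀ g :=
  ⟨fun ⟨h, g₀, h₀, H⟩ => ⟨g₀, h₀, h, H⟩, fun ⟨g₀, h⟩ => ⟨h.2, g₀, h.1, h.3⟩⟩

theorem IsLift.one : IsLift 1 1 := ⟨one_mem _, one_mem _, fun x y => by simp [act_one]⟩

theorem IsLift.mul {g₀ g h₀ h : SL8} (hg : IsLift g₀ g) (hh : IsLift h₀ h) :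
    IsLift (g₀ * h₀) (g * h) :=
  ⟨mul_mem hg.1 hh.1, mul_mem hg.2 hh.2, fun x y => by simp only [act_mul, hg.3, hh.3]⟩

theorem IsLift.inv {g₀ g : SL8} (hg : IsLift g₀ g) : IsLift g₀⁻¹ g⁻¹ := by
  refine ⟨inv_mem hg.1, inv_mem hg.2, fun x y => ?_⟩
  have h := hg.3 (act g₀⁻¹ x) (act g⁻¹ y)
  rw [act_act_inv, act_act_inv] at h
  rw [h, act_inv_act]

/-- Put y = g⁻¹ e₀ in the lifting identity. The base element is therefore unique, inherits reality
from g, and is polynomial in the entries of g because g⁻¹ = ᵗg. -/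
theorem IsLift.act_base {g₀ g : SL8} (hg : IsLift g₀ g) (x : Fin 8 → ℂ) :
    act g₀ x = act g (octMul x (act g⁻¹ (octE 0))) := by
  rw [← hg.3, act_act_inv, octMul_one]

theorem IsLift.eq_of_fixes {g₀ g : SL8} (hg : IsLift g₀ g) (h0 : act g (octE 0) = octE 0) :
    g₀ = g := by
  refine act_injective fun x => ?_
  have h := hg.3 x (octE 0)
  rwa [h0, octMul_one, octMul_one] at h

/-- `G2` is the stabilizer of e₀ in `Spin7`: if g e₀ = e₀, taking y = e₀ identifies g with its base.
-/
theorem IsLift.mem_G2_of_fixes {g₀ g : SL8} (hg : IsLift g₀ g) (h0 : act g (octE 0) = octE 0) :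
    g ∈ G2 := by
  have := hg.eq_of_fixes h0
  subst this
  exact ⟨hg.2, hg.3⟩

theorem act_octE_zero_of_mem_G2 {g : SL8} (hg : g ∈ G2) : act g (octE 0) = octE 0 := by
  have h := hg.2 (octE 0) (act g⁻¹ (octE 0))
  rwa [act_act_inv, octMul_one, one_octMul, act_act_inv] at h

theorem isLift_of_mem_G2 {g : SL8} (hg : g ∈ G2) : IsLift g g :=
  ⟨⟨hg.1, act_octE_zero_of_mem_G2 hg⟩, hg.1, hg.2⟩

theorem IsLift.eq_base {g₀ g₀' g : SL8} (hg : IsLift g₀ g) (hg' : IsLift g₀' g) : g₀ = g₀' :=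
  act_injective fun x => by rw [hg.act_base, hg'.act_base]

theorem IsLift.base_real {g₀ g : SL8} (hg : IsLift g₀ g) (hr : cartanInv g = g) :
    cartanInv g₀ = g₀ := by
  refine cartanInv_eq_self_of_star_act fun x => ?_
  rw [hg.act_base, hg.act_base, star_act, hr, ← octMul_star, star_act,
    cartanInv_inv_of_real hr, star_octE]

/-- The imaginary vectors `u` of the complexified Cayley algebra with `u · u = 1`. -/
abbrev UnitImag : Type := {u : Fin 8 → ℂ // u 0 = 0 ∧ u ⬝ᵥ u = 1}

/-- Left multiplication by a unit imaginary vector, as an element of `SL(8, ℂ)`. -/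
def leftMulSL (u : UnitImag) : SL8 := ⟨leftMulMat u, det_leftMulMat u.2.1 u.2.2⟩

/-- The half-turn around a unit imaginary vector, as an element of `SL(8, ℂ)`. -/
def halfTurnSL (u : UnitImag) : SL8 := ⟨halfTurnMat u, det_halfTurnMat u.2.1 u.2.2⟩

theorem act_leftMulSL (u : UnitImag) (x : Fin 8 → ℂ) : act (leftMulSL u) x = octMul u x :=
  leftMulMat_mulVec _ _

theorem act_halfTurnSL (u : UnitImag) (x : Fin 8 → ℂ) :
    act (halfTurnSL u) x = (2 * (u.1 ⬝ᵥ x)) • u.1 + (2 * x 0) • octE 0 - x :=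
  halfTurnMat_mulVec _ _

/-- The source of all lifts: with L_u² = -1, the linearized alternative law becomes (h_u x)(u y) =
u(x y) for the half-turn h_u. -/
theorem isLift_leftMulSL (u : UnitImag) : IsLift (halfTurnSL u) (leftMulSL u) := by
  refine ⟨⟨halfTurnMat_transpose_mul u.2.1 u.2.2, ?_⟩, leftMulMat_transpose_mul u.2.2, fun x y => ?_⟩
  · rw [act_halfTurnSL, dotProduct_comm, octE_dotProduct, u.2.1]
    funext i
    simp [octE]
    ring
  · rw [act_halfTurnSL, act_leftMulSL, act_leftMulSL, octMul_octMul_add u.2.1, sub_eq_add_neg,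
      octMul_add_left, octMul_add_left, octMul_smul_left, octMul_smul_left, one_octMul,
      octMul_octMul_self u.2.1, u.2.2]
    have : octMul (-x) (octMul u y) = -octMul x (octMul u y) := by
      have := octMul_smul_left (-1) x (octMul u y)
      simpa using this
    rw [this]
    funext i
    simp only [Pi.add_apply, Pi.sub_apply, Pi.neg_apply, Pi.smul_apply, smul_eq_mul]
    ring

theorem leftMulSL_real {u : UnitImag} (hu : star u.1 = u.1) : cartanInv (leftMulSL u) = leftMulSL u := by
  refine cartanInv_eq_self_of_star_act fun x => ?_
  rw [act_leftMulSL, act_leftMulSL, ← octMul_star, hu]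

theorem halfTurnSL_real {u : UnitImag} (hu : star u.1 = u.1) :
    cartanInv (halfTurnSL u) = halfTurnSL u :=
  (isLift_leftMulSL u).base_real (leftMulSL_real hu)

theorem act_halfTurnSL_of_orthogonal (u : UnitImag) {x : Fin 8 → ℂ} (hx : x 0 = 0)
    (h : u.1 ⬝ᵥ x = 0) : act (halfTurnSL u) x = -x := by
  rw [act_halfTurnSL, h, hx]
  simp

theorem dotProduct_self_of_real {v : Fin 8 → ℂ} (hv : star v = v) :
    v ⬝ᵥ v = ((∑ i, (v i).re ^ 2 : ℝ) : ℂ) := by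
  rw [dotProduct, Complex.ofReal_sum]
  refine Finset.sum_congr rfl fun i _ => ?_
  have h : (starRingEnd ℂ) (v i) = v i := congrFun hv i
  rw [Complex.conj_eq_iff_re] at h
  rw [Complex.ofReal_pow, h, sq]

theorem exists_smul_dotProduct_self_eq_one {v : Fin 8 → ℂ} (hv : v ⬝ᵥ v ≠ 0) :
    ∃ c : ℂ, c ^ 2 * (v ⬝ᵥ v) = 1 ∧ (star v = v → star c = c) := by
  by_cases hr : star v = v
  · rw [dotProduct_self_of_real hr] at hv ⊢
    set r : ℝ := ∑ i, (v i).re ^ 2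
    have hr0 : 0 ≤ r := Finset.sum_nonneg fun i _ => sq_nonneg _
    have hrne : r ≠ 0 := fun h => hv (by rw [h, Complex.ofReal_zero])
    refine ⟨((√r)⁻¹ : ℝ), ?_, fun _ => Complex.conj_ofReal _⟩
    rw [← Complex.ofReal_pow, ← Complex.ofReal_mul, inv_pow, Real.sq_sqrt hr0, inv_mul_cancel₀ hrne,
      Complex.ofReal_one]
  · obtain ⟨c, hc⟩ := IsAlgClosed.exists_pow_nat_eq (v ⬝ᵥ v)⁻¹ two_pos
    exact ⟨c, by rw [hc, inv_mul_cancel₀ hv], fun h => absurd h hr⟩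

theorem exists_unitImag_smul {v : Fin 8 → ℂ} (hv0 : v 0 = 0) (hv : v ⬝ᵥ v ≠ 0) :
    ∃ (u : UnitImag) (c : ℂ), u.1 = c • v ∧ c ^ 2 * (v ⬝ᵥ v) = 1 ∧
      (star v = v → star u.1 = u.1) := by
  obtain ⟨c, hc, hcr⟩ := exists_smul_dotProduct_self_eq_one hv
  refine ⟨⟨c • v, by simp [hv0], ?_⟩, c, rfl, hc, fun h => ?_⟩
  · rw [smul_dotProduct, dotProduct_smul, smul_eq_mul, smul_eq_mul, ← hc]; ring
  · simp only [star_smul, h, hcr h]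

/-- Two unit imaginary vectors are exchanged by a product of two half-turns around vectors in a
given three-dimensional space. -/
theorem exists_isLift_act_eq {z w p : UnitImag} (hpw : p.1 ⬝ᵥ w.1 = 0) :
    ∃ g₀ g : SL8, IsLift g₀ g ∧ act g₀ z = w ∧
      (∀ q : Fin 8 → ℂ, q 0 = 0 → z.1 ⬝ᵥ q = 0 → w.1 ⬝ᵥ q = 0 → p.1 ⬝ᵥ q = 0 → act g₀ q = q) ∧
      (star z.1 = z.1 → star w.1 = w.1 → star p.1 = p.1 → cartanInv g₀ = g₀ ∧ cartanInv g = g) := by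
  have hz := z.2.2
  have hw := w.2.2
  -- Over ℂ the vector z - w may be isotropic; then (z + w) · (z + w) = 4 and the half-turn around z
  -- + w takes z to w. Otherwise the half-turn around z - w takes z to -w, and the one around p ⊥ w
  -- repairs the sign. The first case also gets a second half-turn, around w, so that common
  -- orthogonal vectors are negated twice.
  by_cases hne : (z.1 - w.1) ⬝ᵥ (z.1 - w.1) = 0
  · have hzw : z.1 ⬝ᵥ w.1 = 1 := by
      simp only [dotProduct_sub, sub_dotProduct, hz, hw, dotProduct_comm w.1 z.1] at hne
      linear_combination -hne / 2
    have hsum : (z.1 + w.1) ⬝ᵥ (z.1 + w.1) = 4 := by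
      simp only [dotProduct_add, add_dotProduct, hz, hw, dotProduct_comm w.1 z.1, hzw]
      norm_num
    obtain ⟨u, c, hu, hc, hur⟩ := exists_unitImag_smul (v := z.1 + w.1)
      (by simp [z.2.1, w.2.1]) (by rw [hsum]; norm_num)
    have hact : act (halfTurnSL u) z = w := by
      rw [act_halfTurnSL, hu, z.2.1, smul_dotProduct, add_dotProduct, hz, dotProduct_comm w.1, hzw]
      rw [hsum] at hc
      funext i
      simp only [Pi.add_apply, Pi.sub_apply, Pi.smul_apply, smul_eq_mul]
      linear_combination (z.1 i + w.1 i) * hc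
    have hactw : act (halfTurnSL w) w = w := by
      rw [act_halfTurnSL, hw, w.2.1]
      funext i
      simp only [Pi.add_apply, Pi.sub_apply, Pi.smul_apply, smul_eq_mul]
      ring
    refine ⟨_, _, (isLift_leftMulSL w).mul (isLift_leftMulSL u), by rw [act_mul, hact, hactw],
      fun q hq0 hqz hqw _ => ?_, fun h1 h2 _ => ?_⟩
    · have huq : u.1 ⬝ᵥ q = 0 := by rw [hu, smul_dotProduct, add_dotProduct, hqz, hqw]; simp
      rw [act_mul, act_halfTurnSL_of_orthogonal u hq0 huq, act_neg,
        act_halfTurnSL_of_orthogonal w hq0 hqw, neg_neg]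
    · have hur' := hur (by rw [star_add, h1, h2])
      exact ⟨cartanInv_mul_of_real (halfTurnSL_real h2) (halfTurnSL_real hur'),
        cartanInv_mul_of_real (leftMulSL_real h2) (leftMulSL_real hur')⟩
  · obtain ⟨u, c, hu, hc, hur⟩ := exists_unitImag_smul (v := z.1 - w.1)
      (by simp [z.2.1, w.2.1]) hne
    have hact : act (halfTurnSL u) z = -w.1 := by
      rw [act_halfTurnSL, hu, z.2.1, smul_dotProduct]
      simp only [dotProduct_sub, sub_dotProduct, hz, hw, dotProduct_comm w.1 z.1, smul_eq_mul]
        at hc ⊢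
      funext i
      simp only [Pi.add_apply, Pi.sub_apply, Pi.smul_apply, Pi.neg_apply, smul_eq_mul]
      linear_combination (z.1 i - w.1 i) * hc
    refine ⟨_, _, (isLift_leftMulSL p).mul (isLift_leftMulSL u), ?_,
      fun q hq0 hqz hqw hqp => ?_, fun h1 h2 h3 => ?_⟩
    · rw [act_mul, hact, act_neg, act_halfTurnSL_of_orthogonal p w.2.1 hpw, neg_neg]
    · have huq : u.1 ⬝ᵥ q = 0 := by rw [hu, smul_dotProduct, sub_dotProduct, hqz, hqw]; simp
      rw [act_mul, act_halfTurnSL_of_orthogonal u hq0 huq, act_neg,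
        act_halfTurnSL_of_orthogonal p hq0 hqp, neg_neg]
    · have hur' := hur (by rw [star_sub, h1, h2])
      exact ⟨cartanInv_mul_of_real (halfTurnSL_real h3) (halfTurnSL_real hur'),
        cartanInv_mul_of_real (leftMulSL_real h3) (leftMulSL_real hur')⟩

/-- The imaginary basis vectors. -/
def unitE (i : Fin 8) (hi : i ≠ 0) : UnitImag :=
  ⟨octE i, by simp [octE, hi.symm], by simp [octE_dotProduct_octE]⟩

/-- Orthogonality confines g e₁ to the line of e₁, and det g = 1 fixes the factor. -/
theorem eq_one_of_fixes {g : SL8} (hg : g ∈ SO8) (h : ∀ j : Fin 8, j ≠ 1 → act g (octE j) = octE j) :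
    g = 1 := by
  set c := (g : Matrix (Fin 8) (Fin 8) ℂ) 1 1 with hc
  have hdiag : (g : Matrix (Fin 8) (Fin 8) ℂ) = diagonal (fun j => if j = 1 then c else 1) := by
    ext i j
    by_cases hj : j = 1
    · subst hj
      by_cases hi : i = 1
      · subst hi; simp [hc]
      · rw [diagonal_apply_ne _ hi, ← act_octE, ← octE_dotProduct i (act g (octE 1))]
        conv_lhs => rw [← h i hi]
        rw [act_dotProduct_act hg, octE_dotProduct_octE, if_neg hi]
    · rw [← act_octE, h j hj, diagonal_apply]
      by_cases hij : i = j
      · subst hij; simp [octE, hj]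
      · simp [octE, hij]
  have hdet : c = 1 := by
    have := g.2
    rw [hdiag, det_diagonal] at this
    simpa using this
  apply Subtype.ext
  rw [hdiag, hdet]
  simp

/-- The homomorphism `Spin(7, ℂ) → SO(7, ℂ)` is surjective, also on real points. -/
theorem exists_isLift {g₀ : SL8} (hg₀ : g₀ ∈ SO7) :
    ∃ g, IsLift g₀ g ∧ (cartanInv g₀ = g₀ → cartanInv g = g) := by
  -- Induction on the last index k that may still be moved: two half-turns return g₀ e_k to e_k and
  -- keep the later basis vectors. The vector e₁ is the spare axis p, so the induction stops at k =
  -- 1.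
  suffices H : ∀ k : ℕ, 1 ≤ k → k ≤ 7 → ∀ g₀ ∈ SO7,
      (∀ j : Fin 8, k < j.val → act g₀ (octE j) = octE j) →
        ∃ g, IsLift g₀ g ∧ (cartanInv g₀ = g₀ → cartanInv g = g) from
    H 7 (by norm_num) le_rfl g₀ hg₀ fun j hj => absurd j.isLt (by omega)
  intro k hk
  induction k, hk using Nat.le_induction with
  | base =>
    intro _ g₀ hg₀ hfix
    have : g₀ = 1 := eq_one_of_fixes hg₀.1 fun j hj => by
      by_cases h0 : j = 0
      · rw [h0, hg₀.2]
      · exact hfix j (by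
          have h1 : j.val ≠ 0 := fun h => h0 (Fin.ext h)
          have h2 : j.val ≠ 1 := fun h => hj (Fin.ext h)
          omega)
    exact ⟨1, this ▸ IsLift.one, fun _ => map_one _⟩
  | succ k hk ih =>
    intro hk7 g₀ hg₀ hfix
    have hlt : k + 1 < 8 := by omega
    set m : Fin 8 := ⟨k + 1, hlt⟩ with hm
    have hm0 : m ≠ 0 := fun h => by simpa [hm] using congrArg Fin.val h
    have hm1 : (1 : Fin 8) ≠ m := fun h => by
      have : (1 : ℕ) = k + 1 := congrArg Fin.val h
      omega
    let z : UnitImag := ⟨act g₀ (octE m), by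
      rw [← octE_dotProduct 0 (act g₀ (octE m)), ← hg₀.2, act_dotProduct_act hg₀.1, octE_dotProduct_octE,
        if_neg hm0.symm], by
      rw [act_dotProduct_act hg₀.1, octE_dotProduct_octE, if_pos rfl]⟩
    obtain ⟨h₀, h, hh, hz, hq, hr⟩ := exists_isLift_act_eq (z := z) (w := unitE m hm0)
      (p := unitE 1 (by decide)) (by simp only [unitE, octE_dotProduct_octE, if_neg hm1])
    obtain ⟨g', hg', hr'⟩ := ih (by omega) (h₀ * g₀) (mul_mem hh.1 hg₀) (fun j hj => by
      rw [act_mul]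
      by_cases hjm : j = m
      · rw [hjm]; exact hz
      · have hjv : k + 1 < j.val := by
          have : j.val ≠ k + 1 := fun h => hjm (Fin.ext h)
          omega
        rw [hfix j hjv]
        have hj0 : j ≠ 0 := fun h => by rw [h] at hjv; simp at hjv
        have hj1 : (1 : Fin 8) ≠ j := fun h => by
          rw [← h] at hjv
          have : ((1 : Fin 8) : ℕ) = 1 := rfl
          omega
        refine hq _ ?_ ?_ ?_ ?_
        · simp [octE, hj0.symm]
        · simp only [z]
          rw [← hfix j hjv, act_dotProduct_act hg₀.1, octE_dotProduct_octE, if_neg (Ne.symm hjm)]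
        · simp only [unitE, octE_dotProduct_octE, if_neg (Ne.symm hjm)]
        · simp only [unitE, octE_dotProduct_octE, if_neg hj1])
    refine ⟨h⁻¹ * g', ?_, fun hr₀ => ?_⟩
    · have := hh.inv.mul hg'
      rwa [inv_mul_cancel_left] at this
    · obtain ⟨h1, h2⟩ := hr (star_act_of_real hr₀ (star_octE m)) (star_octE m) (star_octE 1)
      exact cartanInv_mul_of_real (cartanInv_inv_of_real h2) (hr' (cartanInv_mul_of_real h1 hr₀))

/-- Six real vectors of `ℂ⁸` have a common real unit normal. -/
theorem exists_real_orthogonal (w : Fin 6 → Fin 8 → ℂ) (hw : ∀ i, star (w i) = w i) :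
    ∃ u : Fin 8 → ℂ, star u = u ∧ u ⬝ᵥ u = 1 ∧ ∀ i, u ⬝ᵥ w i = 0 := by
  let M : Matrix (Fin 6) (Fin 8) ℝ := Matrix.of fun i j => (w i j).re
  have hker : LinearMap.ker (Matrix.toLin' M) ≠ ⊥ :=
    -- Six real linear conditions on ℝ⁸ have a nonzero solution.
    LinearMap.ker_ne_bot_of_finrank_lt (by simp)
  obtain ⟨v, hv, hv0⟩ := Submodule.exists_mem_ne_zero_of_ne_bot hker
  rw [LinearMap.mem_ker, Matrix.toLin'_apply] at hv
  set u : Fin 8 → ℂ := fun i => (v i : ℂ) with hu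
  have hur : star u = u := by funext i; simp [hu]
  have hune : u ⬝ᵥ u ≠ 0 := by
    rw [dotProduct_self_of_real hur, Complex.ofReal_ne_zero]
    intro h
    rw [Finset.sum_eq_zero_iff_of_nonneg (fun i _ => sq_nonneg _)] at h
    exact hv0 (funext fun i => by simpa [hu] using h i (Finset.mem_univ i))
  obtain ⟨c, hc, hcr⟩ := exists_smul_dotProduct_self_eq_one hune
  refine ⟨c • u, by rw [star_smul, hur, hcr hur], ?_, fun i => ?_⟩
  · rw [smul_dotProduct, dotProduct_smul, smul_eq_mul, smul_eq_mul, ← hc]; ring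
  · have h1 : u ⬝ᵥ w i = (((M *ᵥ v) i : ℝ) : ℂ) := by
      simp only [dotProduct, mulVec, Complex.ofReal_sum, M, Matrix.of_apply, hu]
      refine Finset.sum_congr rfl fun j _ => ?_
      have h : (starRingEnd ℂ) (w i j) = w i j := congrFun (hw i) j
      rw [Complex.conj_eq_iff_re] at h
      rw [Complex.ofReal_mul, h, mul_comm]
    rw [smul_dotProduct, h1, hv]
    simp

/-- A real unit octonion is the product of two real unit imaginary octonions orthogonal to two given
real vectors. -/
theorem exists_octMul_eq {x f₁ f₂ : Fin 8 → ℂ} (hxr : star x = x) (hx : x ⬝ᵥ x = 1)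
    (hf₁ : star f₁ = f₁) (hf₂ : star f₂ = f₂) :
    ∃ u v : UnitImag, star u.1 = u.1 ∧ star v.1 = v.1 ∧ octMul u v = x ∧
      u.1 ⬝ᵥ f₁ = 0 ∧ u.1 ⬝ᵥ f₂ = 0 ∧ v.1 ⬝ᵥ f₁ = 0 ∧ v.1 ⬝ᵥ f₂ = 0 := by
  have hcr : star (octConj x) = octConj x := by
    have h0 : star (x 0) = x 0 := congrFun hxr 0
    rw [octConj, star_sub, hxr, star_smul, star_octE, star_mul, h0]
    simp [mul_comm]
  -- With v = -ux one has uv = -u(ux) = x for any unit imaginary u. Orthogonality to e₀ makes u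
  -- imaginary, to x makes v imaginary, to fᵢ gives u ⊥ fᵢ, and to fᵢ x̄ gives v ⊥ fᵢ by the adjoint
  -- formula.
  obtain ⟨u, hur, hu, hw⟩ := exists_real_orthogonal
    ![octE 0, x, f₁, f₂, octMul f₁ (octConj x), octMul f₂ (octConj x)] (by
      intro i
      fin_cases i
      · exact star_octE 0
      · exact hxr
      · exact hf₁
      · exact hf₂
      · exact (octMul_star _ _).symm.trans (by rw [hf₁, hcr]; rfl)
      · exact (octMul_star _ _).symm.trans (by rw [hf₂, hcr]; rfl))
  have hu0 : u 0 = 0 := by rw [← octE_dotProduct 0 u, dotProduct_comm]; exact hw 0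
  have hv : (-octMul u x) ⬝ᵥ (-octMul u x) = 1 := by
    rw [neg_dotProduct_neg, dotProduct_octMul_self, hu, hx, one_mul]
  refine ⟨⟨u, hu0, hu⟩, ⟨-octMul u x, ?_, hv⟩, hur, ?_, ?_, hw 2, hw 3, ?_, ?_⟩
  · have h1 : u ⬝ᵥ x = 0 := hw 1
    rw [Pi.neg_apply, octMul_zero_coord, hu0, h1]
    simp
  · change star (-octMul u x) = -octMul u x
    rw [star_neg, ← octMul_star, hur, hxr]
  · have := octMul_smul_right (-1) u (octMul u x)
    rw [neg_one_smul, neg_one_smul] at this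
    change octMul u (-octMul u x) = x
    rw [this, octMul_octMul_self hu0, hu]
    simp
  · change (-octMul u x) ⬝ᵥ f₁ = 0
    rw [neg_dotProduct, octMul_dotProduct]
    exact neg_eq_zero.2 (hw 4)
  · change (-octMul u x) ⬝ᵥ f₂ = 0
    rw [neg_dotProduct, octMul_dotProduct]
    exact neg_eq_zero.2 (hw 5)

/-- The compact group `G₂` is transitive on real orthonormal pairs of imaginary octonions. -/
theorem exists_G2_act_eq {f₁ f₂ : UnitImag} (hf₁ : star f₁.1 = f₁.1) (hf₂ : star f₂.1 = f₂.1)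
    (hf : f₁.1 ⬝ᵥ f₂.1 = 0) :
    ∃ k ∈ G2, cartanInv k = k ∧ act k (octE 1) = f₁ ∧ act k (octE 2) = f₂ := by
  have h12 : octE 2 ⬝ᵥ octE 1 = 0 := by simp [octE_dotProduct_octE]
  obtain ⟨a₀, a, ha, haz, -, har⟩ := exists_isLift_act_eq (z := f₁) (w := unitE 1 (by decide))
    (p := unitE 2 (by decide)) h12
  obtain ⟨ha₀r, har⟩ := har hf₁ (star_octE _) (star_octE _)
  let z : UnitImag := ⟨act a₀ f₂, by
    rw [← octE_dotProduct 0 (act a₀ f₂), ← ha.1.2, act_dotProduct_act ha.1.1, octE_dotProduct, f₂.2.1], by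
    rw [act_dotProduct_act ha.1.1, f₂.2.2]⟩
  have hz1 : z.1 ⬝ᵥ octE 1 = 0 := by
    have : act a₀ f₁ = octE 1 := haz
    simp only [z]
    rw [← this, act_dotProduct_act ha.1.1, dotProduct_comm, hf]
  -- The second rotation must not disturb e₁; this holds because e₁ is orthogonal to z, to e₂ and to
  -- the spare axis e₃.
  obtain ⟨b₀, b, hb, hbz, hbq, hbr⟩ := exists_isLift_act_eq (z := z) (w := unitE 2 (by decide))
    (p := unitE 3 (by decide)) (by simp [unitE, octE_dotProduct_octE])
  obtain ⟨hb₀r, hbr⟩ := hbr (star_act_of_real ha₀r hf₂) (star_octE _) (star_octE _)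
  have hb1 : act b₀ (octE 1) = octE 1 := hbq _ (by simp [octE]) hz1
    (by simp [unitE, octE_dotProduct_octE]) (by simp [unitE, octE_dotProduct_octE])
  have hg := hb.mul ha
  set g := b * a
  set g₀ := b₀ * a₀
  have hgr : cartanInv g = g := cartanInv_mul_of_real hbr har
  have hg1 : act g₀ f₁ = octE 1 := by rw [act_mul, haz]; exact hb1
  have hg2 : act g₀ f₂ = octE 2 := by rw [act_mul]; exact hbz
  -- The base g₀ takes (f₁, f₂) to (e₁, e₂), but g need not fix e₀. Writing g e₀ = uv with u, v ⊥
  -- e₁, e₂, the element L_u L_v also sends e₀ to g e₀ while its base, a product of two half-turns,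
  -- fixes e₁ and e₂. So g⁻¹ L_u L_v fixes e₀, lies in `G2`, and moves e₁, e₂ as its base does.
  obtain ⟨u, v, hur, hvr, huv, hu1, hu2, hv1, hv2⟩ := exists_octMul_eq (x := act g (octE 0))
    (f₁ := octE 1) (f₂ := octE 2) (star_act_of_real hgr (star_octE 0))
    (by rw [act_dotProduct_act hg.2, octE_dotProduct_octE, if_pos rfl]) (star_octE _) (star_octE _)
  have hs := (isLift_leftMulSL u).mul (isLift_leftMulSL v)
  have hk := hg.inv.mul hs
  have hsr : cartanInv (leftMulSL u * leftMulSL v) = leftMulSL u * leftMulSL v :=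
    cartanInv_mul_of_real (leftMulSL_real hur) (leftMulSL_real hvr)
  have hfix : act (g⁻¹ * (leftMulSL u * leftMulSL v)) (octE 0) = octE 0 := by
    rw [act_mul, act_mul, act_leftMulSL, act_leftMulSL, octMul_one, huv, act_inv_act]
  have heq := hk.eq_of_fixes hfix
  refine ⟨_, hk.mem_G2_of_fixes hfix, cartanInv_mul_of_real (cartanInv_inv_of_real hgr) hsr, ?_, ?_⟩
  · rw [← heq, act_mul, act_mul, act_halfTurnSL_of_orthogonal v (by simp [octE]) hv1, act_neg,
      act_halfTurnSL_of_orthogonal u (by simp [octE]) hu1, neg_neg, ← hg1, act_inv_act]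
  · rw [← heq, act_mul, act_mul, act_halfTurnSL_of_orthogonal v (by simp [octE]) hv2, act_neg,
      act_halfTurnSL_of_orthogonal u (by simp [octE]) hu2, neg_neg, ← hg2, act_inv_act]

theorem exists_leftMul_act_eq {x : Fin 8 → ℂ} (hxr : star x = x) (hx : x ⬝ᵥ x = 1) :
    ∃ u v : UnitImag, star u.1 = u.1 ∧ star v.1 = v.1 ∧
      act (leftMulSL u * leftMulSL v) (octE 0) = x := by
  -- Nothing is required of f₁ and f₂ here, so e₀ fills both places.
  obtain ⟨u, v, hu, hv, huv, -⟩ := exists_octMul_eq hxr hx (star_octE 0) (star_octE 0)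
  exact ⟨u, v, hu, hv, by rw [act_mul, act_leftMulSL, act_leftMulSL, octMul_one, huv]⟩

/-- Two real orthonormal imaginary vectors exist next to a given one. -/
theorem exists_real_unitImag_orthogonal {x : Fin 8 → ℂ} (hx : star x = x) :
    ∃ u : UnitImag, star u.1 = u.1 ∧ x ⬝ᵥ u.1 = 0 := by
  obtain ⟨u, hur, hu, hw⟩ := exists_real_orthogonal ![octE 0, x, x, x, x, x] (by
    intro i
    fin_cases i
    · exact star_octE 0
    all_goals exact hx)
  exact ⟨⟨u, by rw [← octE_dotProduct 0 u, dotProduct_comm]; exact hw 0, hu⟩, hur, by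
    rw [dotProduct_comm]; exact hw 1⟩

/-- The compact group `Spin(7)` is transitive on real orthonormal pairs of octonions. -/
theorem exists_Spin7_act_eq {x y : Fin 8 → ℂ} (hxr : star x = x) (hyr : star y = y)
    (hx : x ⬝ᵥ x = 1) (hy : y ⬝ᵥ y = 1) (hxy : x ⬝ᵥ y = 0) :
    ∃ k₀ k : SL8, IsLift k₀ k ∧ cartanInv k = k ∧ act k (octE 0) = x ∧ act k (octE 1) = y := by
  obtain ⟨u, v, hu, hv, huv⟩ := exists_leftMul_act_eq hxr hx
  have hs := (isLift_leftMulSL u).mul (isLift_leftMulSL v)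
  set s := leftMulSL u * leftMulSL v
  have hsr : cartanInv s = s := cartanInv_mul_of_real (leftMulSL_real hu) (leftMulSL_real hv)
  have hsir := cartanInv_inv_of_real hsr
  have hs' : act s⁻¹ x = octE 0 := by rw [← huv, act_inv_act]
  let f : UnitImag := ⟨act s⁻¹ y, by
    rw [← octE_dotProduct 0 (act s⁻¹ y), ← hs', act_dotProduct_act (inv_mem hs.2), hxy], by
    rw [act_dotProduct_act (inv_mem hs.2), hy]⟩
  have hfr : star f.1 = f.1 := star_act_of_real hsir hyr
  -- Only f matters; f' merely completes it to an orthonormal pair.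
  obtain ⟨f', hf'r, hff'⟩ := exists_real_unitImag_orthogonal hfr
  obtain ⟨k, hk, hkr, hk1, -⟩ := exists_G2_act_eq hfr hf'r hff'
  refine ⟨_, _, hs.mul (isLift_of_mem_G2 hk), cartanInv_mul_of_real hsr hkr, ?_, ?_⟩
  · rw [act_mul, act_octE_zero_of_mem_G2 hk, huv]
  · rw [act_mul, hk1]
    exact act_act_inv _ _

end SpinCover

/-! ### The involution `σ₀` and the group `A` -/

section Involution

open Matrix

theorem RankOnePair.HC_le_GC (P : RankOnePair) : P.HC ≤ P.GC := by
  cases P with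
  | so7g2 => exact fun g hg => (isLift_of_mem_G2 hg).1
  | spin7g2 => exact fun g hg => mem_Spin7_iff.2 ⟨g, isLift_of_mem_G2 hg⟩
  | g2sl3 => exact fun g hg => hg.1

theorem act_Ipm (x : Fin 8 → ℂ) :
    act Ipm x = ![x 0, -x 1, x 2, -x 3, x 4, -x 5, x 6, -x 7] := by
  funext i
  fin_cases i <;> simp [act, Ipm, mulVec_diagonal]

theorem Ipm_mul_Ipm : Ipm * Ipm = 1 :=
  act_injective fun x => by
    rw [act_mul, act_one, act_Ipm, act_Ipm]
    apply fin8_funext <;> simp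

theorem cartanInv_Ipm : cartanInv Ipm = Ipm :=
  cartanInv_eq_self_of_star_act fun x => by
    rw [act_Ipm, act_Ipm]
    apply fin8_funext <;> simp

/-- The span of e₀, e₂, e₄, e₆ is a quaternion subalgebra, and `Ipm` is the automorphism that is 1
on it and -1 on its orthogonal complement. Hence conjugation by `Ipm` preserves all the groups
involved. -/
theorem Ipm_mem_G2 : Ipm ∈ G2 := by
  refine ⟨?_, fun x y => ?_⟩
  · change (Ipm : Matrix (Fin 8) (Fin 8) ℂ)ᵀ * (Ipm : Matrix (Fin 8) (Fin 8) ℂ) = 1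
    have h : (Ipm : Matrix (Fin 8) (Fin 8) ℂ)ᵀ = Ipm := by simp [Ipm]
    rw [h]
    exact congrArg Subtype.val Ipm_mul_Ipm
  · rw [act_Ipm, act_Ipm, act_Ipm]
    apply fin8_funext <;> simp [octMul] <;> ring

theorem act_cartanInv (g : SL8) (x : Fin 8 → ℂ) : act (cartanInv g) x = star (act g (star x)) := by
  rw [star_act, star_star]

theorem cartanInv_cartanInv (g : SL8) : cartanInv (cartanInv g) = g :=
  act_injective fun x => by rw [act_cartanInv, act_cartanInv, star_star, star_star]

theorem sigmaZero_mul (g h : SL8) : sigmaZero (g * h) = sigmaZero g * sigmaZero h := by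
  simp only [sigmaZero, map_mul, mul_assoc]
  rw [← mul_assoc Ipm Ipm, Ipm_mul_Ipm, one_mul]

theorem sigmaZero_sigmaZero (g : SL8) : sigmaZero (sigmaZero g) = g := by
  simp only [sigmaZero, map_mul, cartanInv_Ipm, cartanInv_cartanInv, mul_assoc, Ipm_mul_Ipm,
    mul_one]
  rw [← mul_assoc, Ipm_mul_Ipm, one_mul]

theorem mem_SO8_of_dotProduct {g : SL8} (hg : ∀ x y, act g x ⬝ᵥ act g y = x ⬝ᵥ y) : g ∈ SO8 :=
  transpose_mul_self_of_dotProduct fun x => hg x x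

theorem cartanInv_mem_SO8 {g : SL8} (hg : g ∈ SO8) : cartanInv g ∈ SO8 :=
  mem_SO8_of_dotProduct fun x y => by
    rw [act_cartanInv, act_cartanInv, star_dotProduct_star, act_dotProduct_act hg,
      ← star_dotProduct_star, star_star, star_star]

theorem cartanInv_mem_SO7 {g : SL8} (hg : g ∈ SO7) : cartanInv g ∈ SO7 :=
  ⟨cartanInv_mem_SO8 hg.1, by
    have h := star_act g (octE 0)
    rwa [star_octE, hg.2, star_octE, eq_comm] at h⟩

theorem IsLift.cartanInv_lift {g₀ g : SL8} (hg : IsLift g₀ g) : IsLift (cartanInv g₀) (cartanInv g) :=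
  ⟨cartanInv_mem_SO7 hg.1, cartanInv_mem_SO8 hg.2, fun x y => by
    rw [act_cartanInv, act_cartanInv, act_cartanInv, octMul_star, hg.3, octMul_star]⟩

theorem IsLift.sigmaZero_lift {g₀ g : SL8} (hg : IsLift g₀ g) : IsLift (sigmaZero g₀) (sigmaZero g) :=
  ((isLift_of_mem_G2 Ipm_mem_G2).mul hg.cartanInv_lift).mul (isLift_of_mem_G2 Ipm_mem_G2)

theorem sigmaZero_mem_G2 {g : SL8} (hg : g ∈ G2) : sigmaZero g ∈ G2 :=
  let h := (isLift_of_mem_G2 hg).sigmaZero_lift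
  ⟨h.2, h.3⟩

namespace RankOnePair

theorem sigmaZero_mem_GC (P : RankOnePair) {g : SL8} (hg : g ∈ P.GC) : sigmaZero g ∈ P.GC := by
  cases P with
  | so7g2 =>
    have h : Ipm ∈ SO7 := (isLift_of_mem_G2 Ipm_mem_G2).1
    exact SO7.mul_mem (SO7.mul_mem h (cartanInv_mem_SO7 hg)) h
  | spin7g2 =>
    obtain ⟨g₀, h⟩ := mem_Spin7_iff.1 hg
    exact mem_Spin7_iff.2 ⟨_, h.sigmaZero_lift⟩
  | g2sl3 => exact sigmaZero_mem_G2 hg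

/-- In the last case `Ipm` is not in `SL3`, since it sends e₁ to -e₁; in the conjugate the two signs
cancel. -/
theorem sigmaZero_mem_HC (P : RankOnePair) {g : SL8} (hg : g ∈ P.HC) : sigmaZero g ∈ P.HC := by
  cases P with
  | so7g2 => exact sigmaZero_mem_G2 hg
  | spin7g2 => exact sigmaZero_mem_G2 hg
  | g2sl3 =>
    refine ⟨sigmaZero_mem_G2 hg.1, ?_⟩
    have h1 : act Ipm (octE 1) = -octE 1 := by
      rw [act_Ipm]
      apply fin8_funext <;> simp [octE]
    rw [sigmaZero, act_mul, act_mul, h1, act_cartanInv, star_neg, star_octE, act_neg, hg.2,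
      star_neg, star_octE, act_neg, h1, neg_neg]

end RankOnePair

end Involution

/-! ### One-parameter groups and infinitesimal lifts -/

section OneParameter

open Matrix NormedSpace
open scoped Matrix.Norms.Operator

/-- The entries of a matrix, as a continuous linear equivalence. -/
def entriesEquiv (𝕜 : Type*) [RCLike 𝕜] [NormedAlgebra 𝕜 ℂ] :
    (Fin 8 → Fin 8 → ℂ) ≃L[𝕜] Matrix (Fin 8) (Fin 8) ℂ where
  toLinearEquiv := Matrix.ofLinearEquiv 𝕜
  continuous_toFun := continuous_id
  continuous_invFun := continuous_id

theorem hasDerivAt_matrix {f : ℝ → Matrix (Fin 8) (Fin 8) ℂ} {f' : Matrix (Fin 8) (Fin 8) ℂ} {t : ℝ}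
    (h : ∀ i j, HasDerivAt (fun s => f s i j) (f' i j) t) : HasDerivAt f f' t := by
  have h1 : HasDerivAt (fun s i j => f s i j) (fun i j => f' i j) t :=
    hasDerivAt_pi.2 fun i => hasDerivAt_pi.2 fun j => h i j
  exact (entriesEquiv ℝ).toContinuousLinearMap.hasFDerivAt.comp_hasDerivAt t h1

/-- Uniqueness for f' = f Z: the product f(t) exp(-tZ) has zero derivative. -/
theorem eq_exp_of_hasDerivAt {A : Type*} [NormedRing A] [NormedAlgebra ℝ A] [FiniteDimensional ℝ A]
    {f : ℝ → A} {Z : A} (h0 : f 0 = 1) (hf : ∀ t, HasDerivAt f (f t * Z) t) (t : ℝ) :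
    f t = exp (t • Z) := by
  have := FiniteDimensional.complete ℝ A
  have hd : ∀ s : ℝ, HasDerivAt (fun s => f s * exp (s • -Z)) 0 s := fun s => by
    refine ((hf s).fun_mul (hasDerivAt_exp_smul_const' (𝕂 := ℝ) (-Z) s)).congr_deriv ?_
    rw [neg_mul, mul_neg, mul_assoc, add_neg_cancel]
  have hc := is_const_of_deriv_eq_zero (fun s => (hd s).differentiableAt) (fun s => (hd s).deriv) t 0
  simp only [h0, zero_smul, exp_zero, mul_one] at hc
  have h1 : exp (t • -Z) * exp (t • Z) = 1 := by
    rw [smul_neg]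
    exact exp_neg_mul_exp_self _
  calc f t = f t * exp (t • -Z) * exp (t • Z) := by rw [mul_assoc, h1, mul_one]
    _ = _ := by rw [hc, one_mul]

/-- The derivative of `dBlocks (r t) (s t)` at `t = 0`. -/
def dGen (r s : ℝ) : Matrix (Fin 8) (Fin 8) ℂ :=
  let I : ℝ → ℂ := fun t => Complex.I * (t : ℂ)
  !![0, -I r, 0, 0, 0, 0, 0, 0;
     I r, 0, 0, 0, 0, 0, 0, 0;
     0, 0, 0, -I s, 0, 0, 0, 0;
     0, 0, I s, 0, 0, 0, 0, 0;
     0, 0, 0, 0, 0, -I s, 0, 0;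
     0, 0, 0, 0, I s, 0, 0, 0;
     0, 0, 0, 0, 0, 0, 0, -I s;
     0, 0, 0, 0, 0, 0, I s, 0]

/-- The derivative of `tBlocks` at `0`. -/
def tGen : Matrix (Fin 8) (Fin 8) ℂ :=
  !![0, 0, 0, 0, 0, 0, 0, 0;
     0, 0, -Complex.I, 0, 0, 0, 0, 0;
     0, Complex.I, 0, 0, 0, 0, 0, 0;
     0, 0, 0, 0, 0, 0, 0, 0;
     0, 0, 0, 0, 0, 0, 0, Complex.I / 2;
     0, 0, 0, 0, 0, 0, Complex.I / 2, 0;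
     0, 0, 0, 0, 0, -Complex.I / 2, 0, 0;
     0, 0, 0, 0, -Complex.I / 2, 0, 0, 0]

theorem hasDerivAt_ofReal_cosh_mul (c t : ℝ) :
    HasDerivAt (fun s : ℝ => (Real.cosh (s * c) : ℂ)) ((Real.sinh (t * c) * c : ℝ) : ℂ) t :=
  (((hasDerivAt_id t).mul_const c).cosh.congr_deriv (by simp)).ofReal_comp

theorem hasDerivAt_ofReal_sinh_mul (c t : ℝ) :
    HasDerivAt (fun s : ℝ => (Real.sinh (s * c) : ℂ)) ((Real.cosh (t * c) * c : ℝ) : ℂ) t :=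
  (((hasDerivAt_id t).mul_const c).sinh.congr_deriv (by simp)).ofReal_comp

theorem dBlocks_eq_exp (r s t : ℝ) : dBlocks (t * r) (t * s) = exp (t • dGen r s) := by
  refine eq_exp_of_hasDerivAt (f := fun t => dBlocks (t * r) (t * s)) ?_ (fun t => ?_) t
  · ext i j
    fin_cases i <;> fin_cases j <;> simp [dBlocks]
  · refine hasDerivAt_matrix fun i j => ?_
    have hc := fun c => hasDerivAt_ofReal_cosh_mul c t
    have hs := fun c => (hasDerivAt_ofReal_sinh_mul c t).const_mul Complex.I
    have hs' := fun c => (hs c).fun_neg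
    have h0 := hasDerivAt_const (𝕜 := ℝ) t (0 : ℂ)
    fin_cases i <;> fin_cases j <;>
      first
      | refine h0.congr_deriv ?_
        simp [Matrix.mul_apply, Fin.sum_univ_eight, dBlocks, dGen]
      | refine (hc r).congr_deriv ?_
        simp [Matrix.mul_apply, Fin.sum_univ_eight, dBlocks, dGen]
        linear_combination (Complex.sinh (t * r) * r) * Complex.I_sq
      | refine (hs r).congr_deriv ?_
        simp [Matrix.mul_apply, Fin.sum_univ_eight, dBlocks, dGen]
        ring
      | refine (hs' r).congr_deriv ?_
        simp [Matrix.mul_apply, Fin.sum_univ_eight, dBlocks, dGen]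
        ring
      | refine (hc s).congr_deriv ?_
        simp [Matrix.mul_apply, Fin.sum_univ_eight, dBlocks, dGen]
        linear_combination (Complex.sinh (t * s) * s) * Complex.I_sq
      | refine (hs s).congr_deriv ?_
        simp [Matrix.mul_apply, Fin.sum_univ_eight, dBlocks, dGen]
        ring
      | refine (hs' s).congr_deriv ?_
        simp [Matrix.mul_apply, Fin.sum_univ_eight, dBlocks, dGen]
        ring

theorem tBlocks_eq_exp (t : ℝ) : tBlocks t = exp (t • tGen) := by
  refine eq_exp_of_hasDerivAt (f := tBlocks) ?_ (fun t => ?_) t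
  · ext i j
    fin_cases i <;> fin_cases j <;> simp [tBlocks]
  · refine hasDerivAt_matrix fun i j => ?_
    have hc : ∀ c : ℝ, HasDerivAt (fun s : ℝ => (Real.cosh (s * c) : ℂ)) _ t :=
      fun c => hasDerivAt_ofReal_cosh_mul c t
    have hs := fun c => (hasDerivAt_ofReal_sinh_mul c t).const_mul Complex.I
    have e1 : ∀ s : ℝ, s * 1 = s := mul_one
    have e2 : ∀ s : ℝ, s * (-1 / 2) = -s / 2 := fun s => by ring
    have hc1 := hc 1
    have hc2 := hc (-1 / 2)
    have hs1 := hs 1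
    have hs2 := hs (-1 / 2)
    simp only [e1, e2] at hc1 hc2 hs1 hs2
    have hs1' := hs1.fun_neg
    have hs2' := hs2.fun_neg
    have h0 := hasDerivAt_const (𝕜 := ℝ) t (0 : ℂ)
    have h1 := hasDerivAt_const (𝕜 := ℝ) t (1 : ℂ)
    fin_cases i <;> fin_cases j <;>
      first
      | refine h0.congr_deriv ?_
        simp [Matrix.mul_apply, Fin.sum_univ_eight, tBlocks, tGen]
      | refine h1.congr_deriv ?_
        simp [Matrix.mul_apply, Fin.sum_univ_eight, tBlocks, tGen]
      | refine hc1.congr_deriv ?_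
        simp [Matrix.mul_apply, Fin.sum_univ_eight, tBlocks, tGen]
        linear_combination (Complex.sinh t) * Complex.I_sq
      | refine hs1.congr_deriv ?_
        simp [Matrix.mul_apply, Fin.sum_univ_eight, tBlocks, tGen]
        ring
      | refine hs1'.congr_deriv ?_
        simp [Matrix.mul_apply, Fin.sum_univ_eight, tBlocks, tGen]
        ring
      | refine hc2.congr_deriv ?_
        simp [Matrix.mul_apply, Fin.sum_univ_eight, tBlocks, tGen]
        linear_combination (Complex.sinh (-t / 2) * (-1 / 2)) * Complex.I_sq
      | refine hs2.congr_deriv ?_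
        simp [Matrix.mul_apply, Fin.sum_univ_eight, tBlocks, tGen]
        ring
      | refine hs2'.congr_deriv ?_
        simp [Matrix.mul_apply, Fin.sum_univ_eight, tBlocks, tGen]
        ring

/-- Left multiplication in the complexified Cayley algebra, as a continuous real linear map. -/
def leftMulCLM (y : Fin 8 → ℂ) : Matrix (Fin 8) (Fin 8) ℂ →L[ℝ] Matrix (Fin 8) (Fin 8) ℂ :=
  LinearMap.toContinuousLinearMap
    { toFun := fun M => leftMulMat (M *ᵥ y)
      map_add' := fun M N => Matrix.eq_of_mulVec_eq fun x => by
        rw [add_mulVec, add_mulVec, leftMulMat_mulVec, leftMulMat_mulVec, leftMulMat_mulVec,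
          octMul_add_left]
      map_smul' := fun c M => Matrix.eq_of_mulVec_eq fun x => by
        have h : ∀ N : Matrix (Fin 8) (Fin 8) ℂ, c • N = (c : ℂ) • N := fun N => by ext; simp
        rw [RingHom.id_apply, h, h, smul_mulVec, smul_mulVec, leftMulMat_mulVec, leftMulMat_mulVec,
          octMul_smul_left] }

/-- If `(D₀ x) y + x (D y) = D (x y)` for all `x` and `y`, the one-parameter groups generated by `D₀`
and `D` satisfy the multiplicativity of a spin lift. -/
theorem octMul_exp_mulVec {D₀ D : Matrix (Fin 8) (Fin 8) ℂ}
    (h : ∀ x y, octMul (D₀ *ᵥ x) y + octMul x (D *ᵥ y) = D *ᵥ octMul x y) (t : ℝ)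
    (x y : Fin 8 → ℂ) :
    octMul (exp (t • D₀) *ᵥ x) (exp (t • D) *ᵥ y) = exp (t • D) *ᵥ octMul x y := by
  have hL : ∀ v, leftMulMat (D₀ *ᵥ v) + leftMulMat v * D = D * leftMulMat v := fun v =>
    Matrix.eq_of_mulVec_eq fun w => by
      rw [add_mulVec, ← mulVec_mulVec, ← mulVec_mulVec, leftMulMat_mulVec, leftMulMat_mulVec,
        leftMulMat_mulVec, h]
  -- A conserved quantity: the hypothesis says [D, L_v] = L_{D₀ v}, so conjugating L_{exp(sD₀)x} by
  -- exp(sD) does not depend on s.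
  have hd : ∀ s : ℝ, HasDerivAt
      (fun s => exp (s • -D) * leftMulMat (exp (s • D₀) *ᵥ x) * exp (s • D)) 0 s := fun s => by
    have h1 : HasDerivAt (fun u : ℝ => leftMulMat (exp (u • D₀) *ᵥ x))
        (leftMulMat (D₀ *ᵥ exp (s • D₀) *ᵥ x)) s := by
      rw [mulVec_mulVec]
      exact (leftMulCLM x).hasFDerivAt.comp_hasDerivAt s (hasDerivAt_exp_smul_const' (𝕂 := ℝ) D₀ s)
    have h2 := hasDerivAt_exp_smul_const (𝕂 := ℝ) (-D) s
    have h3 := hasDerivAt_exp_smul_const' (𝕂 := ℝ) D s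
    refine ((h2.fun_mul h1).fun_mul h3).congr_deriv ?_
    have h4 := hL (exp (s • D₀) *ᵥ x)
    rw [eq_sub_of_add_eq h4]
    noncomm_ring
  have hc := is_const_of_deriv_eq_zero (fun s => (hd s).differentiableAt) (fun s => (hd s).deriv) t 0
  simp only [zero_smul, exp_zero, mul_one, one_mul, one_mulVec] at hc
  have h1 : exp (t • D) * exp (t • -D) = 1 := by
    rw [smul_neg]
    exact exp_mul_exp_neg_self _
  have h2 : leftMulMat (exp (t • D₀) *ᵥ x) * exp (t • D) = exp (t • D) * leftMulMat x := by
    rw [← hc, ← mul_assoc, ← mul_assoc, h1, one_mul]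
  have h3 := congrArg (· *ᵥ y) h2
  simpa only [← mulVec_mulVec, leftMulMat_mulVec] using h3

theorem transpose_exp_mul_exp {Z : Matrix (Fin 8) (Fin 8) ℂ} (hZ : Zᵀ = -Z) (t : ℝ) :
    (exp (t • Z))ᵀ * exp (t • Z) = 1 := by
  rw [← exp_transpose, transpose_smul, hZ, smul_neg]
  exact exp_neg_mul_exp_self _

/-- exp(tZ) is the square of the orthogonal matrix exp(tZ/2). -/
theorem det_exp_of_skew {Z : Matrix (Fin 8) (Fin 8) ℂ} (hZ : Zᵀ = -Z) (t : ℝ) :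
    (exp (t • Z)).det = 1 := by
  have h1 : exp (t • Z) = exp ((t / 2) • Z) * exp ((t / 2) • Z) := by
    rw [← Matrix.exp_add_of_commute _ _ (Commute.refl _), ← add_smul, add_halves]
  rw [h1, det_mul, ← sq, det_sq_of_transpose_mul_self (transpose_exp_mul_exp hZ _)]

/-- The one-parameter group generated by a skew-symmetric matrix. -/
def expSL {Z : Matrix (Fin 8) (Fin 8) ℂ} (hZ : Zᵀ = -Z) (t : ℝ) : SL8 :=
  ⟨exp (t • Z), det_exp_of_skew hZ t⟩

theorem expSL_mem_SO8 {Z : Matrix (Fin 8) (Fin 8) ℂ} (hZ : Zᵀ = -Z) (t : ℝ) : expSL hZ t ∈ SO8 :=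
  transpose_exp_mul_exp hZ t

theorem isLift_expSL {D₀ D : Matrix (Fin 8) (Fin 8) ℂ} (h₀ : D₀ᵀ = -D₀) (h : Dᵀ = -D)
    (hD : ∀ x y, octMul (D₀ *ᵥ x) y + octMul x (D *ᵥ y) = D *ᵥ octMul x y) (t : ℝ) :
    IsLift (expSL h₀ t) (expSL h t) := by
  refine ⟨⟨expSL_mem_SO8 _ t, ?_⟩, expSL_mem_SO8 _ t, octMul_exp_mulVec hD t⟩
  -- The choice x = e₀, y = exp(-tD) e₀ shows that exp(tD₀) fixes e₀.
  have h1 := octMul_exp_mulVec hD t (octE 0) (exp (-(t • D)) *ᵥ octE 0)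
  have h2 : exp (t • D) * exp (-(t • D)) = 1 := exp_mul_exp_neg_self _
  rw [mulVec_mulVec, h2, one_mulVec, octMul_one, one_octMul, mulVec_mulVec, h2, one_mulVec] at h1
  exact h1

theorem dGen_transpose (r s : ℝ) : (dGen r s)ᵀ = -dGen r s := by
  ext i j
  fin_cases i <;> fin_cases j <;> simp [dGen]

theorem tGen_transpose : tGenᵀ = -tGen := by
  ext i j
  fin_cases i <;> fin_cases j <;> simp [tGen, neg_div]

theorem dGen_mulVec (r s : ℝ) (x : Fin 8 → ℂ) :
    dGen r s *ᵥ x = ![-(Complex.I * r) * x 1, Complex.I * r * x 0, -(Complex.I * s) * x 3,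
      Complex.I * s * x 2, -(Complex.I * s) * x 5, Complex.I * s * x 4, -(Complex.I * s) * x 7,
      Complex.I * s * x 6] := by
  apply fin8_funext <;> simp [dGen, mulVec, dotProduct, Fin.sum_univ_eight]

theorem tGen_mulVec (x : Fin 8 → ℂ) :
    tGen *ᵥ x = ![0, -Complex.I * x 2, Complex.I * x 1, 0, Complex.I / 2 * x 7,
      Complex.I / 2 * x 6, -Complex.I / 2 * x 5, -Complex.I / 2 * x 4] := by
  apply fin8_funext <;> simp [tGen, mulVec, dotProduct, Fin.sum_univ_eight]

/-- The infinitesimal covering on the generators. The weights (3r, -r) explain the -θ/3 in A for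
Spin(7), and r = 1/3 gives the ratio 2/3 between the parameters upstairs and in SO(7). -/
theorem dGen_derivation (r : ℝ) (x y : Fin 8 → ℂ) :
    octMul (dGen 0 (2 * r) *ᵥ x) y + octMul x (dGen (3 * r) (-r) *ᵥ y) =
      dGen (3 * r) (-r) *ᵥ octMul x y := by
  simp only [dGen_mulVec]
  apply fin8_funext <;> simp [octMul] <;> ring

theorem tGen_derivation (x y : Fin 8 → ℂ) :
    octMul (tGen *ᵥ x) y + octMul x (tGen *ᵥ y) = tGen *ᵥ octMul x y := by
  simp only [tGen_mulVec]
  apply fin8_funext <;> simp [octMul] <;> ring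

namespace RankOnePair

/-- The generator of the one-parameter group `A`. -/
def gen : RankOnePair → Matrix (Fin 8) (Fin 8) ℂ
  | so7g2 => dGen 0 1
  | spin7g2 => dGen 1 (-1 / 3)
  | g2sl3 => tGen

theorem gen_transpose (P : RankOnePair) : P.genᵀ = -P.gen := by
  cases P
  exacts [dGen_transpose _ _, dGen_transpose _ _, tGen_transpose]

theorem aMat_eq_exp (P : RankOnePair) (t : ℝ) : P.aMat t = exp (t • P.gen) := by
  cases P with
  | so7g2 => rw [gen, ← dBlocks_eq_exp, mul_zero, mul_one, aMat]
  | spin7g2 =>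
    rw [gen, ← dBlocks_eq_exp, mul_one, aMat]
    congr 1
    ring
  | g2sl3 => exact tBlocks_eq_exp t

/-- The elements of the one-parameter group `A`. -/
def aSL (P : RankOnePair) (t : ℝ) : SL8 := expSL P.gen_transpose t

theorem coe_aSL (P : RankOnePair) (t : ℝ) :
    (P.aSL t : Matrix (Fin 8) (Fin 8) ℂ) = P.aMat t := (P.aMat_eq_exp t).symm

theorem isLift_aSL (t : ℝ) : IsLift (so7g2.aSL (2 / 3 * t)) (spin7g2.aSL t) := by
  have h := isLift_expSL (dGen_transpose 0 (2 * (1 / 3))) (dGen_transpose (3 * (1 / 3)) (-(1 / 3)))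
    (dGen_derivation (1 / 3)) t
  convert h using 1 <;> apply Subtype.ext <;> rw [coe_aSL]
  · change dBlocks 0 (2 / 3 * t) = exp (t • dGen 0 (2 * (1 / 3)))
    rw [← dBlocks_eq_exp]
    congr 1 <;> ring
  · change dBlocks t (-t / 3) = exp (t • dGen (3 * (1 / 3)) (-(1 / 3)))
    rw [← dBlocks_eq_exp]
    congr 1 <;> ring

theorem aSL_mem_GC (P : RankOnePair) (t : ℝ) : P.aSL t ∈ P.GC := by
  cases P with
  | so7g2 =>
    have h := (isLift_aSL (3 / 2 * t)).1
    rwa [show (2 : ℝ) / 3 * (3 / 2 * t) = t by ring] at h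
  | spin7g2 => exact mem_Spin7_iff.2 ⟨_, isLift_aSL t⟩
  | g2sl3 =>
    have h := isLift_expSL tGen_transpose tGen_transpose tGen_derivation t
    exact ⟨h.2, h.3⟩

theorem aSL_add (P : RankOnePair) (s t : ℝ) : P.aSL (s + t) = P.aSL s * P.aSL t := by
  apply Subtype.ext
  change exp ((s + t) • P.gen) = exp (s • P.gen) * exp (t • P.gen)
  rw [add_smul]
  refine Matrix.exp_add_of_commute _ _ ?_
  exact ((Commute.refl P.gen).smul_left s).smul_right t

/-- Every plane rotated by A joins an even and an odd index, so conjugation by `Ipm` changes the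
sign of each entry ±i sinh, and complex conjugation changes it back. -/
theorem sigmaZero_aSL (P : RankOnePair) (t : ℝ) : sigmaZero (P.aSL t) = P.aSL t := by
  apply Subtype.ext
  have h2 : (sigmaZero (P.aSL t) : Matrix (Fin 8) (Fin 8) ℂ) =
      diagonal ![1, -1, 1, -1, 1, -1, 1, -1] *
        (P.aSL t : Matrix (Fin 8) (Fin 8) ℂ).map (starRingEnd ℂ) *
        diagonal ![1, -1, 1, -1, 1, -1, 1, -1] := rfl
  refine h2.trans ?_
  rw [coe_aSL]
  cases P
  all_goals
    ext i j
    rw [mul_diagonal, diagonal_mul]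
    fin_cases i <;> fin_cases j <;> simp [aMat, dBlocks, tBlocks, -Complex.ofReal_cosh, -Complex.ofReal_sinh]

/-- The elements of `A`, as elements of `G_ℂ`. -/
def aElt (P : RankOnePair) (t : ℝ) : P.GC := ⟨P.aSL t, P.aSL_mem_GC t⟩

theorem mem_A_iff (P : RankOnePair) (g : SL8) : g ∈ P.A ↔ ∃ t, g = P.aSL t :=
  exists_congr fun t => ⟨fun h => Subtype.ext (h.trans (P.coe_aSL t).symm),
    fun h => h ▸ P.coe_aSL t⟩

end RankOnePair

end OneParameter

/-! ### The Cartan decomposition -/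

section CartanDecomposition

open Matrix NormedSpace
open scoped Matrix.Norms.Operator

theorem act_spin7_aSL_zero (t : ℝ) : act (RankOnePair.spin7g2.aSL t) (octE 0) =
    (Real.cosh t : ℂ) • octE 0 + (Complex.I * Real.sinh t) • octE 1 := by
  funext i
  rw [act_octE, RankOnePair.coe_aSL]
  fin_cases i <;> simp [RankOnePair.aMat, dBlocks, octE]

theorem act_g2_aSL_one (t : ℝ) : act (RankOnePair.g2sl3.aSL t) (octE 1) =
    (Real.cosh t : ℂ) • octE 1 + (Complex.I * Real.sinh t) • octE 2 := by
  funext i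
  rw [act_octE, RankOnePair.coe_aSL]
  fin_cases i <;> simp [RankOnePair.aMat, tBlocks, octE]

theorem exists_unit_multiple {v : Fin 8 → ℂ} (hv : star v = v) :
    ∃ r : ℝ, 0 ≤ r ∧ v ⬝ᵥ v = (r : ℂ) ^ 2 := by
  refine ⟨√(∑ i, (v i).re ^ 2), Real.sqrt_nonneg _, ?_⟩
  rw [← Complex.ofReal_pow, Real.sq_sqrt (Finset.sum_nonneg fun i _ => sq_nonneg _),
    dotProduct_self_of_real hv]

theorem eq_zero_of_real_of_dotProduct_self {v : Fin 8 → ℂ} (hv : star v = v) (h : v ⬝ᵥ v = 0) :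
    v = 0 := by
  rw [dotProduct_self_of_real hv, Complex.ofReal_eq_zero,
    Finset.sum_eq_zero_iff_of_nonneg (fun i _ => sq_nonneg _)] at h
  funext i
  have h1 : (starRingEnd ℂ) (v i) = v i := congrFun hv i
  rw [Complex.conj_eq_iff_re] at h1
  rw [← h1]
  simpa using h i (Finset.mem_univ i)

theorem smul_real {v : Fin 8 → ℂ} (hv : star v = v) (r : ℝ) : star ((r : ℂ) • v) = (r : ℂ) • v := by
  rw [star_smul, hv]
  congr 1
  exact Complex.conj_ofReal r

/-- A vector of the complex unit quadric is `cosh t x + √-1 sinh t y` with real orthonormal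
vectors `x` and `y`. -/
theorem exists_cosh_sinh {z : Fin 8 → ℂ} (hz : z ⬝ᵥ z = 1) :
    ∃ (t : ℝ) (x y : Fin 8 → ℂ), star x = x ∧ star y = y ∧ x ⬝ᵥ x = 1 ∧ y ⬝ᵥ y = 1 ∧ x ⬝ᵥ y = 0 ∧
      z = (Real.cosh t : ℂ) • x + (Complex.I * Real.sinh t) • y ∧ (z 0 = 0 → x 0 = 0 ∧ y 0 = 0) := by
  set x : Fin 8 → ℂ := fun i => ((z i).re : ℂ) with hx
  set y : Fin 8 → ℂ := fun i => ((z i).im : ℂ) with hy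
  have hxr : star x = x := funext fun i => Complex.conj_ofReal _
  have hyr : star y = y := funext fun i => Complex.conj_ofReal _
  have hzxy : z = x + Complex.I • y := funext fun i => by
    simp only [hx, hy, Pi.add_apply, Pi.smul_apply, smul_eq_mul]
    rw [mul_comm]
    exact (Complex.re_add_im _).symm
  obtain ⟨a, ha0, ha⟩ := exists_unit_multiple hxr
  obtain ⟨b, hb0, hb⟩ := exists_unit_multiple hyr
  have hxyr : x ⬝ᵥ y = ((∑ i, (z i).re * (z i).im : ℝ) : ℂ) := by
    simp [dotProduct, hx, hy]
  have h1 : a ^ 2 - b ^ 2 = 1 ∧ x ⬝ᵥ y = 0 := by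
    rw [hzxy, dotProduct_add, add_dotProduct, add_dotProduct, smul_dotProduct, dotProduct_smul,
      dotProduct_smul, smul_dotProduct, ha, hb, dotProduct_comm y x, hxyr] at hz
    rw [hxyr]
    set c : ℝ := ∑ i, (z i).re * (z i).im
    have h2 : ((a ^ 2 - b ^ 2 : ℝ) : ℂ) + (2 * c : ℝ) * Complex.I = 1 := by
      rw [← hz]
      push_cast
      simp only [smul_eq_mul]
      linear_combination -(b : ℂ) ^ 2 * Complex.I_sq
    have hre := congrArg Complex.re h2
    have him := congrArg Complex.im h2
    simp only [Complex.add_re, Complex.add_im, Complex.ofReal_re, Complex.ofReal_im, Complex.mul_re,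
      Complex.mul_im, Complex.I_re, Complex.I_im, Complex.one_re, Complex.one_im] at hre him
    have hc0 : c = 0 := by linarith
    exact ⟨by linarith, by rw [hc0, Complex.ofReal_zero]⟩
  -- The real part of z · z = 1 is a² - b² = 1 for the lengths a, b of the two parts, so t = arsinh
  -- b.
  have ha1 : a = Real.cosh (Real.arsinh b) := by
    rw [Real.cosh_arsinh, ← Real.sqrt_sq ha0]
    congr 1
    linarith [h1.1]
  have hapos : (a : ℂ) ≠ 0 := by
    rw [ha1]
    exact_mod_cast (Real.cosh_pos _).ne'
  have hx1 : ((a⁻¹ : ℝ) : ℂ) • x ⬝ᵥ ((a⁻¹ : ℝ) : ℂ) • x = 1 := by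
    rw [smul_dotProduct, dotProduct_smul, ha, Complex.ofReal_inv, smul_eq_mul, smul_eq_mul]
    field_simp
  have hax : (a : ℂ) • ((a⁻¹ : ℝ) : ℂ) • x = x := by
    rw [smul_smul, Complex.ofReal_inv, mul_inv_cancel₀ hapos, one_smul]
  have hx0 : z 0 = 0 → x 0 = 0 := fun h => by simp [hx, h]
  have hy0 : z 0 = 0 → y 0 = 0 := fun h => by simp [hy, h]
  -- For b = 0 the coefficient of y is zero, and any imaginary unit vector orthogonal to x will do.
  by_cases hbz : b = 0
  · have hyz : y = 0 := eq_zero_of_real_of_dotProduct_self hyr (by simp [hb, hbz])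
    obtain ⟨u, hu, hxu⟩ := exists_real_unitImag_orthogonal (smul_real hxr a⁻¹)
    refine ⟨Real.arsinh b, _, u, smul_real hxr a⁻¹, hu, hx1, u.2.2, hxu, ?_, fun h => ⟨?_, u.2.1⟩⟩
    · rw [← ha1, hax, Real.sinh_arsinh, hbz, hzxy, hyz]
      simp
    · simp [hx0 h]
  · have hbz' : (b : ℂ) ≠ 0 := by exact_mod_cast hbz
    refine ⟨Real.arsinh b, _, ((b⁻¹ : ℝ) : ℂ) • y, smul_real hxr a⁻¹, smul_real hyr b⁻¹, hx1, ?_, ?_,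
      ?_, fun h => ⟨?_, ?_⟩⟩
    · rw [smul_dotProduct, dotProduct_smul, hb, Complex.ofReal_inv, smul_eq_mul, smul_eq_mul]
      field_simp
    · rw [smul_dotProduct, dotProduct_smul, h1.2, smul_zero, smul_zero]
    · rw [← ha1, hax, Real.sinh_arsinh, smul_smul, mul_assoc, Complex.ofReal_inv,
        mul_inv_cancel₀ hbz', mul_one, hzxy]
    · simp [hx0 h]
    · simp [hy0 h]

theorem exists_cosh_sinh_act {g : SL8} (hg : g ∈ SO8) (i : Fin 8) :
    ∃ (t : ℝ) (x y : Fin 8 → ℂ), star x = x ∧ star y = y ∧ x ⬝ᵥ x = 1 ∧ y ⬝ᵥ y = 1 ∧ x ⬝ᵥ y = 0 ∧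
      act g (octE i) = (Real.cosh t : ℂ) • x + (Complex.I * Real.sinh t) • y ∧
      (act g (octE i) 0 = 0 → x 0 = 0 ∧ y 0 = 0) :=
  exists_cosh_sinh (by rw [act_dotProduct_act hg, octE_dotProduct_octE, if_pos rfl])

/-- Choose k real with (e₀, e₁) ↦ (x, y) where g e₀ = cosh t x + i sinh t y. Then k a_t and g agree
on e₀ and differ by an element of `G2`. -/
theorem IsLift.exists_cartan {g₀ g : SL8} (hg : IsLift g₀ g) :
    ∃ k₀ k : SL8, IsLift k₀ k ∧ cartanInv k = k ∧ ∃ t : ℝ, ∃ h ∈ G2,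
      g = k * RankOnePair.spin7g2.aSL t * h := by
  obtain ⟨t, x, y, hxr, hyr, hx, hy, hxy, hz, -⟩ := exists_cosh_sinh_act hg.2 0
  obtain ⟨k₀, k, hk, hkr, hk0, hk1⟩ := exists_Spin7_act_eq hxr hyr hx hy hxy
  have hka := hk.mul (RankOnePair.isLift_aSL t)
  refine ⟨k₀, k, hk, hkr, t, (k * RankOnePair.spin7g2.aSL t)⁻¹ * g,
    (hka.inv.mul hg).mem_G2_of_fixes ?_, (mul_inv_cancel_left _ _).symm⟩
  rw [act_mul, hz, ← hk0, ← hk1, ← act_smul, ← act_smul, ← act_add, ← act_spin7_aSL_zero, ← act_mul k,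
    act_inv_act]

theorem mem_SL3_of_fixes {g : SL8} (hg : g ∈ G2) (h : act g (octE 1) = octE 1) : g ∈ SL3 := ⟨hg, h⟩

theorem act_apply_zero_of_mem_SO7 {g : SL8} (hg : g ∈ SO7) (x : Fin 8 → ℂ) : act g x 0 = x 0 := by
  rw [← octE_dotProduct 0 (act g x), ← octE_dotProduct 0 x]
  conv_lhs => rw [← hg.2]
  exact act_dotProduct_act hg.1 _ _

/-- The Cartan decomposition `G_ℂ = G_u A H_ℂ`. -/
theorem RankOnePair.exists_cartan (P : RankOnePair) {g : SL8} (hg : g ∈ P.GC) :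
    ∃ k ∈ P.GC, cartanInv k = k ∧ ∃ t : ℝ, ∃ h ∈ P.HC, g = k * P.aSL t * h := by
  cases P with
  -- Decompose a lift in Spin(7) and compare bases; the base of a_t has parameter 2t/3.
  | so7g2 =>
    obtain ⟨g', hg', -⟩ := exists_isLift hg
    obtain ⟨k₀, k, hk, hkr, t, h, hh, he⟩ := hg'.exists_cartan
    refine ⟨k₀, hk.1, hk.base_real hkr, 2 / 3 * t, h, hh, ?_⟩
    rw [he] at hg'
    exact hg'.eq_base ((hk.mul (isLift_aSL t)).mul (isLift_of_mem_G2 hh))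
  | spin7g2 =>
    obtain ⟨g₀, hg'⟩ := mem_Spin7_iff.1 hg
    obtain ⟨k₀, k, hk, hkr, t, h, hh, he⟩ := hg'.exists_cartan
    exact ⟨k, mem_Spin7_iff.2 ⟨k₀, hk⟩, hkr, t, h, hh, he⟩
  | g2sl3 =>
    have hg : g ∈ G2 := hg
    have hz0 : act g (octE 1) 0 = 0 := by
      rw [act_apply_zero_of_mem_SO7 (isLift_of_mem_G2 hg).1]
      simp [octE]
    obtain ⟨t, x, y, hxr, hyr, hx, hy, hxy, hz, h0⟩ := exists_cosh_sinh_act hg.1 1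
    obtain ⟨k, hk, hkr, hk1, hk2⟩ := exists_G2_act_eq (f₁ := ⟨x, (h0 hz0).1, hx⟩)
      (f₂ := ⟨y, (h0 hz0).2, hy⟩) hxr hyr hxy
    have ha : g2sl3.aSL t ∈ G2 := aSL_mem_GC g2sl3 t
    refine ⟨k, hk, hkr, t, (k * g2sl3.aSL t)⁻¹ * g,
      mem_SL3_of_fixes (mul_mem (inv_mem (mul_mem hk ha)) hg) ?_, (mul_inv_cancel_left _ _).symm⟩
    have hk1' : act k (octE 1) = x := hk1
    have hk2' : act k (octE 2) = y := hk2
    rw [act_mul, hz, ← hk1', ← hk2', ← act_smul, ← act_smul, ← act_add, ← act_g2_aSL_one, ← act_mul k,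
      act_inv_act]

/-- The vector exp(-sD)(cos s p + sin s q) is constant in s. -/
theorem exp_mulVec_of_rotation {D : Matrix (Fin 8) (Fin 8) ℂ} {p q : Fin 8 → ℂ} (hp : D *ᵥ p = q)
    (hq : D *ᵥ q = -p) (t : ℝ) :
    exp (t • D) *ᵥ p = (Real.cos t : ℂ) • p + (Real.sin t : ℂ) • q := by
  -- Vectors are encoded as matrices with equal columns, so that the product rule of the algebra
  -- applies.
  let col : (Fin 8 → ℂ) → Matrix (Fin 8) (Fin 8) ℂ := fun v => Matrix.of fun i _ => v i
  have hcol : ∀ (M : Matrix (Fin 8) (Fin 8) ℂ) v, M * col v = col (M *ᵥ v) := fun M v => by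
    ext i j
    simp [col, Matrix.mul_apply, mulVec, dotProduct]
  have hP : D * col p = col q := by rw [hcol, hp]
  have hQ : D * col q = -col p := by
    rw [hcol, hq]
    ext i j
    simp [col]
  have hd : ∀ s : ℝ, HasDerivAt
      (fun s : ℝ => exp (s • -D) * (Real.cos s • col p + Real.sin s • col q)) 0 s := fun s => by
    have h2 := hasDerivAt_exp_smul_const (𝕂 := ℝ) (-D) s
    have h3 := ((Real.hasDerivAt_cos s).smul_const (col p)).fun_add
      ((Real.hasDerivAt_sin s).smul_const (col q))
    refine (h2.fun_mul h3).congr_deriv ?_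
    have h4 : D * (Real.cos s • col p + Real.sin s • col q) = Real.cos s • col q - Real.sin s • col p := by
      rw [Matrix.mul_add, Matrix.mul_smul, Matrix.mul_smul, hP, hQ, smul_neg, sub_eq_add_neg]
    rw [mul_assoc, neg_mul, h4, neg_smul, ← mul_add]
    convert mul_zero _ using 2
    abel
  have hc := is_const_of_deriv_eq_zero (fun s => (hd s).differentiableAt) (fun s => (hd s).deriv) t 0
  simp only [zero_smul, exp_zero, Real.cos_zero, Real.sin_zero, one_smul, add_zero, one_mul] at hc
  have h1 : exp (t • D) * exp (t • -D) = 1 := by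
    rw [smul_neg]
    exact exp_mul_exp_neg_self _
  have h2 : exp (t • D) * col p = Real.cos t • col p + Real.sin t • col q := by
    conv_lhs => rw [← hc]
    rw [← Matrix.mul_assoc, h1, Matrix.one_mul]
  rw [hcol] at h2
  funext i
  have := congrFun (congrFun h2 i) 0
  simpa [col] using this

namespace RankOnePair

/-- The generator of a one-parameter group of rotations in `G_u`. -/
def rotGen (P : RankOnePair) : Matrix (Fin 8) (Fin 8) ℂ := (-Complex.I) • P.gen

theorem rotGen_transpose (P : RankOnePair) : P.rotGenᵀ = -P.rotGen := by
  rw [rotGen, transpose_smul, gen_transpose, smul_neg]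

/-- A one-parameter group of rotations in `G_u`. -/
def rotSL (P : RankOnePair) (t : ℝ) : SL8 := expSL P.rotGen_transpose t

theorem smul_dGen (c r s : ℝ) : c • dGen r s = dGen (c * r) (c * s) := by
  ext i j
  fin_cases i <;> fin_cases j <;> simp [dGen] <;> ring

/-- The derivation identity is complex linear in the generators, so it survives multiplication by
-i, which turns hyperbolic rotations into ordinary ones. -/
theorem isLift_rotSL (t : ℝ) : IsLift (so7g2.rotSL (2 / 3 * t)) (spin7g2.rotSL t) := by
  have h₀ : ((2 / 3 : ℝ) • so7g2.rotGen)ᵀ = -((2 / 3 : ℝ) • so7g2.rotGen) := by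
    rw [transpose_smul, rotGen_transpose, smul_neg]
  have h := isLift_expSL h₀ spin7g2.rotGen_transpose (fun x y => ?_) t
  · have e : so7g2.rotSL (2 / 3 * t) = expSL h₀ t := by
      apply Subtype.ext
      change exp ((2 / 3 * t) • so7g2.rotGen) = exp (t • (2 / 3 : ℝ) • so7g2.rotGen)
      rw [smul_smul, mul_comm]
    rw [e]
    exact h
  · have e1 : (2 / 3 : ℝ) • so7g2.rotGen = (-Complex.I) • dGen 0 (2 * (1 / 3)) := by
      rw [rotGen, smul_comm, gen, smul_dGen]
      norm_num
    have e2 : spin7g2.rotGen = (-Complex.I) • dGen (3 * (1 / 3)) (-(1 / 3)) := by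
      rw [rotGen, gen]
      norm_num
    rw [e1, e2, smul_mulVec, smul_mulVec, smul_mulVec, octMul_smul_left, octMul_smul_right,
      ← smul_add, dGen_derivation]

theorem rotSL_mem_GC (P : RankOnePair) (t : ℝ) : P.rotSL t ∈ P.GC := by
  cases P with
  | so7g2 =>
    have h := (isLift_rotSL (3 / 2 * t)).1
    rwa [show (2 : ℝ) / 3 * (3 / 2 * t) = t by ring] at h
  | spin7g2 => exact mem_Spin7_iff.2 ⟨_, isLift_rotSL t⟩
  | g2sl3 =>
    have h := isLift_expSL g2sl3.rotGen_transpose g2sl3.rotGen_transpose (fun x y => by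
      rw [rotGen, smul_mulVec, smul_mulVec, smul_mulVec, octMul_smul_left, octMul_smul_right,
        ← smul_add, gen, tGen_derivation]) t
    exact ⟨h.2, h.3⟩

theorem act_spin7_rotSL_zero (t : ℝ) : act (spin7g2.rotSL t) (octE 0) =
    (Real.cos t : ℂ) • octE 0 + (Real.sin t : ℂ) • octE 1 := by
  refine exp_mulVec_of_rotation ?_ ?_ t
  all_goals
    rw [rotGen, smul_mulVec, gen, dGen_mulVec]
    apply fin8_funext <;> simp [octE]

theorem act_g2_rotSL_one (t : ℝ) : act (g2sl3.rotSL t) (octE 1) =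
    (Real.cos t : ℂ) • octE 1 + (Real.sin t : ℂ) • octE 2 := by
  refine exp_mulVec_of_rotation ?_ ?_ t
  all_goals
    rw [rotGen, smul_mulVec, gen, tGen_mulVec]
    apply fin8_funext <;> simp [octE]

end RankOnePair

/-- A real unit vector is `cos t e + sin t f` with `f` a real unit vector normal to the given real
unit vector `e`. -/
theorem exists_cos_sin {x e : Fin 8 → ℂ} (hxr : star x = x) (her : star e = e) (hx : x ⬝ᵥ x = 1)
    (he : e ⬝ᵥ e = 1) : ∃ (t : ℝ) (f : Fin 8 → ℂ), star f = f ∧ f ⬝ᵥ f = 1 ∧ e ⬝ᵥ f = 0 ∧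
      x = (Real.cos t : ℂ) • e + (Real.sin t : ℂ) • f ∧ (e 0 = 0 → x 0 = 0 → f 0 = 0) := by
  have hxe : ∃ c : ℝ, e ⬝ᵥ x = c := by
    refine ⟨(e ⬝ᵥ x).re, (Complex.conj_eq_iff_re.1 ?_).symm⟩
    have : star (e ⬝ᵥ x) = e ⬝ᵥ x := by
      rw [← star_dotProduct_star, hxr, her, dotProduct_comm]
    exact this
  obtain ⟨c, hc⟩ := hxe
  set w := x - (c : ℂ) • e with hw
  have hwr : star w = w := by rw [hw, star_sub, hxr, smul_real her]
  have hew : e ⬝ᵥ w = 0 := by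
    rw [hw, dotProduct_sub, dotProduct_smul, hc, he]
    simp
  obtain ⟨s, hs0, hs⟩ := exists_unit_multiple hwr
  have hcs : c ^ 2 + s ^ 2 = 1 := by
    have : w ⬝ᵥ w = 1 - (c : ℂ) ^ 2 := by
      rw [hw, sub_dotProduct, dotProduct_sub, dotProduct_sub, smul_dotProduct, dotProduct_smul,
        dotProduct_smul, smul_dotProduct, hx, he, dotProduct_comm x e, hc]
      simp only [smul_eq_mul]
      ring
    rw [hs] at this
    have h2 : ((c ^ 2 + s ^ 2 : ℝ) : ℂ) = 1 := by
      push_cast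
      rw [this]
      ring
    exact_mod_cast h2
  have hcabs : -1 ≤ c ∧ c ≤ 1 := ⟨by nlinarith [sq_nonneg s], by nlinarith [sq_nonneg s]⟩
  have hcos := Real.cos_arccos hcabs.1 hcabs.2
  have hsin : Real.sin (Real.arccos c) = s := by
    rw [Real.sin_arccos, ← Real.sqrt_sq hs0]
    congr 1
    linarith
  have hxw : x = (c : ℂ) • e + w := by rw [hw]; abel
  by_cases hsz : s = 0
  · have hwz : w = 0 := eq_zero_of_real_of_dotProduct_self hwr (by simp [hs, hsz])
    obtain ⟨u, hu, heu⟩ := exists_real_unitImag_orthogonal her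
    refine ⟨Real.arccos c, u, hu, u.2.2, heu, ?_, fun _ _ => u.2.1⟩
    rw [hcos, hsin, hsz, hxw, hwz]
    simp
  · have hsz' : (s : ℂ) ≠ 0 := by exact_mod_cast hsz
    refine ⟨Real.arccos c, ((s⁻¹ : ℝ) : ℂ) • w, smul_real hwr _, ?_, ?_, ?_, fun h1 h2 => ?_⟩
    · rw [smul_dotProduct, dotProduct_smul, hs, Complex.ofReal_inv, smul_eq_mul, smul_eq_mul]
      field_simp
    · rw [dotProduct_smul, hew, smul_zero]
    · rw [hcos, hsin, smul_smul, Complex.ofReal_inv, mul_inv_cancel₀ hsz', one_smul, ← hxw]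
    · simp [hw, h1, h2]

/-- Compact counterpart of the Cartan decomposition, with g e₀ = cos t e₀ + sin t f; it serves to
connect D. -/
theorem IsLift.exists_rotation {g₀ g : SL8} (hg : IsLift g₀ g) (hgr : cartanInv g = g) :
    ∃ k ∈ G2, ∃ t : ℝ, ∃ h ∈ G2, g = k * RankOnePair.spin7g2.rotSL t * h := by
  obtain ⟨t, f, hfr, hf, hef, hx, -⟩ := exists_cos_sin (star_act_of_real hgr (star_octE 0))
    (star_octE 0) (by rw [act_dotProduct_act hg.2, octE_dotProduct_octE, if_pos rfl])
    (by rw [octE_dotProduct_octE, if_pos rfl])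
  obtain ⟨f', hf'r, hff'⟩ := exists_real_unitImag_orthogonal hfr
  rw [octE_dotProduct] at hef
  obtain ⟨k, hk, -, hk1, -⟩ := exists_G2_act_eq (f₁ := ⟨f, hef, hf⟩) hfr hf'r hff'
  have hk1' : act k (octE 1) = f := hk1
  have hkr := (isLift_of_mem_G2 hk).mul (RankOnePair.isLift_rotSL t)
  refine ⟨k, hk, t, (k * RankOnePair.spin7g2.rotSL t)⁻¹ * g,
    (hkr.inv.mul hg).mem_G2_of_fixes ?_, (mul_inv_cancel_left _ _).symm⟩
  rw [act_mul, hx, ← hk1']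
  conv_lhs => rw [← act_octE_zero_of_mem_G2 hk]
  rw [← act_smul, ← act_smul, ← act_add,
    ← RankOnePair.act_spin7_rotSL_zero, ← act_mul k, act_inv_act]

/-- Every element of `G_u` lies in `H_ℂ r_t H_ℂ` for a rotation `r_t`. -/
theorem RankOnePair.exists_rotation (P : RankOnePair) {g : SL8} (hg : g ∈ P.GC)
    (hgr : cartanInv g = g) : ∃ k ∈ P.HC, ∃ t : ℝ, ∃ h ∈ P.HC, g = k * P.rotSL t * h := by
  cases P with
  | so7g2 =>
    obtain ⟨g', hg', hr⟩ := exists_isLift hg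
    obtain ⟨k, hk, t, h, hh, he⟩ := hg'.exists_rotation (hr hgr)
    refine ⟨k, hk, 2 / 3 * t, h, hh, ?_⟩
    rw [he] at hg'
    exact hg'.eq_base (((isLift_of_mem_G2 hk).mul (isLift_rotSL t)).mul (isLift_of_mem_G2 hh))
  | spin7g2 =>
    obtain ⟨g₀, hg'⟩ := mem_Spin7_iff.1 hg
    exact hg'.exists_rotation hgr
  | g2sl3 =>
    have hg : g ∈ G2 := hg
    have hz0 : act g (octE 1) 0 = 0 := by
      rw [act_apply_zero_of_mem_SO7 (isLift_of_mem_G2 hg).1]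
      simp [octE]
    obtain ⟨t, f, hfr, hf, hef, hx, h0⟩ := exists_cos_sin (star_act_of_real hgr (star_octE 1))
      (star_octE 1) (by rw [act_dotProduct_act hg.1, octE_dotProduct_octE, if_pos rfl])
      (by rw [octE_dotProduct_octE, if_pos rfl])
    obtain ⟨k, hk, -, hk1, hk2⟩ := exists_G2_act_eq (f₁ := unitE 1 (by decide))
      (f₂ := ⟨f, h0 (by simp [octE]) hz0, hf⟩) (star_octE 1) hfr hef
    have hk1' : act k (octE 1) = octE 1 := hk1
    have hk2' : act k (octE 2) = f := hk2
    have ha : g2sl3.rotSL t ∈ G2 := rotSL_mem_GC g2sl3 t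
    refine ⟨k, ⟨hk, hk1'⟩, t, (k * g2sl3.rotSL t)⁻¹ * g,
      mem_SL3_of_fixes (mul_mem (inv_mem (mul_mem hk ha)) hg) ?_, (mul_inv_cancel_left _ _).symm⟩
    rw [act_mul, hx, ← hk2']
    conv_lhs => rw [← hk1']
    rw [← act_smul, ← act_smul, ← act_add, ← act_g2_rotSL_one, ← act_mul k, act_inv_act]

end CartanDecomposition

/-! ### Holomorphic equations of the matrix groups -/

section ZeroLoci

open Matrix NormedSpace
open scoped Matrix.Norms.Operator

/-- The set of common zeros of a family of holomorphic functions of the matrix entries. -/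
def IsZeroLocus (S : Set (Matrix (Fin 8) (Fin 8) ℂ)) : Prop :=
  ∃ F : Set (Matrix (Fin 8) (Fin 8) ℂ → ℂ), (∀ f ∈ F, Differentiable ℂ f) ∧
    ∀ M, M ∈ S ↔ ∀ f ∈ F, f M = 0

theorem IsZeroLocus.of_eq {f g : Matrix (Fin 8) (Fin 8) ℂ → ℂ} (hf : Differentiable ℂ f)
    (hg : Differentiable ℂ g) : IsZeroLocus {M | f M = g M} :=
  ⟨{fun M => f M - g M}, by rintro _ rfl; exact hf.sub hg, fun M => by simp [sub_eq_zero]⟩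

theorem IsZeroLocus.iInter {κ : Sort*} {S : κ → Set (Matrix (Fin 8) (Fin 8) ℂ)}
    (h : ∀ k, IsZeroLocus (S k)) : IsZeroLocus (⋂ k, S k) := by
  choose F hF hS using h
  refine ⟨⋃ k, F k, fun f hf => ?_, fun M => ?_⟩
  · obtain ⟨k, hk⟩ := Set.mem_iUnion.1 hf
    exact hF k f hk
  · simp only [Set.mem_iInter, hS, Set.mem_iUnion]
    exact ⟨fun h f ⟨k, hk⟩ => h k f hk, fun h k f hk => h f ⟨k, hk⟩⟩

theorem IsZeroLocus.inter {S T : Set (Matrix (Fin 8) (Fin 8) ℂ)} (hS : IsZeroLocus S)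
    (hT : IsZeroLocus T) : IsZeroLocus (S ∩ T) := by
  rw [Set.inter_eq_iInter]
  exact IsZeroLocus.iInter fun b => by cases b <;> assumption

theorem IsZeroLocus.of_vec_eq {f g : Matrix (Fin 8) (Fin 8) ℂ → Fin 8 → ℂ}
    (hf : ∀ i, Differentiable ℂ fun M => f M i) (hg : ∀ i, Differentiable ℂ fun M => g M i) :
    IsZeroLocus {M | f M = g M} := by
  have : {M | f M = g M} = ⋂ i, {M | f M i = g M i} := by
    ext M
    simp [funext_iff]
  rw [this]
  exact IsZeroLocus.iInter fun i => IsZeroLocus.of_eq (hf i) (hg i)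

theorem IsZeroLocus.isClosed {S : Set (Matrix (Fin 8) (Fin 8) ℂ)} (hS : IsZeroLocus S) :
    IsClosed S := by
  obtain ⟨F, hF, h⟩ := hS
  have : S = ⋂ f : F, {M | f.1 M = 0} := by
    ext M
    simp [h]
  rw [this]
  exact isClosed_iInter fun f => isClosed_eq (hF f f.2).continuous continuous_const

/-- The Lie algebra of a group cut out by holomorphic equations is a complex subspace; without this
the quotient would have no complex slice charts. -/
theorem IsZeroLocus.complex_smul_mem_lieSet {S : Set (Matrix (Fin 8) (Fin 8) ℂ)}
    (hS : IsZeroLocus S) (c : ℂ) {X : Matrix (Fin 8) (Fin 8) ℂ} (hX : X ∈ lieSet S) :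
    c • X ∈ lieSet S := by
  obtain ⟨F, hF, h⟩ := hS
  have hr : ∀ (t : ℝ) (Y : Matrix (Fin 8) (Fin 8) ℂ), t • Y = (t : ℂ) • Y := fun t Y => by
    ext
    simp
  intro t
  rw [hr, smul_smul]
  refine exp_complex_smul_mem (F := fun f : F => f.1) (fun f => hF f f.2)
    (fun M => by rw [h, Subtype.forall]) X (fun s => ?_) _
  rw [← hr]
  exact hX s

theorem differentiable_entry (i j : Fin 8) :
    Differentiable ℂ fun M : Matrix (Fin 8) (Fin 8) ℂ => M i j :=
  (LinearMap.toContinuousLinearMap (Matrix.entryLinearMap ℂ ℂ i j)).differentiable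

section

variable {E : Type*} [NormedAddCommGroup E] [NormedSpace ℂ E]

theorem differentiable_mulVec {f : E → Matrix (Fin 8) (Fin 8) ℂ} {v : E → Fin 8 → ℂ}
    (hf : ∀ i j, Differentiable ℂ fun M => f M i j) (hv : ∀ i, Differentiable ℂ fun M => v M i)
    (i : Fin 8) : Differentiable ℂ fun M => (f M *ᵥ v M) i := by
  simp only [mulVec, dotProduct]
  exact Differentiable.fun_sum fun j _ => (hf i j).fun_mul (hv j)

theorem differentiable_matMul {f g : E → Matrix (Fin 8) (Fin 8) ℂ}
    (hf : ∀ i j, Differentiable ℂ fun M => f M i j) (hg : ∀ i j, Differentiable ℂ fun M => g M i j)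
    (i j : Fin 8) : Differentiable ℂ fun M => (f M * g M) i j := by
  simp only [Matrix.mul_apply]
  exact Differentiable.fun_sum fun k _ => (hf i k).fun_mul (hg k j)

theorem differentiable_det {f : E → Matrix (Fin 8) (Fin 8) ℂ}
    (hf : ∀ i j, Differentiable ℂ fun M => f M i j) : Differentiable ℂ fun M => (f M).det := by
  simp only [det_apply]
  refine Differentiable.fun_sum fun σ _ => ?_
  have h := Finset.prod_induction (fun i M => f M (σ i) i) (Differentiable ℂ ·)
    (fun _ _ => Differentiable.mul) (differentiable_const 1) fun i (_ : i ∈ Finset.univ) => hf (σ i) i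
  have e : (fun M => ∏ i, f M (σ i) i) = ∏ i, fun M => f M (σ i) i := by
    ext M
    rw [Finset.prod_apply]
  refine Differentiable.const_smul ?_ _
  rw [e]
  exact h

theorem differentiable_octMul {f g : E → Fin 8 → ℂ} (hf : ∀ i, Differentiable ℂ fun M => f M i)
    (hg : ∀ i, Differentiable ℂ fun M => g M i) (i : Fin 8) :
    Differentiable ℂ fun M => octMul (f M) (g M) i := by
  have h : ∀ i j, Differentiable ℂ fun M => f M i * g M j := fun i j => (hf i).fun_mul (hg j)
  fin_cases i <;> simp [octMul] <;> fun_prop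

theorem differentiable_rightMulMat {f : E → Fin 8 → ℂ} (hf : ∀ i, Differentiable ℂ fun M => f M i)
    (i j : Fin 8) : Differentiable ℂ fun M => rightMulMat (f M) i j := by
  have h : ∀ u, rightMulMat u i j = octMul (octE j) u i := fun u => by
    rw [← rightMulMat_mulVec]
    simp [octE]
  simp only [h]
  exact differentiable_octMul (f := fun _ => octE j) (g := f) (fun _ => differentiable_const _) hf i

end

/-- The inclusion of a subgroup of `SL(8, ℂ)` into the algebra of matrices. -/
def matHom (G : Subgroup SL8) : G →* Matrix (Fin 8) (Fin 8) ℂ where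
  toFun g := ((g : SL8) : Matrix (Fin 8) (Fin 8) ℂ)
  map_one' := rfl
  map_mul' _ _ := rfl

theorem matHom_apply (G : Subgroup SL8) (g : G) :
    matHom G g = ((g : SL8) : Matrix (Fin 8) (Fin 8) ℂ) := rfl

theorem isInducing_matHom (G : Subgroup SL8) : Topology.IsInducing (matHom G) :=
  Topology.IsInducing.subtypeVal.comp Topology.IsInducing.subtypeVal

theorem mem_range_matHom {G : Subgroup SL8} {M : Matrix (Fin 8) (Fin 8) ℂ} :
    M ∈ Set.range (matHom G) ↔ ∃ hM : M.det = 1, (⟨M, hM⟩ : SL8) ∈ G :=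
  ⟨fun ⟨g, hg⟩ => hg ▸ ⟨(g : SL8).2, g.2⟩, fun ⟨_, hg⟩ => ⟨⟨_, hg⟩, rfl⟩⟩

theorem isClosedLinearGroup_range {K : Type*} [Group K] {A : Type*} [NormedRing A]
    {ι : K →* A} (h : IsClosed (Set.range ι)) : IsClosedLinearGroup (Set.range ι) where
  one_mem := ⟨1, map_one ι⟩
  mul_mem := by
    rintro _ ⟨a, rfl⟩ _ ⟨b, rfl⟩
    exact ⟨a * b, map_mul ι a b⟩
  inv_mem := by
    rintro _ ⟨a, rfl⟩ b hb
    refine ⟨a⁻¹, ?_⟩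
    have h1 : ι a⁻¹ * ι a = 1 := by rw [← map_mul, inv_mul_cancel, map_one]
    exact left_inv_eq_right_inv h1 hb
  isClosed := h

theorem isZeroLocus_det : IsZeroLocus {M | M.det = 1} :=
  IsZeroLocus.of_eq (f := fun M => M.det) (g := fun _ => 1)
    (differentiable_det (f := fun M => M) differentiable_entry) (differentiable_const 1)

theorem isZeroLocus_SO8 : IsZeroLocus (Set.range (matHom SO8)) := by
  have h : Set.range (matHom SO8) = {M | M.det = 1} ∩ ⋂ i, ⋂ j,
      {M | (Mᵀ * M) i j = (1 : Matrix (Fin 8) (Fin 8) ℂ) i j} := by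
    ext M
    rw [mem_range_matHom]
    simp only [Set.mem_inter_iff, Set.mem_iInter, Set.mem_ofPred_eq]
    exact ⟨fun ⟨hd, h⟩ => ⟨hd, fun i j => congrFun (congrFun h i) j⟩,
      fun ⟨hd, h⟩ => ⟨hd, Matrix.ext h⟩⟩
  rw [h]
  exact isZeroLocus_det.inter (IsZeroLocus.iInter fun i => IsZeroLocus.iInter fun j =>
    IsZeroLocus.of_eq (f := fun M => (Mᵀ * M) i j) (g := fun _ => (1 : Matrix (Fin 8) (Fin 8) ℂ) i j)
      (differentiable_matMul (f := fun M => Mᵀ) (g := fun M => M)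
        (fun i j => differentiable_entry j i) differentiable_entry i j) (differentiable_const _))

theorem isZeroLocus_of_and {G G' : Subgroup SL8} (hG : IsZeroLocus (Set.range (matHom G)))
    {p : SL8 → Prop} (hG' : ∀ g, g ∈ G' ↔ g ∈ G ∧ p g) {S : Set (Matrix (Fin 8) (Fin 8) ℂ)}
    (hS : IsZeroLocus S) (hp : ∀ g ∈ G, p g ↔ (g : Matrix (Fin 8) (Fin 8) ℂ) ∈ S) :
    IsZeroLocus (Set.range (matHom G')) := by
  have h : Set.range (matHom G') = Set.range (matHom G) ∩ S := by
    ext M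
    rw [Set.mem_inter_iff, mem_range_matHom, mem_range_matHom]
    constructor
    · rintro ⟨hd, h⟩
      have h1 := (hG' _).1 h
      exact ⟨⟨hd, h1.1⟩, (hp _ h1.1).1 h1.2⟩
    · rintro ⟨⟨hd, h1⟩, h2⟩
      exact ⟨hd, (hG' _).2 ⟨h1, (hp _ h1).2 h2⟩⟩
  rw [h]
  exact hG.inter hS

theorem isZeroLocus_fixes (v : Fin 8 → ℂ) : IsZeroLocus {M | M *ᵥ v = v} :=
  IsZeroLocus.of_vec_eq (differentiable_mulVec (f := fun M => M) differentiable_entry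
    fun _ => differentiable_const _)
    fun _ => differentiable_const _

theorem isZeroLocus_SO7 : IsZeroLocus (Set.range (matHom SO7)) :=
  isZeroLocus_of_and isZeroLocus_SO8 (p := fun g => act g (octE 0) = octE 0) (fun _ => Iff.rfl)
    (isZeroLocus_fixes (octE 0)) fun _ _ => Iff.rfl

theorem isZeroLocus_octMul {f : Matrix (Fin 8) (Fin 8) ℂ → Matrix (Fin 8) (Fin 8) ℂ}
    (hf : ∀ i j, Differentiable ℂ fun M => f M i j) :
    IsZeroLocus (⋂ (x : Fin 8 → ℂ) (y : Fin 8 → ℂ),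
      {M | octMul (f M *ᵥ x) (M *ᵥ y) = M *ᵥ octMul x y}) :=
  IsZeroLocus.iInter fun x => IsZeroLocus.iInter fun y => IsZeroLocus.of_vec_eq
    (differentiable_octMul (f := fun M => f M *ᵥ x) (g := fun M => M *ᵥ y)
      (differentiable_mulVec hf fun _ => differentiable_const _)
      (differentiable_mulVec (f := fun M => M) differentiable_entry fun _ => differentiable_const _))
    (differentiable_mulVec (f := fun M => M) differentiable_entry fun _ => differentiable_const _)

theorem isZeroLocus_G2 : IsZeroLocus (Set.range (matHom G2)) :=
  isZeroLocus_of_and isZeroLocus_SO8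
    (p := fun g => ∀ x y, octMul (act g x) (act g y) = act g (octMul x y)) (fun _ => Iff.rfl)
    (isZeroLocus_octMul (f := fun M => M) differentiable_entry)
    fun _ _ => by simp only [Set.mem_iInter]; rfl

theorem isZeroLocus_SL3 : IsZeroLocus (Set.range (matHom SL3)) :=
  isZeroLocus_of_and isZeroLocus_G2 (p := fun g => act g (octE 1) = octE 1) (fun _ => Iff.rfl)
    (isZeroLocus_fixes (octE 1)) fun _ _ => Iff.rfl

/-- The image in `SO(7, ℂ)` of an element of `Spin(7, ℂ)`, as a polynomial in its entries. -/
def spinBase (M : Matrix (Fin 8) (Fin 8) ℂ) : Matrix (Fin 8) (Fin 8) ℂ :=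
  M * rightMulMat (Mᵀ *ᵥ octE 0)

theorem spinBase_mulVec (M : Matrix (Fin 8) (Fin 8) ℂ) (x : Fin 8 → ℂ) :
    spinBase M *ᵥ x = M *ᵥ octMul x (Mᵀ *ᵥ octE 0) := by
  rw [spinBase, ← mulVec_mulVec, rightMulMat_mulVec]

theorem act_inv_of_mem_SO8 {g : SL8} (hg : g ∈ SO8) (x : Fin 8 → ℂ) :
    act g⁻¹ x = (g : Matrix (Fin 8) (Fin 8) ℂ)ᵀ *ᵥ x := by
  have h : (g : Matrix (Fin 8) (Fin 8) ℂ)ᵀ * (g : Matrix (Fin 8) (Fin 8) ℂ) = 1 := hg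
  conv_rhs => rw [← act_act_inv g x]
  rw [act, act, mulVec_mulVec, h, one_mulVec]

theorem differentiable_spinBase (i j : Fin 8) :
    Differentiable ℂ fun M : Matrix (Fin 8) (Fin 8) ℂ => spinBase M i j :=
  differentiable_matMul (f := fun M => M) (g := fun M => rightMulMat (Mᵀ *ᵥ octE 0))
    differentiable_entry (differentiable_rightMulMat (f := fun M => Mᵀ *ᵥ octE 0)
      (differentiable_mulVec (f := fun M => Mᵀ) (v := fun _ => octE 0)
        (fun i j => differentiable_entry j i) fun _ => differentiable_const _)) i j

/-- The quantifier over g₀ disappears because g₀ must be `spinBase g`. Besides multiplicativity only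
det = 1 has to be imposed on it; orthogonality and g₀ e₀ = e₀ are consequences. -/
theorem isZeroLocus_Spin7 : IsZeroLocus (Set.range (matHom Spin7)) := by
  refine isZeroLocus_of_and isZeroLocus_SO8
    (p := fun g => ∃ g₀ ∈ SO7, ∀ x y, octMul (act g₀ x) (act g y) = act g (octMul x y))
    (fun _ => Iff.rfl) ((IsZeroLocus.of_eq (f := fun M => (spinBase M).det) (g := fun _ => 1)
      (differentiable_det differentiable_spinBase) (differentiable_const _)).inter
      (isZeroLocus_octMul differentiable_spinBase)) fun g hg => ?_
  simp only [Set.mem_inter_iff, Set.mem_iInter, Set.mem_ofPred_eq]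
  constructor
  · rintro ⟨g₀, hg₀, h⟩
    have hl : IsLift g₀ g := ⟨hg₀, hg, h⟩
    have e : spinBase g = g₀ := Matrix.eq_of_mulVec_eq fun x => by
      rw [spinBase_mulVec, ← act_inv_of_mem_SO8 hg]
      exact (hl.act_base x).symm
    rw [e]
    exact ⟨g₀.2, h⟩
  · rintro ⟨hd, h⟩
    refine ⟨⟨spinBase g, hd⟩, ⟨transpose_mul_self_of_dotProduct fun x => ?_, ?_⟩, h⟩
    -- Multiplicativity at y = e₀ and the composition law: the norm of g₀x times that of g e₀, which
    -- is 1, equals the norm of g x.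
    · have h1 := dotProduct_octMul_self (spinBase g *ᵥ x) (act g (octE 0))
      have h2 : octMul (spinBase g *ᵥ x) (act g (octE 0)) = act g (octMul x (octE 0)) := h _ _
      rw [h2, act_dotProduct_act hg, act_dotProduct_act hg, octMul_one, octE_dotProduct_octE,
        if_pos rfl, mul_one] at h1
      exact h1.symm
    · have h1 : octMul (spinBase g *ᵥ octE 0) (act g (act g⁻¹ (octE 0))) =
        act g (octMul (octE 0) (act g⁻¹ (octE 0))) := h _ _
      rwa [act_act_inv, one_octMul, act_act_inv, octMul_one] at h1

namespace RankOnePair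

theorem isZeroLocus_GC (P : RankOnePair) : IsZeroLocus (Set.range (matHom P.GC)) := by
  cases P
  exacts [isZeroLocus_SO7, isZeroLocus_Spin7, isZeroLocus_G2]

theorem isZeroLocus_HC (P : RankOnePair) : IsZeroLocus (Set.range (matHom P.HC)) := by
  cases P
  exacts [isZeroLocus_G2, isZeroLocus_G2, isZeroLocus_SL3]

/-- The inclusion of `G_u` into the algebra of matrices. -/
def guHom (P : RankOnePair) : P.Gu →* Matrix (Fin 8) (Fin 8) ℂ := (matHom P.GC).comp P.Gu.subtype

theorem isInducing_guHom (P : RankOnePair) : Topology.IsInducing P.guHom :=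
  (isInducing_matHom P.GC).comp Topology.IsInducing.subtypeVal

theorem range_guHom (P : RankOnePair) :
    Set.range P.guHom = Set.range (matHom P.GC) ∩ {M | ∀ i j, star (M i j) = M i j} := by
  ext M
  constructor
  · rintro ⟨g, rfl⟩
    refine ⟨⟨g, rfl⟩, fun i j => ?_⟩
    have h : cartanInv ((g : P.GC) : SL8) = ((g : P.GC) : SL8) := g.2
    conv_rhs => rw [guHom, MonoidHom.comp_apply, matHom_apply]
    exact congrFun (congrFun (congrArg Subtype.val h) i) j
  · rintro ⟨⟨g, rfl⟩, hr⟩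
    exact ⟨⟨g, Subtype.ext (Matrix.ext fun i j => hr i j)⟩, rfl⟩

theorem GC_le_SO8 (P : RankOnePair) : P.GC ≤ SO8 := by
  cases P
  exacts [fun _ h => h.1, fun _ h => h.1, fun _ h => h.1]

theorem isClosed_range_guHom (P : RankOnePair) : IsClosed (Set.range P.guHom) := by
  rw [range_guHom]
  refine P.isZeroLocus_GC.isClosed.inter ?_
  simp only [Set.ofPred_forall]
  exact isClosed_iInter fun i => isClosed_iInter fun j =>
    isClosed_eq (differentiable_entry i j).continuous.star (differentiable_entry i j).continuous

/-- A real orthogonal matrix is unitary. The bound makes the closed set G_u compact. -/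
theorem norm_entry_le_of_mem_range_guHom (P : RankOnePair) {M : Matrix (Fin 8) (Fin 8) ℂ}
    (hM : M ∈ Set.range P.guHom) (i j : Fin 8) : ‖M i j‖ ≤ 1 := by
  rw [range_guHom] at hM
  obtain ⟨⟨g, rfl⟩, hr⟩ := hM
  refine entry_norm_bound_of_unitary ?_ i j
  have h : ((g : SL8) : Matrix (Fin 8) (Fin 8) ℂ)ᵀ * ((g : SL8) : Matrix (Fin 8) (Fin 8) ℂ) = 1 :=
    P.GC_le_SO8 g.2
  rw [mem_unitaryGroup_iff']
  have e : star (matHom P.GC g) = ((g : SL8) : Matrix (Fin 8) (Fin 8) ℂ)ᵀ :=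
    Matrix.ext fun i j => hr j i
  rw [e]
  exact h

instance compactSpace_Gu (P : RankOnePair) : CompactSpace P.Gu := by
  rw [← isCompact_univ_iff, P.isInducing_guHom.isCompact_iff, Set.image_univ]
  have hc : IsCompact {M : Matrix (Fin 8) (Fin 8) ℂ | ∀ i,
      M i ∈ {v : Fin 8 → ℂ | ∀ j, v j ∈ Metric.closedBall (0 : ℂ) 1}} :=
    isCompact_pi_infinite fun _ => isCompact_pi_infinite fun _ => isCompact_closedBall _ _
  exact hc.of_isClosed_subset P.isClosed_range_guHom fun M hM i j => by
    rw [mem_closedBall_zero_iff]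
    exact P.norm_entry_le_of_mem_range_guHom hM i j

end RankOnePair

end ZeroLoci

/-! ### The topology of `D`, the slice and the involution -/

section HomogeneousSpace

open Matrix NormedSpace
open scoped Matrix.Norms.Operator

theorem continuous_act (x : Fin 8 → ℂ) (G : Subgroup SL8) :
    Continuous fun g : G => act (g : SL8) x :=
  Continuous.matrix_mulVec (continuous_subtype_val.comp continuous_subtype_val) continuous_const

theorem continuous_act_inv (x : Fin 8 → ℂ) (G : Subgroup SL8) :
    Continuous fun g : G => act (g : SL8)⁻¹ x :=
  (continuous_act x G).comp continuous_inv

theorem continuous_octMul {X : Type*} [TopologicalSpace X] {f g : X → Fin 8 → ℂ} (hf : Continuous f)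
    (hg : Continuous g) : Continuous fun x => octMul (f x) (g x) := by
  refine continuous_pi fun i => ?_
  have h : ∀ i j, Continuous fun x => f x i * g x j := fun i j =>
    ((continuous_apply i).comp hf).mul ((continuous_apply j).comp hg)
  fin_cases i <;> simp [octMul] <;> fun_prop

namespace RankOnePair

/-- The base point of `D`. -/
def base (P : RankOnePair) : P.D := P.proj 1

theorem smul_base (P : RankOnePair) (g : P.GC) : g • P.base = P.proj g :=
  congrArg QuotientGroup.mk (mul_one g)

theorem exists_smul_base (P : RankOnePair) (x : P.D) : ∃ g : P.GC, g • P.base = x := by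
  obtain ⟨g, rfl⟩ := QuotientGroup.mk_surjective x
  exact ⟨g, P.smul_base g⟩

theorem proj_eq_iff (P : RankOnePair) (g h : P.GC) :
    P.proj g = P.proj h ↔ ((g : SL8)⁻¹ * h) ∈ P.HC := by
  rw [proj, proj, QuotientGroup.eq, Subgroup.mem_subgroupOf]
  rfl

theorem smul_base_eq_base_iff (P : RankOnePair) (g : P.GC) :
    g • P.base = P.base ↔ matHom P.GC g ∈ Set.range (matHom P.HC) := by
  rw [smul_base, base, proj_eq_iff, mem_range_matHom]
  have : (g : SL8)⁻¹ * ((1 : P.GC) : SL8) = (g : SL8)⁻¹ := mul_one _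
  rw [this, inv_mem_iff]
  exact ⟨fun h => ⟨(g : SL8).2, h⟩, fun ⟨_, h⟩ => h⟩

theorem continuous_smul_base (P : RankOnePair) : Continuous fun g : P.GC => g • P.base := by
  simp only [smul_base]
  exact QuotientGroup.continuous_mk

theorem isOpenMap_smul_base (P : RankOnePair) : IsOpenMap fun g : P.GC => g • P.base := by
  simp only [smul_base]
  exact QuotientGroup.isOpenMap_coe

/-- The quotient map is open, so it suffices that the coset relation is closed: it is the preimage
of the closed set H_ℂ under (g, h) ↦ g⁻¹h. -/
instance t2Space_D (P : RankOnePair) : T2Space P.D := by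
  rw [t2Space_iff_of_isOpenQuotientMap (QuotientGroup.isOpenQuotientMap_mk)]
  have h : {q : P.GC × P.GC | (QuotientGroup.mk q.1 : P.D) = QuotientGroup.mk q.2} =
      (fun q : P.GC × P.GC => matHom P.GC (q.1⁻¹ * q.2)) ⁻¹' Set.range (matHom P.HC) := by
    ext q
    rw [Set.mem_preimage, mem_range_matHom]
    refine (P.proj_eq_iff q.1 q.2).trans ⟨fun h => ⟨(q.1⁻¹ * q.2 : P.GC).1.2, h⟩, fun ⟨_, h⟩ => h⟩
  rw [h]
  exact P.isZeroLocus_HC.isClosed.preimage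
    ((isInducing_matHom P.GC).continuous.comp (continuous_fst.inv.mul continuous_snd))

instance secondCountableTopology_GC (P : RankOnePair) : SecondCountableTopology P.GC :=
  haveI : SecondCountableTopology (Matrix (Fin 8) (Fin 8) ℂ) :=
    inferInstanceAs (SecondCountableTopology (Fin 8 → Fin 8 → ℂ))
  (isInducing_matHom P.GC).secondCountableTopology

theorem continuous_aElt (P : RankOnePair) : Continuous P.aElt := by
  rw [(isInducing_matHom P.GC).continuous_iff]
  exact exp_continuous.comp (continuous_id.smul continuous_const)

/-- The rotations in `G_u`, as elements of `G_ℂ`. -/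
def rotElt (P : RankOnePair) (t : ℝ) : P.GC := ⟨P.rotSL t, P.rotSL_mem_GC t⟩

theorem continuous_rotElt (P : RankOnePair) : Continuous P.rotElt := by
  rw [(isInducing_matHom P.GC).continuous_iff]
  exact exp_continuous.comp (continuous_id.smul continuous_const)

theorem expSL_zero {Z : Matrix (Fin 8) (Fin 8) ℂ} (hZ : Zᵀ = -Z) : expSL hZ 0 = 1 := by
  apply Subtype.ext
  change exp ((0 : ℝ) • Z) = 1
  rw [zero_smul]
  exact exp_zero

theorem aElt_zero (P : RankOnePair) : P.aElt 0 = 1 := Subtype.ext (expSL_zero P.gen_transpose)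

theorem rotElt_zero (P : RankOnePair) : P.rotElt 0 = 1 := Subtype.ext (expSL_zero P.rotGen_transpose)

theorem aElt_add (P : RankOnePair) (s t : ℝ) : P.aElt (s + t) = P.aElt s * P.aElt t :=
  Subtype.ext (P.aSL_add s t)

theorem matHom_aElt (P : RankOnePair) (t : ℝ) : matHom P.GC (P.aElt t) = exp (t • P.gen) := rfl

theorem slice_eq (P : RankOnePair) : P.slice = Set.range fun t => P.aElt t • P.base := by
  ext x
  constructor
  · rintro ⟨a, ha, rfl⟩
    obtain ⟨t, ht⟩ := (P.mem_A_iff _).1 ha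
    have : P.aElt t = a := Subtype.ext ht.symm
    exact ⟨t, by rw [← this]; exact P.smul_base _⟩
  · rintro ⟨t, rfl⟩
    exact ⟨P.aElt t, (P.mem_A_iff _).2 ⟨t, rfl⟩, P.smul_base _⟩

theorem smul_base_of_mem_HC (P : RankOnePair) {h : P.GC} (hh : (h : SL8) ∈ P.HC) :
    h • P.base = P.base :=
  (P.smul_base_eq_base_iff h).2 (mem_range_matHom.2 ⟨(h : SL8).2, hh⟩)

theorem exists_cartan_GC (P : RankOnePair) (g : P.GC) : ∃ (k : P.Gu) (t : ℝ) (h : P.GC),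
    (h : SL8) ∈ P.HC ∧ g = k * P.aElt t * h := by
  obtain ⟨k, hk, hkr, t, h, hh, he⟩ := P.exists_cartan g.2
  exact ⟨⟨⟨k, hk⟩, hkr⟩, t, ⟨h, P.HC_le_GC hh⟩, hh, Subtype.ext he⟩

theorem exists_rotation_GC (P : RankOnePair) (k : P.Gu) : ∃ (k' : P.GC) (t : ℝ) (h : P.GC),
    (k' : SL8) ∈ P.HC ∧ (h : SL8) ∈ P.HC ∧ (k : P.GC) = k' * P.rotElt t * h := by
  obtain ⟨k', hk', t, h, hh, he⟩ := P.exists_rotation (k : P.GC).2 k.2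
  exact ⟨⟨k', P.HC_le_GC hk'⟩, t, ⟨h, P.HC_le_GC hh⟩, hk', hh, Subtype.ext he⟩

/-- With g = k a_t h and k = k' r_s h', the curve k' r_s joins the base point to its translate by k,
and then k a_t leads on to the given point. -/
instance connectedSpace_D (P : RankOnePair) : ConnectedSpace P.D := by
  have hpath : ∀ (k : P.GC) (c : ℝ → P.GC), Continuous c →
      IsPreconnected (Set.range fun t => (k * c t) • P.base) := fun k c hc =>
    isPreconnected_range (P.continuous_smul_base.comp (continuous_const.mul hc))
  have hpre : IsPreconnected (Set.univ : Set P.D) := by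
    refine isPreconnected_of_forall P.base fun y _ => ?_
    obtain ⟨g, rfl⟩ := P.exists_smul_base y
    obtain ⟨k, t, h, hh, rfl⟩ := P.exists_cartan_GC g
    obtain ⟨k', s, h', hk', hh', hk⟩ := P.exists_rotation_GC k
    refine ⟨(Set.range fun t => (k' * P.rotElt t) • P.base) ∪
      Set.range fun t => ((k : P.GC) * P.aElt t) • P.base, Set.subset_univ _,
      Or.inl ⟨0, ?_⟩, Or.inr ⟨t, ?_⟩,
      IsPreconnected.union ((k : P.GC) • P.base) ⟨s, ?_⟩ ⟨0, ?_⟩ (hpath _ _ P.continuous_rotElt)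
        (hpath _ _ P.continuous_aElt)⟩
    · change (k' * P.rotElt 0) • P.base = P.base
      rw [rotElt_zero, mul_one, P.smul_base_of_mem_HC hk']
    · change ((k : P.GC) * P.aElt t) • P.base = ((k : P.GC) * P.aElt t * h) • P.base
      rw [mul_smul _ h, P.smul_base_of_mem_HC hh]
    · change (k' * P.rotElt s) • P.base = (k : P.GC) • P.base
      rw [hk, mul_smul _ h', P.smul_base_of_mem_HC hh']
    · change ((k : P.GC) * P.aElt 0) • P.base = (k : P.GC) • P.base
      rw [aElt_zero, mul_one]
  exact { isPreconnected_univ := hpre, toNonempty := ⟨P.base⟩ }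

theorem exists_continuous_lift (P : RankOnePair) {f : P.GC → ℝ} (hf : Continuous f)
    (hinv : ∀ g h : P.GC, (h : SL8) ∈ P.HC → f (g * h) = f g) :
    ∃ τ : P.D → ℝ, Continuous τ ∧ ∀ g, τ (g • P.base) = f g := by
  have hr : ∀ a b : P.GC, QuotientGroup.leftRel (P.HC.subgroupOf P.GC) a b → f a = f b := by
    intro a b hab
    rw [QuotientGroup.leftRel_apply, Subgroup.mem_subgroupOf] at hab
    have := hinv a (a⁻¹ * b) hab
    rwa [mul_inv_cancel_left, eq_comm] at this
  refine ⟨fun x => Quotient.lift f hr x, hf.quotient_lift hr, fun g => ?_⟩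
  rw [smul_base]
  rfl

/-- The trilinear form ((xy)z)₀ is `G2`-invariant, so evaluating it at g⁻¹e₂, g⁻¹e₄, g⁻¹e₇ gives a
function on SO(7)/G₂; this replaces the orbit of a fixed vector used for the other pairs. -/
theorem so7_triple (t : ℝ) :
    octMul (octMul (act (so7g2.aSL t)⁻¹ (octE 2)) (act (so7g2.aSL t)⁻¹ (octE 4)))
      (act (so7g2.aSL t)⁻¹ (octE 7)) 0 = Complex.I * Real.sinh (3 * t) := by
  have hinv : (so7g2.aSL t)⁻¹ = so7g2.aSL (-t) := by
    rw [inv_eq_iff_mul_eq_one, ← aSL_add, add_neg_cancel]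
    exact expSL_zero _
  have hcol : ∀ j, act (so7g2.aSL t)⁻¹ (octE j) = fun i => dBlocks 0 (-t) i j := fun j => by
    funext i
    rw [hinv, act_octE, coe_aSL]
    rfl
  have hcs : (Complex.cosh t) ^ 2 = Complex.sinh t ^ 2 + 1 := Complex.cosh_sq t
  rw [hcol, hcol, hcol, Real.sinh_three_mul]
  simp [octMul, dBlocks]
  ring_nf
  rw [hcs, show Complex.I ^ 3 = -Complex.I by rw [pow_succ, Complex.I_sq]; ring]
  ring

/-- A continuous function on `D` that separates the points of the slice. -/
theorem exists_separating (P : RankOnePair) :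
    ∃ τ : P.D → ℝ, Continuous τ ∧ ∀ t, τ (P.aElt t • P.base) = t := by
  cases P with
  | so7g2 =>
    -- Inverses are used because g ↦ gh acts on g⁻¹x by h⁻¹, where invariance applies; the division
    -- by 3 undoes sinh 3t.
    obtain ⟨τ, hτ, h⟩ := so7g2.exists_continuous_lift
      (f := fun g => Real.arsinh (octMul (octMul (act (g : SL8)⁻¹ (octE 2))
        (act (g : SL8)⁻¹ (octE 4))) (act (g : SL8)⁻¹ (octE 7)) 0).im / 3)
      (Real.continuous_arsinh.comp (Complex.continuous_im.comp ((continuous_apply 0).comp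
        (continuous_octMul (continuous_octMul (continuous_act_inv _ _) (continuous_act_inv _ _))
          (continuous_act_inv _ _)))) |>.div_const 3) fun g h hh => by
        have hh : (h : SL8) ∈ G2 := hh
        have hi := inv_mem hh
        simp only [Subgroup.coe_mul, _root_.mul_inv_rev, act_mul]
        rw [hi.2, hi.2, act_apply_zero_of_mem_SO7 (isLift_of_mem_G2 hi).1]
    refine ⟨τ, hτ, fun t => ?_⟩
    have h1 := so7_triple t
    rw [h]
    change Real.arsinh (octMul (octMul (act (so7g2.aSL t)⁻¹ (octE 2)) (act (so7g2.aSL t)⁻¹ (octE 4)))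
      (act (so7g2.aSL t)⁻¹ (octE 7)) 0).im / 3 = t
    rw [h1]
    have : (Complex.I * (Real.sinh (3 * t) : ℂ)).im = Real.sinh (3 * t) := by
      rw [Complex.mul_im, Complex.I_re, Complex.I_im, Complex.ofReal_re, Complex.ofReal_im]
      ring
    rw [this, Real.arsinh_sinh]
    ring
  | spin7g2 =>
    -- g e₀ depends only on the coset, and a_t e₀ has e₁-coordinate i sinh t.
    obtain ⟨τ, hτ, h⟩ := spin7g2.exists_continuous_lift
      (f := fun g => Real.arsinh (act (g : SL8) (octE 0) 1).im)
      (Real.continuous_arsinh.comp (Complex.continuous_im.comp ((continuous_apply 1).comp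
        (continuous_act _ _)))) fun g h hh => by
        rw [Subgroup.coe_mul, act_mul, act_octE_zero_of_mem_G2 hh]
    refine ⟨τ, hτ, fun t => ?_⟩
    rw [h]
    change Real.arsinh (act (spin7g2.aSL t) (octE 0) 1).im = t
    rw [act_spin7_aSL_zero]
    simp [octE, -Complex.ofReal_sinh]
  | g2sl3 =>
    obtain ⟨τ, hτ, h⟩ := g2sl3.exists_continuous_lift
      (f := fun g => Real.arsinh (act (g : SL8) (octE 1) 2).im)
      (Real.continuous_arsinh.comp (Complex.continuous_im.comp ((continuous_apply 2).comp
        (continuous_act _ _)))) fun g h hh => by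
        rw [Subgroup.coe_mul, act_mul, hh.2]
    refine ⟨τ, hτ, fun t => ?_⟩
    rw [h]
    change Real.arsinh (act (g2sl3.aSL t) (octE 1) 2).im = t
    rw [act_g2_aSL_one]
    simp [octE, -Complex.ofReal_sinh]

/-- The involution `σ₀` of `G_ℂ`. -/
def sigmaGC (P : RankOnePair) (g : P.GC) : P.GC := ⟨sigmaZero g, P.sigmaZero_mem_GC g.2⟩

theorem sigmaGC_mul (P : RankOnePair) (g h : P.GC) :
    P.sigmaGC (g * h) = P.sigmaGC g * P.sigmaGC h := Subtype.ext (sigmaZero_mul _ _)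

/-- The involution of `D` induced by `σ₀`. -/
def sigmaD (P : RankOnePair) : P.D → P.D :=
  Quotient.lift (fun g => P.proj (P.sigmaGC g)) fun a b hab => by
    have hab : QuotientGroup.leftRel (P.HC.subgroupOf P.GC) a b := hab
    rw [QuotientGroup.leftRel_apply, Subgroup.mem_subgroupOf] at hab
    have h1 : P.sigmaGC b = P.sigmaGC a * P.sigmaGC (a⁻¹ * b) := by
      rw [← sigmaGC_mul, mul_inv_cancel_left]
    rw [h1, ← smul_base, ← smul_base, mul_smul,
      P.smul_base_of_mem_HC (h := P.sigmaGC (a⁻¹ * b)) (P.sigmaZero_mem_HC hab)]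

theorem sigmaD_smul_base (P : RankOnePair) (g : P.GC) :
    P.sigmaD (g • P.base) = P.sigmaGC g • P.base := by
  rw [smul_base, smul_base]
  rfl

theorem sigmaD_sigmaD (P : RankOnePair) (x : P.D) : P.sigmaD (P.sigmaD x) = x := by
  obtain ⟨g, rfl⟩ := P.exists_smul_base x
  rw [sigmaD_smul_base, sigmaD_smul_base]
  congr 1
  exact Subtype.ext (sigmaZero_sigmaZero _)

theorem sigmaGC_aElt (P : RankOnePair) (t : ℝ) : P.sigmaGC (P.aElt t) = P.aElt t :=
  Subtype.ext (P.sigmaZero_aSL t)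

theorem sigmaGC_mem_Gu (P : RankOnePair) (k : P.Gu) : P.sigmaGC k ∈ P.Gu := by
  have hk : cartanInv ((k : P.GC) : SL8) = ((k : P.GC) : SL8) := k.2
  change cartanInv (sigmaZero ((k : P.GC) : SL8)) = sigmaZero ((k : P.GC) : SL8)
  rw [sigmaZero, map_mul, map_mul, cartanInv_Ipm, hk, hk]

/-- For x = k a h x₀ one gets σ(x) = σ₀(k) a x₀ = (σ₀(k) k⁻¹) x, and σ₀(k) is again in G_u. -/
theorem sigmaD_mem_orbit (P : RankOnePair) (x : P.D) : P.sigmaD x ∈ MulAction.orbit P.Gu x := by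
  obtain ⟨g, rfl⟩ := P.exists_smul_base x
  obtain ⟨k, t, h, hh, rfl⟩ := P.exists_cartan_GC g
  refine ⟨⟨P.sigmaGC k, P.sigmaGC_mem_Gu k⟩ * k⁻¹, ?_⟩
  rw [sigmaD_smul_base, sigmaGC_mul, sigmaGC_mul, sigmaGC_aElt, mul_smul _ (P.sigmaGC h),
    P.smul_base_of_mem_HC (h := P.sigmaGC h) (P.sigmaZero_mem_HC hh)]
  change (P.sigmaGC k * (k : P.GC)⁻¹) • ((k : P.GC) * P.aElt t * h) • P.base = _
  rw [mul_smul _ h, P.smul_base_of_mem_HC hh, ← mul_smul, mul_assoc, inv_mul_cancel_left]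

theorem exists_Gu_smul_slice (P : RankOnePair) (x : P.D) :
    ∃ k : P.Gu, ∃ s ∈ P.slice, x = k • s := by
  obtain ⟨g, rfl⟩ := P.exists_smul_base x
  obtain ⟨k, t, h, hh, rfl⟩ := P.exists_cartan_GC g
  refine ⟨k, P.aElt t • P.base, by rw [slice_eq]; exact ⟨t, rfl⟩, ?_⟩
  change _ = (k : P.GC) • P.aElt t • P.base
  rw [mul_smul _ h, P.smul_base_of_mem_HC hh, mul_smul]

/-- The real linear extension of `σ₀` to the space of matrices. -/
def sigmaMat : Matrix (Fin 8) (Fin 8) ℂ →L[ℝ] Matrix (Fin 8) (Fin 8) ℂ :=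
  LinearMap.toContinuousLinearMap
    { toFun := fun M => (Ipm : Matrix (Fin 8) (Fin 8) ℂ) * M.map (starRingEnd ℂ) * Ipm
      map_add' := fun M N => by
        rw [Matrix.map_add _ (map_add _), Matrix.mul_add, Matrix.add_mul]
      map_smul' := fun c M => by
        rw [RingHom.id_apply, ← Matrix.smul_mul, ← Matrix.mul_smul]
        congr 2
        ext i j
        simp }

theorem sigmaMat_smul (M : Matrix (Fin 8) (Fin 8) ℂ) :
    sigmaMat (Complex.I • M) = -(Complex.I • sigmaMat M) := by
  change (Ipm : Matrix (Fin 8) (Fin 8) ℂ) * (Complex.I • M).map (starRingEnd ℂ) * Ipm =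
    -(Complex.I • ((Ipm : Matrix (Fin 8) (Fin 8) ℂ) * M.map (starRingEnd ℂ) * Ipm))
  have h : (Complex.I • M).map (starRingEnd ℂ) = -(Complex.I • M.map (starRingEnd ℂ)) := by
    ext i j
    simp
  rw [h, Matrix.mul_neg, Matrix.neg_mul, Matrix.mul_smul, Matrix.smul_mul]

theorem matHom_sigmaGC (P : RankOnePair) (g : P.GC) :
    matHom P.GC (P.sigmaGC g) = sigmaMat (matHom P.GC g) := rfl

end RankOnePair

end HomogeneousSpace

/-! ### The manifold structures and the theorem -/

section Charts

open Matrix NormedSpace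
open scoped Matrix.Norms.Operator

theorem Submodule.exists_coordinates {𝕜 A : Type*} [RCLike 𝕜] [NormedAddCommGroup A]
    [NormedSpace 𝕜 A] [FiniteDimensional 𝕜 A] (M : Submodule 𝕜 A) :
    ∃ (d : ℕ) (L : (Fin d → 𝕜) →L[𝕜] A) (l : A →L[𝕜] (Fin d → 𝕜)),
      (∀ v, L v ∈ M) ∧ (∀ v, l (L v) = v) ∧ ∀ Y ∈ M, L (l Y) = Y := by
  obtain ⟨f, hf⟩ := M.subtype.exists_leftInverse_of_injective M.ker_subtype
  have hf : ∀ Y : M, f Y = Y := fun Y => LinearMap.congr_fun hf Y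
  let b := (Module.finBasis 𝕜 M).equivFun
  refine ⟨_, LinearMap.toContinuousLinearMap (M.subtype ∘ₗ b.symm.toLinearMap),
    LinearMap.toContinuousLinearMap (b.toLinearMap ∘ₗ f), fun v => (b.symm v).2, fun v => ?_,
    fun Y hY => ?_⟩
  · change b (f (b.symm v : M)) = v
    rw [hf, b.apply_symm_apply]
  · change ((b.symm (b (f Y)) : M) : A) = Y
    rw [b.symm_apply_apply, hf ⟨Y, hY⟩]

/-- Take C complementary to H ⊕ 𝕜Z and cut 𝕜Z ⊕ C down to K; the modular law gives the sum. It makes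
the generator of A a coordinate direction. -/
theorem Submodule.exists_complement_mem {𝕜 A : Type*} [Field 𝕜] [AddCommGroup A] [Module 𝕜 A]
    {H K : Submodule 𝕜 A} (hHK : H ≤ K) {Z : A} (hZ : Z ∈ K) (hZH : Z ∉ H) :
    ∃ M : Submodule 𝕜 A, Disjoint H M ∧ H ⊔ M = K ∧ Z ∈ M := by
  have hZ0 : Z ≠ 0 := fun h => hZH (h ▸ H.zero_mem)
  have hd : Disjoint H (𝕜 ∙ Z) := (Submodule.disjoint_span_singleton' hZ0).2 hZH
  obtain ⟨C, hC⟩ := exists_isCompl (H ⊔ 𝕜 ∙ Z)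
  have h1 : Disjoint H ((𝕜 ∙ Z) ⊔ C) := hd.disjoint_sup_right_of_disjoint_sup_left hC.disjoint
  refine ⟨((𝕜 ∙ Z) ⊔ C) ⊓ K, h1.mono_right inf_le_left, ?_, ?_, hZ⟩
  · rw [← sup_inf_assoc_of_le _ hHK, ← sup_assoc, hC.sup_eq_top, top_inf_eq]
  · exact Submodule.mem_sup_left (Submodule.mem_span_singleton_self Z)

theorem eq_zero_of_forall_exp_smul_eq_one {A : Type*} [NormedRing A] [NormedAlgebra ℝ A]
    [CompleteSpace A] {X : A} (h : ∀ t : ℝ, exp (t • X) = 1) : X = 0 := by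
  have h1 := hasDerivAt_exp_smul_const (𝕂 := ℝ) X 0
  simp only [h, one_mul] at h1
  exact h1.unique (hasDerivAt_const _ _)

namespace RankOnePair

theorem exists_charts_D (P : RankOnePair) : ∃ (d : ℕ) (_ : ChartedSpace (Fin d → ℂ) P.D),
    (∀ e ∈ atlas (Fin d → ℂ) P.D, IsSliceChart ℂ (matHom P.GC) P.base e) ∧
      IsRealSubmanifold d 1 P.slice := by
  have hS := isClosedLinearGroup_range P.isZeroLocus_GC.isClosed
  have hT := isClosedLinearGroup_range P.isZeroLocus_HC.isClosed
  have hTS : Set.range (matHom P.HC) ⊆ Set.range (matHom P.GC) := by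
    rintro _ ⟨h, rfl⟩
    exact ⟨⟨h, P.HC_le_GC h.2⟩, rfl⟩
  obtain ⟨K, hK⟩ := hS.exists_submodule (𝕜 := ℂ) fun c X hX =>
    P.isZeroLocus_GC.complex_smul_mem_lieSet c hX
  obtain ⟨H, hH⟩ := hT.exists_submodule (𝕜 := ℂ) fun c X hX =>
    P.isZeroLocus_HC.complex_smul_mem_lieSet c hX
  obtain ⟨τ, hτ, hτa⟩ := P.exists_separating
  have hgenK : P.gen ∈ K := (hK _).2 fun t => ⟨P.aElt t, rfl⟩
  -- Otherwise a₁ would fix the base point, where τ would have to be both 1 and 0.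
  have hgenH : P.gen ∉ H := fun h => by
    have h1 := (P.smul_base_eq_base_iff (P.aElt 1)).2 ((hH _).1 h 1)
    have h2 := hτa 1
    have h3 := hτa 0
    rw [aElt_zero, one_smul] at h3
    rw [h1, h3] at h2
    exact zero_ne_one h2
  have hHK : H ≤ K := fun X hX => (hK X).2 fun t => hTS ((hH X).1 hX t)
  obtain ⟨M, hHM, hsup, hgenM⟩ := Submodule.exists_complement_mem hHK hgenK hgenH
  obtain ⟨d, L, l, hLM, hlL, hLl⟩ := M.exists_coordinates
  obtain ⟨ψ, hψ, hψs, hψ0, hψe⟩ := exists_isSliceChart (isInducing_matHom P.GC) hS hT hTS hK hH hHM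
    hsup hLM hlL hLl P.smul_base_eq_base_iff P.continuous_smul_base P.isOpenMap_smul_base
  let cs : ChartedSpace (Fin d → ℂ) P.D := homogeneousChartedSpace ψ hψs P.exists_smul_base
  have hatlas : ∀ e ∈ atlas (Fin d → ℂ) P.D, IsSliceChart ℂ (matHom P.GC) P.base e := by
    rintro _ ⟨g, rfl⟩
    exact hψ.translate g
  refine ⟨d, cs, hatlas, ?_⟩
  have : IsManifold 𝓘(ℝ, Fin d → ℂ) ω P.D := isManifold_of_isSliceChart (𝕜 := ℝ)
    (isInducing_matHom P.GC) fun e he => (hatlas e he).restrictScalars ℝ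
  have : IsManifold 𝓘(ℝ, Fin d → ℂ) ∞ P.D := IsManifold.of_le (n := ω) le_top
  rw [slice_eq]
  refine isRealSubmanifold_range_smul hψs hψ0 (fun g => Set.mem_range_self g) P.aElt_add (u := l P.gen)
    (fun h => hgenH ?_) (fun t ht => hψe _ ht _ ?_) hτ hτa
  · rw [← hLl _ hgenM, h, map_zero]
    exact H.zero_mem
  · rw [matHom_aElt, L.map_smul_of_tower, hLl _ hgenM]
    rfl

/-- The slice construction with trivial subgroup: T = {1}, H = 0, and the whole real Lie algebra as
complement. -/
theorem exists_charts_Gu (P : RankOnePair) : ∃ (m : ℕ) (_ : ChartedSpace (Fin m → ℝ) P.Gu),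
    ∀ e ∈ atlas (Fin m → ℝ) P.Gu, IsSliceChart ℝ P.guHom (1 : P.Gu) e := by
  have hS := isClosedLinearGroup_range P.isClosed_range_guHom
  have hT : IsClosedLinearGroup ({1} : Set (Matrix (Fin 8) (Fin 8) ℂ)) :=
    { one_mem := rfl
      mul_mem := by rintro _ rfl _ rfl; exact mul_one 1
      inv_mem := by rintro _ rfl b hb; rwa [one_mul] at hb
      isClosed := isClosed_singleton }
  obtain ⟨K, hK⟩ := hS.exists_submodule (𝕜 := ℝ) fun c X hX => smul_mem_lieSet hX c
  have hH : ∀ X, X ∈ (⊥ : Submodule ℝ (Matrix (Fin 8) (Fin 8) ℂ)) ↔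
      X ∈ lieSet ({1} : Set (Matrix (Fin 8) (Fin 8) ℂ)) := fun X => by
    rw [Submodule.mem_bot]
    constructor
    · rintro rfl t
      rw [smul_zero, exp_zero]
      rfl
    · intro h
      exact eq_zero_of_forall_exp_smul_eq_one h
  obtain ⟨d, L, l, hLM, hlL, hLl⟩ := K.exists_coordinates
  have hid : (fun g : P.Gu => g • (1 : P.Gu)) = id := funext fun g => mul_one g
  have hstab : ∀ g : P.Gu, g • (1 : P.Gu) = 1 ↔
      P.guHom g ∈ ({1} : Set (Matrix (Fin 8) (Fin 8) ℂ)) := fun g => by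
    rw [smul_eq_mul, mul_one]
    exact ⟨fun h => h ▸ map_one _, fun h => Subtype.ext (Subtype.ext (Subtype.ext h))⟩
  obtain ⟨ψ, hψ, hψs, -⟩ := exists_isSliceChart P.isInducing_guHom hS hT
    (by rintro _ rfl; exact ⟨1, map_one _⟩) hK hH disjoint_bot_left (bot_sup_eq K) hLM hlL hLl
    (x₀ := (1 : P.Gu)) hstab (hid ▸ continuous_id) (hid ▸ IsOpenMap.id)
  refine ⟨d, homogeneousChartedSpace ψ hψs fun x => ⟨x, mul_one x⟩, ?_⟩
  rintro _ ⟨g, rfl⟩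
  exact hψ.translate g

end RankOnePair

end Charts

/-! ### Assembly of the theorem -/

section Main

open Matrix
open scoped Matrix.Norms.Operator

namespace RankOnePair

variable (P : RankOnePair) {d m : ℕ} [ChartedSpace (Fin d → ℂ) P.D] [ChartedSpace (Fin m → ℝ) P.Gu]

/-- Beyond `mdifferentiableOn_iff_analytic_pullback` only the ambient space changes, from the normed
algebra of matrices to families of entries. -/
theorem isQuotientComplexStructure
    (hD : ∀ e ∈ atlas (Fin d → ℂ) P.D, IsSliceChart ℂ (matHom P.GC) P.base e) :
    IsQuotientComplexStructure P d := by
  refine ⟨isManifold_of_isSliceChart (isInducing_matHom P.GC) hD, fun U hU f => ?_⟩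
  rw [mdifferentiableOn_iff_analytic_pullback (isInducing_matHom P.GC) P.continuous_smul_base hD hU]
  simp only [smul_base]
  refine forall₂_congr fun g _ => ⟨?_, ?_⟩
  · rintro ⟨F, hF, he⟩
    exact ⟨fun M => F (entriesEquiv ℂ M), hF.comp_of_eq
      ((entriesEquiv ℂ).toContinuousLinearMap.analyticAt _) rfl, he⟩
  · rintro ⟨F, hF, he⟩
    exact ⟨fun M => F ((entriesEquiv ℂ).symm M), hF.comp_of_eq
      ((entriesEquiv ℂ).symm.toContinuousLinearMap.analyticAt _) rfl, he⟩

theorem isLieSubgroupStructure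
    (hK : ∀ e ∈ atlas (Fin m → ℝ) P.Gu, IsSliceChart ℝ P.guHom (1 : P.Gu) e) :
    IsLieSubgroupStructure P m :=
  ⟨lieGroup_of_isSliceChart P.isInducing_guHom hK ∞,
    (entriesEquiv ℝ).symm.toContinuousLinearMap.contMDiff.comp
      (contMDiff_of_isSliceChart P.isInducing_guHom hK ∞)⟩

theorem isHolomorphicLieAction
    (hD : ∀ e ∈ atlas (Fin d → ℂ) P.D, IsSliceChart ℂ (matHom P.GC) P.base e)
    (hK : ∀ e ∈ atlas (Fin m → ℝ) P.Gu, IsSliceChart ℝ P.guHom (1 : P.Gu) e) :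
    IsHolomorphicLieAction d m P.D P.Gu where
  lieGroup := lieGroup_of_isSliceChart P.isInducing_guHom hK ∞
  smooth := contMDiff_hom_smul (isInducing_matHom P.GC) P.continuous_smul_base hD
    (φ := fun k : P.Gu => (k : P.GC)) (contMDiff_of_isSliceChart P.isInducing_guHom hK ∞)
  holomorphic g := mdifferentiable_const_smul (isInducing_matHom P.GC) P.continuous_smul_base hD
    (g : P.GC)

/-- The diffeomorphism of `D` induced by `σ₀`. -/
def sigmaDiffeomorph
    (hD : ∀ e ∈ atlas (Fin d → ℂ) P.D, IsSliceChart ℂ (matHom P.GC) P.base e) :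
    Diffeomorph 𝓘(ℝ, Fin d → ℂ) 𝓘(ℝ, Fin d → ℂ) P.D P.D ∞ where
  toEquiv := (show Function.Involutive P.sigmaD from P.sigmaD_sigmaD).toPerm
  contMDiff_toFun := contMDiff_of_semiequivariant (isInducing_matHom P.GC) P.continuous_smul_base hD
    P.matHom_sigmaGC P.sigmaD_smul_base ∞
  contMDiff_invFun := contMDiff_of_semiequivariant (isInducing_matHom P.GC) P.continuous_smul_base hD
    P.matHom_sigmaGC P.sigmaD_smul_base ∞

theorem isStronglyVisibleVia
    (hD : ∀ e ∈ atlas (Fin d → ℂ) P.D, IsSliceChart ℂ (matHom P.GC) P.base e)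
    (hK : ∀ e ∈ atlas (Fin m → ℝ) P.Gu, IsSliceChart ℝ P.guHom (1 : P.Gu) e)
    (hsub : IsRealSubmanifold d 1 P.slice) :
    IsStronglyVisibleVia d m P.Gu 1 P.slice (P.sigmaDiffeomorph hD) where
  complexManifold := ⟨(P.isQuotientComplexStructure hD).1, inferInstance, inferInstance, inferInstance⟩
  holomorphicAction := P.isHolomorphicLieAction hD hK
  submanifold := hsub
  antiholomorphic := mfderiv_of_semiequivariant (isInducing_matHom P.GC) P.continuous_smul_base hD
    sigmaMat_smul P.matHom_sigmaGC P.sigmaD_smul_base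
  meets_orbits := P.exists_Gu_smul_slice
  fixes_slice := by
    rw [slice_eq]
    rintro _ ⟨t, rfl⟩
    exact (P.sigmaD_smul_base _).trans (by rw [sigmaGC_aElt])
  preserves_orbits := P.sigmaD_mem_orbit

end RankOnePair

end Main

end

/-- For every reductive spherical pair of rank-one type, the action of the compact group `G_u` on
`D = G_ℂ / H_ℂ` is strongly visible; the slice is the one-dimensional submanifold `S = A H_ℂ / H_ℂ`
coming from the Cartan decomposition `G_ℂ = G_u A H_ℂ`, and the anti-holomorphic diffeomorphism
`σ` of `D` is induced by `σ₀`. -/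
theorem theorem6p1 (P : RankOnePair) :
    P.HC ≤ P.GC ∧ CompactSpace P.Gu ∧
    (∀ t : ℝ, ∃ a ∈ P.GC, (a : Matrix (Fin 8) (Fin 8) ℂ) = P.aMat t) ∧
    (∀ g : P.GC, ∃ k ∈ P.Gu, ∃ a : P.GC, (a : SL8) ∈ P.A ∧
      ∃ h : P.GC, (h : SL8) ∈ P.HC ∧ g = k * a * h) ∧
    ∃ (d m : ℕ) (_ : ChartedSpace (Fin d → ℂ) P.D) (_ : ChartedSpace (Fin m → ℝ) P.Gu),
      IsQuotientComplexStructure P d ∧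
      IsLieSubgroupStructure P m ∧
      IsStronglyVisible d m P.D P.Gu ∧
      ∃ σ : Diffeomorph 𝓘(ℝ, Fin d → ℂ) 𝓘(ℝ, Fin d → ℂ) P.D P.D ∞,
        IsStronglyVisibleVia d m P.Gu 1 P.slice σ ∧
        ∀ g : P.GC, ∃ hg : sigmaZero g ∈ P.GC,
          σ (P.proj g) = P.proj ⟨sigmaZero g, hg⟩ := by
  refine ⟨P.HC_le_GC, inferInstance, fun t => ⟨_, P.aSL_mem_GC t, P.coe_aSL t⟩, fun g => ?_, ?_⟩
  · obtain ⟨k, t, h, hh, rfl⟩ := P.exists_cartan_GC g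
    exact ⟨k, k.2, P.aElt t, (P.mem_A_iff _).2 ⟨t, rfl⟩, h, hh, rfl⟩
  · obtain ⟨d, csD, hD, hsub⟩ := P.exists_charts_D
    obtain ⟨m, csK, hK⟩ := P.exists_charts_Gu
    have h := P.isStronglyVisibleVia hD hK hsub
    exact ⟨d, m, csD, csK, P.isQuotientComplexStructure hD, P.isLieSubgroupStructure hK,
      ⟨1, P.slice, _, h⟩, _, h, fun g => ⟨P.sigmaZero_mem_GC g.2, rfl⟩⟩
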